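/- An \emph{ideal tetrahedron} is a tetrahedron (with barycentric coordinates $x_0,\dots,x_3$) with its four vertices removed. Let $M$ be a topological $3$-manifold with a cellulation $\mathcal{C}$ by ideal tetrahedra, i.e. $M$ is identified with the quotient space of a finite disjoint union of ideal tetrahedra by simplicial isomorphisms identifying their faces in pairs, no face being glued to itself. Let $D\subseteq M$ be the $2$-skeleton of the dual cellulation: the set of points which, in some tetrahedron, have a largest barycentric coordinate that is attained at least twice. Then: 1. $M$ (strongly) deformation retracts onto $D$; in particular $D$ is homotopy equivalent to $M$. 2. $D$ is a $2$-dimensional CW complex with exactly one $0$-cell for each tetrahedron (its barycenter), one $1$-cell for each pair of glued faces (the open dual edge consisting of the two segments from the barycenter of that face to the barycenters of the two tetrahedra at it), and one $2$-cell for each edge of $\mathcal{C}$ (in each tetrahedron edge of this class, the points whose coordinates at the two endpoints of that edge are equal and larger than the other two). 3. Let $\mathcal{T}$ be any spanning tree of the $1$-skeleton of $D$ (a multigraph, possibly with loops and multiple edges), let $t_0$ be any vertex, and choose an orientation of every edge of $D$. For every $2$-cell $c$, choose a starting corner and a direction of rotation around the corresponding edge of $\mathcal{C}$, and let $r_c$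 be the word read along the boundary of $c$, that is, along the cycle of dual edges which crosses successively the faces met in one turn around that edge, where edges of $\mathcal{T}$ are read as $1$ and a dual edge $e\notin\mathcal{T}$ as $e$ or $e^{-1}$ according to its orientation. Then $$\pi_1(M,t_0)\;\cong\;\bigl\langle\, e \text{ an edge of } D\setminus\mathcal{T}\;\big|\; r_c,\ c \text{ a 2-cell of } D\,\bigr\rangle ,$$ by an isomorphism under which each generator $e$ corresponds to the class of the loop that runs in $\mathcal{T}$ from $t_0$ to the start of $e$, then along $e$, and then in $\mathcal{T}$ back to $t_0$. -/

import Mathlib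

noncomputable section

/-- The ideal tetrahedron: the standard 3-simplex (in barycentric coordinates) with its four
vertices removed. Face `f` is the face `x f = 0` opposite to vertex `f`. -/
def idealTetrahedron : Set (Fin 4 → ℝ) :=
  {x | x ∈ stdSimplex ℝ (Fin 4) ∧ ∀ i, x i < 1}

namespace idealTetrahedron

theorem convex : Convex ℝ idealTetrahedron := by
  intro x hx y hy a b ha hb hab
  refine ⟨convex_stdSimplex ℝ (Fin 4) hx.1 hy.1 ha hb hab, fun i => ?_⟩
  have h : a • x i + b • y i ∈ Set.Iio (1 : ℝ) := convex_Iio 1 (hx.2 i) (hy.2 i) ha hb hab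
  simpa using h

/-- Relabelling the vertices: the coordinate of `x` at `v` becomes the coordinate at `σ v`. -/
def permute (σ : Equiv.Perm (Fin 4)) (x : idealTetrahedron) : idealTetrahedron :=
  ⟨fun v => x.1 (σ.symm v), ⟨fun v => x.2.1.1 _, by
    rw [← x.2.1.2]; exact Equiv.sum_comp σ.symm x.1⟩, fun v => x.2.2 _⟩

/-- The barycenter of the tetrahedron. -/
def center : idealTetrahedron :=
  ⟨fun _ => 1 / 4, ⟨fun _ => by norm_num, by norm_num⟩, fun _ => by norm_num⟩

/-- The barycenter of the face opposite to vertex `f`. -/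
def faceCenter (f : Fin 4) : idealTetrahedron :=
  ⟨fun v => if v = f then 0 else 1 / 3,
    ⟨fun v => by dsimp only; split_ifs <;> norm_num,
      by
      rw [Finset.sum_ite, Finset.sum_const_zero, Finset.sum_const, Finset.filter_ne', Finset.card_erase_of_mem (Finset.mem_univ f)]
      norm_num⟩,
    fun v => by dsimp only; split_ifs <;> norm_num⟩

theorem permute_faceCenter (σ : Equiv.Perm (Fin 4)) (f : Fin 4) :
    permute σ (faceCenter f) = faceCenter (σ f) := by
  apply Subtype.ext
  funext v
  simp only [permute, faceCenter, Equiv.symm_apply_eq]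

/-- The straight path between two points of the ideal tetrahedron. -/
def segmentPath (x y : idealTetrahedron) : Path x y where
  toFun s := ⟨AffineMap.lineMap x.1 y.1 (s : ℝ), convex.lineMap_mem x.2 y.2 s.2⟩
  continuous_toFun := by
    refine Continuous.subtype_mk ?_ _
    exact AffineMap.lineMap_continuous.comp continuous_subtype_val
  source' := by simp
  target' := by simp

end idealTetrahedron

/-- Gluing data: the faces of a family `T` of tetrahedra are identified in pairs by simplicial
isomorphisms. Face `f` of `t` is glued to face `perm t f f` of `glue t f`, each vertex `v ≠ f` of
the face being sent to the vertex `perm t f v`. No face is glued to itself. -/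
structure FacePairing (T : Type*) where
  glue : T → Fin 4 → T
  perm : T → Fin 4 → Equiv.Perm (Fin 4)
  glue_glue : ∀ t f, glue (glue t f) (perm t f f) = t
  perm_perm : ∀ t f, perm (glue t f) (perm t f f) = (perm t f).symm
  no_self_gluing : ∀ t f, glue t f = t → perm t f f ≠ f

namespace FacePairing

variable {T : Type*} (P : FacePairing T)

/-- The identifications of points on faces. -/
inductive FaceRel : (Σ _ : T, idealTetrahedron) → (Σ _ : T, idealTetrahedron) → Prop
  | glue (t : T) (f : Fin 4) (x : idealTetrahedron) (hx : x.1 f = 0) :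
      FaceRel ⟨t, x⟩ ⟨P.glue t f, idealTetrahedron.permute (P.perm t f) x⟩

/-- The space obtained from the disjoint union of the ideal tetrahedra by gluing their faces,
with the quotient topology. -/
def Space : Type _ := Quot P.FaceRel

instance : TopologicalSpace P.Space := inferInstanceAs (TopologicalSpace (Quot P.FaceRel))

/-- The other side `(t', f')` of a face `(t, f)`. -/
def opp (a : T × Fin 4) : T × Fin 4 := (P.glue a.1 a.2, P.perm a.1 a.2 a.2)

/-- An unoriented edge of the dual 1-skeleton is a pair of glued faces. A face `(t, f)` stands for
the oriented dual edge which leaves `t` through its face `f`. -/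
def DualEdge : Type _ := Quot fun a b : T × Fin 4 => b = P.opp a

/-- The unoriented dual edge through a face. -/
def dualEdge (a : T × Fin 4) : P.DualEdge := Quot.mk _ a

/-- Walks in the dual 1-skeleton, whose vertices are the tetrahedra. -/
inductive Walk : T → T → Type _
  | nil (t : T) : Walk t t
  | cons {s t : T} (f : Fin 4) (w : Walk (P.glue s f) t) : Walk s t

/-- The list of unoriented dual edges traversed by a walk. -/
def Walk.edges {P : FacePairing T} : {s t : T} → P.Walk s t → List P.DualEdge
  | _, _, .nil _ => []
  | s, _, .cons f w => P.dualEdge (s, f) :: w.edges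

/-- A spanning tree of the dual 1-skeleton, given by its set of edges: it connects all vertices
and contains no closed walk of positive length with pairwise distinct edges. -/
structure IsSpanningTree (S : Set P.DualEdge) : Prop where
  connected : ∀ s t, ∃ w : P.Walk s t, ∀ e ∈ w.edges, e ∈ S
  acyclic : ∀ (t : T) (w : P.Walk t t), (∀ e ∈ w.edges, e ∈ S) → w.edges.Nodup → w.edges = []

/-- An edge of a tetrahedron `tet`, given as the intersection of the two faces `enter` and `exit`
which contain it, together with a direction of rotation about it, from `enter` to `exit`. -/
@[ext]
structure Corner (T : Type*) where
  tet : T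
  enter : Fin 4
  exit : Fin 4
  ne : enter ≠ exit

/-- The same tetrahedron edge with the opposite direction of rotation. -/
def Corner.swap (c : Corner T) : Corner T := ⟨c.tet, c.exit, c.enter, c.ne.symm⟩

/-- Rotate about the edge into the next tetrahedron, through the face `exit`. -/
def step (c : Corner T) : Corner T where
  tet := P.glue c.tet c.exit
  enter := P.perm c.tet c.exit c.exit
  exit := P.perm c.tet c.exit c.enter
  ne := fun h => c.ne ((P.perm c.tet c.exit).injective h).symm

/-- The edges of the triangulation (classes of tetrahedron edges under the gluings); these index
the dual 2-cells. -/
def DualFace : Type _ := Quot fun c d : Corner T => d = P.step c ∨ d = c.swap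

/-- The dual 2-cell around a tetrahedron edge. -/
def dualFace (c : Corner T) : P.DualFace := Quot.mk _ c

/-- The walk which crosses `n` successive faces around a tetrahedron edge. -/
def rotationWalk : (n : ℕ) → (c : Corner T) → P.Walk c.tet (P.step^[n] c).tet
  | 0, c => .nil c.tet
  | n + 1, c => .cons c.exit (rotationWalk n (P.step c))

section Presentation

variable (S : Set P.DualEdge) (orient : P.DualEdge → T × Fin 4)

open Classical in
/-- The letter of an oriented dual edge, in the free group on the edges outside `S`: edges of `S`
are trivial, the others are generators or their inverses, according to the chosen orientations. -/
def letter (a : T × Fin 4) : FreeGroup {e : P.DualEdge // e ∉ S} :=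
  if h : P.dualEdge a ∈ S then 1
  else if orient (P.dualEdge a) = a then FreeGroup.of ⟨P.dualEdge a, h⟩
  else (FreeGroup.of ⟨P.dualEdge a, h⟩)⁻¹

/-- The word read along a walk. It is written from right to left, since in Mathlib the product
`p * q` in the fundamental group is the loop `q` followed by the loop `p`. -/
def word : {s t : T} → P.Walk s t → FreeGroup {e : P.DualEdge // e ∉ S}
  | _, _, .nil _ => 1
  | s, _, .cons f w => word w * P.letter S orient (s, f)

/-- One relator for each dual 2-cell: the word read along its boundary, which goes once around the
edge of the triangulation, starting at a chosen corner. -/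
def relators (corner : P.DualFace → Corner T) : Set (FreeGroup {e : P.DualEdge // e ∉ S}) :=
  Set.range fun c : P.DualFace =>
    P.word S orient (P.rotationWalk (Function.minimalPeriod P.step (corner c)) (corner c))

end Presentation

end FacePairing

/-- A cellulation of `M` by ideal tetrahedra: an identification of `M` with the space obtained by
gluing a family `T` of ideal tetrahedra along their faces. -/
structure IdealCellulation (M : Type*) [TopologicalSpace M] (T : Type*) extends FacePairing T where
  homeo : toFacePairing.Space ≃ₜ M

namespace IdealCellulation

open idealTetrahedron

variable {M : Type*} [TopologicalSpace M] {T : Type*} (𝒞 : IdealCellulation M T)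

/-- The point of `M` with barycentric coordinates `x` in the tetrahedron `t`. -/
def point (t : T) (x : idealTetrahedron) : M := 𝒞.homeo (Quot.mk _ ⟨t, x⟩)

theorem continuous_point (t : T) : Continuous (𝒞.point t) :=
  𝒞.homeo.continuous.comp (continuous_quot_mk.comp continuous_sigmaMk)

theorem point_eq (t : T) (f : Fin 4) (x : idealTetrahedron) (hx : x.1 f = 0) :
    𝒞.point t x = 𝒞.point (𝒞.glue t f) (permute (𝒞.perm t f) x) :=
  congrArg 𝒞.homeo (Quot.sound (.glue t f x hx))

/-- The 2-skeleton `D` of the dual cellulation. In each tetrahedron it is the union of the simplices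
of the barycentric subdivision that avoid the ideal vertices, that is, the set of points whose
largest barycentric coordinate occurs at least twice. -/
def dualSkeleton : Set M :=
  {m | ∃ t x, 𝒞.point t x = m ∧ ∃ i j, i ≠ j ∧ x.1 i = x.1 j ∧ ∀ k, x.1 k ≤ x.1 i}

/-- The dual vertex of a tetrahedron: its barycenter. -/
def dualVertex (t : T) : M := 𝒞.point t center

/-- The open dual edge through the face `f` of `t` and the face glued to it: in both tetrahedra the
half-open segment from the barycenter (excluded) to the barycenter of the face. -/
def openDualEdge (e : 𝒞.DualEdge) : Set M :=
  {m | ∃ t x, 𝒞.point t x = m ∧ ∃ f, 𝒞.dualEdge (t, f) = e ∧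
    (∀ i j, i ≠ f → j ≠ f → x.1 i = x.1 j) ∧ ∀ i, i ≠ f → x.1 f < x.1 i}

/-- The open dual 2-cell around an edge of the triangulation: in each tetrahedron edge of the class,
the points at which the coordinates of its two endpoints are equal and exceed the other two. -/
def openDualFace (c : 𝒞.DualFace) : Set M :=
  {m | ∃ t x, 𝒞.point t x = m ∧ ∃ k l, ∃ h : k ≠ l, 𝒞.dualFace ⟨t, k, l, h⟩ = c ∧
    (∀ i j, i ≠ k → i ≠ l → j ≠ k → j ≠ l → x.1 i = x.1 j) ∧
    ∀ i, i ≠ k → i ≠ l → x.1 k < x.1 i ∧ x.1 l < x.1 i}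

theorem point_faceCenter (t : T) (f : Fin 4) :
    𝒞.point t (faceCenter f) = 𝒞.point (𝒞.glue t f) (faceCenter (𝒞.perm t f f)) := by
  rw [𝒞.point_eq t f _ (by simp [faceCenter]), permute_faceCenter]

/-- The straight path from the barycenter of `t` to the barycenter of its face `f`. -/
def halfEdgePath (t : T) (f : Fin 4) : Path (𝒞.dualVertex t) (𝒞.point t (faceCenter f)) :=
  (segmentPath center (faceCenter f)).map (𝒞.continuous_point t)

/-- The dual edge which leaves `t` through its face `f`, as a path. -/
def edgePath (t : T) (f : Fin 4) : Path (𝒞.dualVertex t) (𝒞.dualVertex (𝒞.glue t f)) :=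
  (𝒞.halfEdgePath t f).trans
    ((𝒞.halfEdgePath (𝒞.glue t f) (𝒞.perm t f f)).symm.cast (𝒞.point_faceCenter t f) rfl)

/-- The path in `M` which follows a walk in the dual 1-skeleton. -/
def walkPath : {s t : T} → 𝒞.Walk s t → Path (𝒞.dualVertex s) (𝒞.dualVertex t)
  | _, _, .nil _ => Path.refl _
  | s, _, .cons f w => (𝒞.edgePath s f).trans (walkPath w)

end IdealCellulation

/-- `D` is a (strong) deformation retract of `M`. -/
def IsDeformationRetract {M : Type*} [TopologicalSpace M] (D : Set M) : Prop :=
  ∃ r : C(M, M), (∀ m, r m ∈ D) ∧ (ContinuousMap.id M).HomotopicRel r D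

end

noncomputable section

open Topology

/-! ### Gluing combinatorics: dual edges and rotation about edges -/

namespace idealTetrahedron

/-! A map of the tetrahedron that commutes with relabelling the vertices and keeps vanishing
coordinates zero descends to `M`. The retraction is of this kind: cut off the coordinates at the
second largest one and renormalise. Since the vertices are missing, two coordinates are positive and
the result is again no vertex; straight lines give the homotopy.

For the cell structure, the set `low x` of vertices whose coordinate is not maximal tells which open
cell contains a point, compatibly with the gluings. A 1-cell consists of two spokes. A 2-cell is a
wheel of sectors, one for each step of a full turn about an edge. The wheel is an embedded open disc
because a rotation never comes back to the same tetrahedron edge in the reversed direction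
(`stepPerm_zpow_ne_swap`), which rests on the absence of self-glued faces. Characteristic maps are
obtained by dividing compact parameter spaces by the identifications of polar coordinates.

For the presentation, tree paths turn every oriented dual edge into a loop (`edgeLoop`), and such a
loop is the transition function between the two ways of approaching a point of a face. Going once
around an edge returns to the original approach path of its barycenter, so the relators hold
(`hol_edgeLoop_rotationWalk`). The open stars of the open faces are contractible and cover `M`;
cutting a path into pieces inside stars shows that the loops generate (`isCarried`). That there are
no other relations is seen from a covering space: take one copy of each tetrahedron for every
element of the presented group, and let crossing a dual edge multiply the index by its letter. The
relators make turns about edges close up, so this is a covering (`isQuotientCoveringMap_coverProj`).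
The lift of a walk ends in the sheet given by its word, hence a closed walk that is null-homotopic
has trivial word (`hol_eq_of_mk_walkPath_eq`). -/

theorem permute_symm_permute (σ : Equiv.Perm (Fin 4)) (x : idealTetrahedron) :
    permute σ.symm (permute σ x) = x := by
  apply Subtype.ext
  funext v
  simp [permute]

@[simp]
theorem permute_apply (σ : Equiv.Perm (Fin 4)) (x : idealTetrahedron) (v : Fin 4) :
    (permute σ x).1 v = x.1 (σ.symm v) := rfl

theorem continuous_coord (i : Fin 4) : Continuous fun x : idealTetrahedron => x.1 i :=
  (continuous_apply i).comp continuous_subtype_val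

theorem nonneg (x : idealTetrahedron) (i : Fin 4) : 0 ≤ x.1 i := x.2.1.1 i

theorem sum_eq_one (x : idealTetrahedron) : x.1 0 + x.1 1 + x.1 2 + x.1 3 = 1 := by
  rw [← x.2.1.2, Fin.sum_univ_four]

end idealTetrahedron

namespace FacePairing

variable {T : Type*} (P : FacePairing T)

theorem opp_opp (a : T × Fin 4) : P.opp (P.opp a) = a := by
  ext1
  · exact P.glue_glue _ _
  · simp [opp, P.perm_perm]

theorem opp_ne (a : T × Fin 4) : P.opp a ≠ a := fun h =>
  P.no_self_gluing a.1 a.2 (congrArg Prod.fst h) (congrArg Prod.snd h)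

theorem dualEdge_opp (a : T × Fin 4) : P.dualEdge (P.opp a) = P.dualEdge a :=
  (Quot.sound (r := fun a b => b = P.opp a) rfl).symm

/-- As `opp` is an involution, a class has no members besides a face and its other side. -/
theorem dualEdge_eq_iff {a b : T × Fin 4} : P.dualEdge a = P.dualEdge b ↔ b = a ∨ b = P.opp a := by
  constructor
  · intro h
    have := Quot.eqvGen_exact h
    clear h
    induction this with
    | rel x y h => exact .inr h
    | refl x => exact .inl rfl
    | symm x y _ ih =>
      rcases ih with rfl | rfl
      · exact .inl rfl
      · exact .inr (P.opp_opp _).symm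
    | trans x y z _ _ h₁ h₂ =>
      rcases h₁ with rfl | rfl <;> rcases h₂ with rfl | rfl <;> simp [opp_opp]
  · rintro (rfl | rfl)
    · rfl
    · exact (P.dualEdge_opp a).symm

theorem faceRel_symm {a b : Σ _ : T, idealTetrahedron} (h : P.FaceRel a b) : P.FaceRel b a := by
  obtain ⟨t, f, x, hx⟩ := h
  have h := FaceRel.glue (P := P) (P.glue t f) (P.perm t f f)
    (idealTetrahedron.permute (P.perm t f) x) (by simpa using hx)
  rwa [P.glue_glue, P.perm_perm, idealTetrahedron.permute_symm_permute] at h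

namespace Corner

@[simp] theorem swap_swap (c : Corner T) : c.swap.swap = c := rfl

theorem swap_ne (c : Corner T) : c.swap ≠ c := fun h => c.ne (congrArg Corner.exit h)

end Corner

/-- Crossing a face and turning back through it undoes the step. Thus `swap` conjugates the rotation
to its inverse, and the two generate a dihedral action. -/
theorem step_swap_step (c : Corner T) : P.step (P.step c).swap = c.swap := by
  ext1
  · exact P.glue_glue _ _
  · simp [step, Corner.swap, P.perm_perm]
  · simp [step, Corner.swap, P.perm_perm]

/-- Rotation about the edges of the triangulation, as a permutation of the corners. -/
@[simps apply]
def stepPerm : Equiv.Perm (Corner T) where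
  toFun := P.step
  invFun c := (P.step c.swap).swap
  left_inv c := congrArg Corner.swap (P.step_swap_step c)
  right_inv c := P.step_swap_step c.swap

theorem stepPerm_zpow_swap (c : Corner T) (m : ℤ) :
    (P.stepPerm ^ m) c.swap = ((P.stepPerm ^ (-m)) c).swap := by
  have key : ∀ (m : ℕ) (c : Corner T),
      (P.stepPerm ^ (m : ℤ)) c.swap = ((P.stepPerm ^ (-m : ℤ)) c).swap := by
    intro m
    induction m with
    | zero => intro c; simp
    | succ m ih =>
      intro c
      have h : P.stepPerm c.swap = ((P.stepPerm⁻¹) c).swap := by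
        change P.step c.swap = ((P.step c.swap).swap).swap
        rfl
      rw [Nat.cast_succ, zpow_add_one, Equiv.Perm.mul_apply, h, ih, ← zpow_neg_one,
        ← Equiv.Perm.mul_apply, ← zpow_add, neg_add]
  obtain ⟨k, rfl | rfl⟩ := m.eq_nat_or_neg
  · exact key k c
  · have := key k ((P.stepPerm ^ (k : ℤ)) c)
    rw [← Equiv.Perm.mul_apply, ← zpow_add, neg_add_cancel, zpow_zero, Equiv.Perm.one_apply] at this
    rw [← this, ← Equiv.Perm.mul_apply, ← zpow_add, neg_add_cancel, neg_neg]
    rfl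

/-- Stop halfway. For even `m` the corner found there equals its own reverse, which is absurd. For
odd `m` it satisfies `step d = d.swap`, so its face `exit` is glued to itself. -/
theorem stepPerm_zpow_ne_swap (c : Corner T) (m : ℤ) : (P.stepPerm ^ m) c ≠ c.swap := by
  intro h
  obtain ⟨k, rfl | rfl⟩ := m.even_or_odd'
  · have h2 := congrArg (P.stepPerm ^ (-k)) h
    rw [P.stepPerm_zpow_swap, neg_neg, ← Equiv.Perm.mul_apply, ← zpow_add] at h2
    rw [show -k + 2 * k = k by ring] at h2
    exact Corner.swap_ne _ h2.symm
  · have h2 := congrArg (P.stepPerm ^ (-k)) h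
    rw [P.stepPerm_zpow_swap, neg_neg, ← Equiv.Perm.mul_apply, ← zpow_add] at h2
    rw [show -k + (2 * k + 1) = 1 + k by ring, zpow_add, Equiv.Perm.mul_apply, zpow_one,
      stepPerm_apply] at h2
    set d := (P.stepPerm ^ k) c
    exact P.no_self_gluing d.tet d.exit (congrArg Corner.tet h2) (congrArg Corner.enter h2)

theorem dualFace_step (c : Corner T) : P.dualFace (P.step c) = P.dualFace c :=
  (Quot.sound (.inl rfl)).symm

theorem dualFace_swap (c : Corner T) : P.dualFace c.swap = P.dualFace c :=
  (Quot.sound (.inr rfl)).symm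

theorem dualFace_zpow (c : Corner T) (m : ℤ) : P.dualFace ((P.stepPerm ^ m) c) = P.dualFace c := by
  induction m with
  | zero => rfl
  | succ m ih =>
    rw [add_comm, zpow_add, zpow_one, Equiv.Perm.mul_apply, stepPerm_apply, dualFace_step, ih]
  | pred m ih =>
    rw [← ih, ← dualFace_step, ← stepPerm_apply, ← Equiv.Perm.mul_apply, ← zpow_one_add]
    congr 3; ring

theorem dualFace_eq_iff {c d : Corner T} : P.dualFace c = P.dualFace d ↔
    ∃ m : ℤ, d = (P.stepPerm ^ m) c ∨ d = ((P.stepPerm ^ m) c).swap := by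
  constructor
  · intro h
    have := Quot.eqvGen_exact h
    clear h
    induction this with
    | rel x y h =>
      rcases h with h | h
      · exact ⟨1, .inl h⟩
      · exact ⟨0, .inr h⟩
    | refl x => exact ⟨0, .inl rfl⟩
    | symm x y _ ih =>
      obtain ⟨m, rfl | rfl⟩ := ih
      · exact ⟨-m, .inl (by rw [← Equiv.Perm.mul_apply, ← zpow_add]; simp)⟩
      · refine ⟨m, .inr ?_⟩
        rw [P.stepPerm_zpow_swap, ← Equiv.Perm.mul_apply, ← zpow_add]
        simp
    | trans x y z _ _ h₁ h₂ =>
      obtain ⟨m, rfl | rfl⟩ := h₁ <;> obtain ⟨k, rfl | rfl⟩ := h₂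
      · exact ⟨k + m, .inl (by rw [zpow_add]; rfl)⟩
      · exact ⟨k + m, .inr (by rw [zpow_add]; rfl)⟩
      · exact ⟨-k + m, .inr (by rw [P.stepPerm_zpow_swap, zpow_add]; rfl)⟩
      · exact ⟨-k + m, .inl (by rw [P.stepPerm_zpow_swap, zpow_add]; rfl)⟩
  · rintro ⟨m, rfl | rfl⟩
    · exact (P.dualFace_zpow c m).symm
    · rw [P.dualFace_swap, P.dualFace_zpow]

end FacePairing

/-! ### Points of `M` and the gluing relation -/

namespace IdealCellulation

open idealTetrahedron

variable {M : Type*} [TopologicalSpace M] {T : Type*} (𝒞 : IdealCellulation M T)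

theorem exists_point (m : M) : ∃ t x, 𝒞.point t x = m := by
  obtain ⟨⟨t, x⟩, h⟩ := Quot.exists_rep (𝒞.homeo.symm m)
  exact ⟨t, x, by rw [point, h, Homeomorph.apply_symm_apply]⟩

/-- Invariance in one direction suffices, because every gluing is undone by the one from the other
side. In the applications `Q` lists all the ways in which a given point is seen from the tetrahedra.
-/
theorem rel_of_point_eq {Q : T → idealTetrahedron → Prop}
    (hQ : ∀ t f x, x.1 f = 0 → Q t x → Q (𝒞.glue t f) (permute (𝒞.perm t f) x))
    {t t' : T} {x x' : idealTetrahedron} (h : 𝒞.point t x = 𝒞.point t' x') (hx : Q t x) :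
    Q t' x' := by
  have h' := Quot.eqvGen_exact (𝒞.homeo.injective h)
  have key : ∀ a b, 𝒞.FaceRel a b → Q a.1 a.2 → Q b.1 b.2 := by
    rintro _ _ ⟨t, f, x, hx⟩ h
    exact hQ t f x hx h
  have : ∀ a b, Relation.EqvGen 𝒞.FaceRel a b → (Q a.1 a.2 ↔ Q b.1 b.2) := by
    intro a b h'
    induction h' with
    | rel a b h => exact ⟨key a b h, key b a (𝒞.faceRel_symm h)⟩
    | refl => rfl
    | symm _ _ _ ih => exact ih.symm
    | trans _ _ _ _ _ h₁ h₂ => exact h₁.trans h₂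
  exact (this _ _ h').1 hx

theorem isQuotientMap_point :
    IsQuotientMap fun p : Σ _ : T, idealTetrahedron => 𝒞.point p.1 p.2 :=
  𝒞.homeo.isQuotientMap.comp isQuotientMap_quot_mk

end IdealCellulation

/-! ### The deformation retraction onto the dual 2-skeleton -/

namespace idealTetrahedron

/-- The second largest coordinate, counted with multiplicity. -/
def second (x : Fin 4 → ℝ) : ℝ :=
  (Finset.univ : Finset (Fin 4)).offDiag.sup' ⟨(0, 1), by simp⟩ fun p => min (x p.1) (x p.2)

theorem min_le_second (x : Fin 4 → ℝ) {i j : Fin 4} (h : i ≠ j) : min (x i) (x j) ≤ second x :=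
  Finset.le_sup' (s := Finset.univ.offDiag) (fun p : Fin 4 × Fin 4 => min (x p.1) (x p.2))
    (b := (i, j)) (by simpa using h)

theorem exists_second_eq (x : Fin 4 → ℝ) : ∃ i j, i ≠ j ∧ min (x i) (x j) = second x := by
  obtain ⟨p, hp, h⟩ := Finset.exists_mem_eq_sup' (s := (Finset.univ : Finset (Fin 4)).offDiag)
    ⟨(0, 1), by simp⟩ fun p => min (x p.1) (x p.2)
  exact ⟨p.1, p.2, by simpa using hp, h.symm⟩

theorem continuous_second : Continuous second :=
  Continuous.finset_sup'_apply _ fun p _ =>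
    (continuous_apply p.1).min (continuous_apply p.2)

theorem second_comp (σ : Equiv.Perm (Fin 4)) (x : Fin 4 → ℝ) :
    second (fun v => x (σ v)) = second x := by
  apply le_antisymm
  · obtain ⟨i, j, hij, h⟩ := exists_second_eq fun v => x (σ v)
    rw [← h]
    exact min_le_second x (σ.injective.ne hij)
  · obtain ⟨i, j, hij, h⟩ := exists_second_eq x
    rw [← h]
    simpa using min_le_second (fun v => x (σ v)) (σ.symm.injective.ne hij)

/-- If only one coordinate were positive, it would equal 1, and the point would be a removed vertex.
-/
theorem second_pos (x : idealTetrahedron) : 0 < second x.1 := by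
  by_contra! h
  obtain ⟨i, hi⟩ : ∃ i, 0 < x.1 i := by
    by_contra! h
    linarith [sum_eq_one x, h 0, h 1, h 2, h 3]
  have h0 : ∀ j, j ≠ i → x.1 j = 0 := fun j hj => by
    rcases min_le_iff.1 ((min_le_second x.1 hj).trans h) with h | h
    · exact le_antisymm h (nonneg x j)
    · linarith
  have h1 := x.2.1.2
  rw [Finset.sum_eq_single i (fun j _ hj => h0 j hj) (by simp)] at h1
  exact (x.2.2 i).ne h1

/-- The coordinates truncated at the second largest one. -/
def truncate (x : Fin 4 → ℝ) (i : Fin 4) : ℝ := min (x i) (second x)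

theorem truncate_nonneg (x : idealTetrahedron) (i : Fin 4) : 0 ≤ truncate x.1 i :=
  le_min (nonneg x i) (second_pos x).le

theorem exists_truncate_eq (x : Fin 4 → ℝ) :
    ∃ i j, i ≠ j ∧ truncate x i = second x ∧ truncate x j = second x := by
  obtain ⟨i, j, hij, h⟩ := exists_second_eq x
  exact ⟨i, j, hij, min_eq_right (h ▸ min_le_left _ _), min_eq_right (h ▸ min_le_right _ _)⟩

/-- The truncated coordinates take the positive value `second x` at two indices, so one of them
differs from `i`. This keeps the normalised point away from the vertices. -/
theorem truncate_lt_sum (x : idealTetrahedron) (i : Fin 4) :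
    truncate x.1 i < ∑ j, truncate x.1 j := by
  obtain ⟨j, hj, h⟩ : ∃ j, j ≠ i ∧ truncate x.1 j = second x.1 := by
    obtain ⟨j, k, hjk, hj, hk⟩ := exists_truncate_eq x.1
    by_cases hji : j = i
    · exact ⟨k, fun h => hjk (hji.trans h.symm), hk⟩
    · exact ⟨j, hji, hj⟩
  exact Finset.single_lt_sum hj (Finset.mem_univ _) (Finset.mem_univ _) (h ▸ second_pos x)
    fun k _ _ => truncate_nonneg x k

theorem sum_truncate_pos (x : idealTetrahedron) : 0 < ∑ j, truncate x.1 j :=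
  (truncate_nonneg x 0).trans_lt (truncate_lt_sum x 0)

/-- The retraction of the ideal tetrahedron onto the points whose largest coordinate is attained
at least twice. -/
def retract (x : idealTetrahedron) : idealTetrahedron :=
  ⟨fun i => truncate x.1 i / ∑ j, truncate x.1 j,
    ⟨fun i => div_nonneg (truncate_nonneg x i) (sum_truncate_pos x).le, by
      rw [← Finset.sum_div, div_self (sum_truncate_pos x).ne']⟩,
    fun i => (div_lt_one (sum_truncate_pos x)).2 (truncate_lt_sum x i)⟩

theorem continuous_truncate (i : Fin 4) :
    Continuous fun x : idealTetrahedron => truncate x.1 i :=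
  (continuous_coord i).min (continuous_second.comp continuous_subtype_val)

theorem continuous_retract : Continuous retract := by
  have h : Continuous fun x : idealTetrahedron => ∑ j, truncate x.1 j :=
    continuous_finsetSum _ fun j _ => continuous_truncate j
  have h' : Continuous fun x : idealTetrahedron => fun i => truncate x.1 i / ∑ j, truncate x.1 j :=
    continuous_pi fun i => (continuous_truncate i).div h fun x => (sum_truncate_pos x).ne'
  exact h'.subtype_mk _

theorem retract_permute (σ : Equiv.Perm (Fin 4)) (x : idealTetrahedron) :
    retract (permute σ x) = permute σ (retract x) := by
  have h : ∀ i, truncate (permute σ x).1 i = truncate x.1 (σ.symm i) := fun i => by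
    simp only [truncate, permute, second_comp σ.symm x.1]
  apply Subtype.ext
  funext i
  simp only [retract, permute_apply, h]
  rw [Equiv.sum_comp σ.symm (truncate x.1)]

theorem retract_apply_eq_zero {x : idealTetrahedron} {i : Fin 4} (h : x.1 i = 0) :
    (retract x).1 i = 0 := by
  simp [retract, truncate, h, (second_pos x).le]

theorem exists_retract_eq (x : idealTetrahedron) : ∃ i j, i ≠ j ∧
    (retract x).1 i = (retract x).1 j ∧ ∀ k, (retract x).1 k ≤ (retract x).1 i := by
  obtain ⟨i, j, hij, hi, hj⟩ := exists_truncate_eq x.1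
  refine ⟨i, j, hij, by simp only [retract, hi, hj], fun k => ?_⟩
  simp only [retract, hi]
  exact div_le_div_of_nonneg_right (min_le_right _ _) (sum_truncate_pos x).le

theorem retract_eq_self {x : idealTetrahedron} {i j : Fin 4} (hij : i ≠ j) (h : x.1 i = x.1 j)
    (hk : ∀ k, x.1 k ≤ x.1 i) : retract x = x := by
  have h1 : ∀ k, truncate x.1 k = x.1 k := fun k => by
    have h2 : x.1 i ≤ second x.1 := by simpa [h] using min_le_second x.1 hij
    rw [truncate, min_eq_left ((hk k).trans h2)]
  apply Subtype.ext
  funext k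
  simp only [retract, h1, x.2.1.2, div_one]

/-- The point at time `s` on the segment from `x` to `y`. -/
def line (s : unitInterval) (x y : idealTetrahedron) : idealTetrahedron :=
  ⟨AffineMap.lineMap x.1 y.1 (s : ℝ), convex.lineMap_mem x.2 y.2 s.2⟩

theorem line_apply (s : unitInterval) (x y : idealTetrahedron) (i : Fin 4) :
    (line s x y).1 i = (1 - s) * x.1 i + s * y.1 i := by
  simp [line, AffineMap.lineMap_apply_module]

@[simp] theorem line_zero (x y : idealTetrahedron) : line 0 x y = x :=
  Subtype.ext (by simp [line])

@[simp] theorem line_one (x y : idealTetrahedron) : line 1 x y = y :=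
  Subtype.ext (by simp [line])

@[simp] theorem line_self (s : unitInterval) (x : idealTetrahedron) : line s x x = x :=
  Subtype.ext (by simp [line])

theorem permute_line (σ : Equiv.Perm (Fin 4)) (s : unitInterval) (x y : idealTetrahedron) :
    permute σ (line s x y) = line s (permute σ x) (permute σ y) := by
  apply Subtype.ext
  funext i
  simp only [permute_apply, line_apply]

theorem continuous_line {X : Type*} [TopologicalSpace X] {a : X → unitInterval}
    {f g : X → idealTetrahedron} (ha : Continuous a) (hf : Continuous f) (hg : Continuous g) :
    Continuous fun p => line (a p) (f p) (g p) := by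
  have h : Continuous fun p => AffineMap.lineMap (k := ℝ) (f p).1 (g p).1 (a p : ℝ) := by
    simp only [AffineMap.lineMap_apply_module]
    fun_prop
  exact h.subtype_mk _

end idealTetrahedron

namespace IdealCellulation

open idealTetrahedron

variable {M : Type*} [TopologicalSpace M] {T : Type*} (𝒞 : IdealCellulation M T)

/-- The product of a quotient map with the identity of a locally compact space is a quotient map, so
joint continuity can be tested on single tetrahedra. -/
theorem continuous_of_point {Y Z : Type*} [TopologicalSpace Y] [TopologicalSpace Z]
    [LocallyCompactSpace Y] {g : Y × M → Z}
    (h : ∀ t, Continuous fun p : Y × idealTetrahedron => g (p.1, 𝒞.point t p.2)) :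
    Continuous g := by
  refine 𝒞.isQuotientMap_point.continuous_lift_prod_right ?_
  let e : Y × (Σ _ : T, idealTetrahedron) ≃ₜ Σ _ : T, idealTetrahedron × Y :=
    (Homeomorph.prodComm _ _).trans Homeomorph.sigmaProdDistrib
  rw [← e.symm.comp_continuous_iff']
  exact continuous_sigma fun t => (h t).comp continuous_swap

/-- The map of `M` induced by a map of the ideal tetrahedron which is compatible with the
gluings. -/
def descend (r : idealTetrahedron → idealTetrahedron)
    (h0 : ∀ x i, x.1 i = 0 → (r x).1 i = 0)
    (hp : ∀ σ x, r (permute σ x) = permute σ (r x)) (m : M) : M :=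
  𝒞.homeo (Quot.map (fun p : Σ _ : T, idealTetrahedron => (⟨p.1, r p.2⟩ : Σ _ : T, idealTetrahedron))
    (by
      rintro _ _ ⟨t, f, x, hx⟩
      simp only [hp]
      exact .glue t f (r x) (h0 x f hx)) (𝒞.homeo.symm m))

theorem descend_point (r : idealTetrahedron → idealTetrahedron)
    (h0 : ∀ x i, x.1 i = 0 → (r x).1 i = 0)
    (hp : ∀ σ x, r (permute σ x) = permute σ (r x)) (t : T) (x : idealTetrahedron) :
    𝒞.descend r h0 hp (𝒞.point t x) = 𝒞.point t (r x) := by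
  have h : 𝒞.homeo.symm (𝒞.point t x) = Quot.mk _ ⟨t, x⟩ := 𝒞.homeo.symm_apply_apply _
  rw [descend, h]
  rfl

theorem isDeformationRetract_dualSkeleton : IsDeformationRetract 𝒞.dualSkeleton := by
  let H : unitInterval → M → M := fun s => 𝒞.descend (fun x => line s x (retract x))
    (fun x i h => by simp [line_apply, h, retract_apply_eq_zero h])
    (fun σ x => by rw [retract_permute, permute_line])
  have hH : ∀ s t x, H s (𝒞.point t x) = 𝒞.point t (line s x (retract x)) := fun s t x =>
    𝒞.descend_point _ _ _ t x
  have hc : Continuous fun p : unitInterval × M => H p.1 p.2 := by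
    refine 𝒞.continuous_of_point (Y := unitInterval) (g := fun p => H p.1 p.2) fun t => ?_
    have h : Continuous fun p : unitInterval × idealTetrahedron => line p.1 p.2 (retract p.2) :=
      continuous_line continuous_fst continuous_snd (continuous_retract.comp continuous_snd)
    simp only [hH]
    exact (𝒞.continuous_point t).comp h
  let r : C(M, M) := ⟨H 1, hc.comp (Continuous.prodMk_right 1)⟩
  let F : (ContinuousMap.id M).Homotopy r :=
    { toFun := fun p => H p.1 p.2
      continuous_toFun := hc
      map_zero_left := fun m => by
        obtain ⟨t, x, rfl⟩ := 𝒞.exists_point m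
        simp [hH]
      map_one_left := fun m => rfl }
  refine ⟨r, fun m => ?_, ⟨⟨F, fun s m hm => ?_⟩⟩⟩
  · obtain ⟨t, x, rfl⟩ := 𝒞.exists_point m
    exact ⟨t, _, (hH 1 t x).symm, by rw [line_one]; exact exists_retract_eq x⟩
  · obtain ⟨t, x, rfl, i, j, hij, h, hk⟩ := hm
    change H s (𝒞.point t x) = 𝒞.point t x
    rw [hH, retract_eq_self hij h hk, line_self]

end IdealCellulation

/-! ### Walks, holonomy and words in the dual graph -/

namespace FacePairing

variable {T : Type*} {P : FacePairing T} {G : Type*} [Group G]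

namespace Walk

/-- Concatenation of walks. -/
def append : {r s t : T} → P.Walk r s → P.Walk s t → P.Walk r t
  | _, _, _, .nil _, w' => w'
  | _, _, _, .cons f w, w' => .cons f (append w w')

/-- The holonomy along a walk of a function on the oriented dual edges, multiplied from right to
left. -/
def hol (F : T × Fin 4 → G) : {s t : T} → P.Walk s t → G
  | _, _, .nil _ => 1
  | s, _, .cons f w => hol F w * F (s, f)

@[simp] theorem hol_nil (F : T × Fin 4 → G) (t : T) : (nil t : P.Walk t t).hol F = 1 := rfl

@[simp] theorem hol_cons (F : T × Fin 4 → G) {s t : T} (f : Fin 4) (w : P.Walk (P.glue s f) t) :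
    (cons f w).hol F = w.hol F * F (s, f) := rfl

@[simp] theorem edges_nil (t : T) : (nil t : P.Walk t t).edges = [] := rfl

@[simp] theorem edges_cons {s t : T} (f : Fin 4) (w : P.Walk (P.glue s f) t) :
    (cons f w).edges = P.dualEdge (s, f) :: w.edges := rfl

@[simp] theorem hol_append (F : T × Fin 4 → G) {r s t : T} (w : P.Walk r s) (w' : P.Walk s t) :
    (w.append w').hol F = w'.hol F * w.hol F := by
  induction w with
  | nil => simp [append]
  | cons f w ih => simp [append, ih, mul_assoc]

@[simp] theorem edges_append {r s t : T} (w : P.Walk r s) (w' : P.Walk s t) :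
    (w.append w').edges = w.edges ++ w'.edges := by
  induction w with
  | nil => simp [append]
  | cons f w ih => simp [append, ih]

theorem exists_eq_append_of_mem {s t : T} (w : P.Walk s t) {e : P.DualEdge} (he : e ∈ w.edges) :
    ∃ (r : T) (f : Fin 4) (u : P.Walk s r) (v : P.Walk (P.glue r f) t),
      P.dualEdge (r, f) = e ∧ w = u.append (cons f v) := by
  induction w with
  | nil => simp at he
  | cons f w ih =>
    rw [edges_cons, List.mem_cons] at he
    rcases he with rfl | he
    · exact ⟨_, f, nil _, w, rfl, rfl⟩
    · obtain ⟨r, f', u, v, h, rfl⟩ := ih he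
      exact ⟨r, f', cons f u, v, h, rfl⟩

theorem exists_eq_append_of_not_nodup {s t : T} (w : P.Walk s t) (hw : ¬ w.edges.Nodup) :
    ∃ (r : T) (f : Fin 4) (r' : T) (f' : Fin 4) (u : P.Walk s r) (v : P.Walk (P.glue r f) r')
      (z : P.Walk (P.glue r' f') t), P.dualEdge (r, f) = P.dualEdge (r', f') ∧
        w = u.append (cons f (v.append (cons f' z))) := by
  induction w with
  | nil => simp at hw
  | cons f w ih =>
    rw [edges_cons, List.nodup_cons, not_and_or, not_not] at hw
    rcases hw with hw | hw
    · obtain ⟨r, f', u, v, h, rfl⟩ := w.exists_eq_append_of_mem hw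
      exact ⟨_, f, r, f', nil _, u, v, h.symm, rfl⟩
    · obtain ⟨r, f', r', f'', u, v, z, h, rfl⟩ := ih hw
      exact ⟨r, f', r', f'', cons f u, v, z, h, rfl⟩

theorem hol_eq_one {S : Set P.DualEdge} (F : T × Fin 4 → G) (hF : ∀ a, P.dualEdge a ∈ S → F a = 1)
    {s t : T} (w : P.Walk s t) (hw : ∀ e ∈ w.edges, e ∈ S) : w.hol F = 1 := by
  induction w with
  | nil => rfl
  | cons f w ih =>
    rw [edges_cons, List.forall_mem_cons] at hw
    rw [hol_cons, ih hw.2, hF _ hw.1, one_mul]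

end Walk

/-- Induction on the length. Without a repeated edge the walk is empty by acyclicity. A repeated
edge splits the walk into two shorter closed walks: if it is run twice in the same direction, each
part keeps one crossing; if in opposite directions, the two crossings cancel. -/
theorem IsSpanningTree.hol_closed_eq_one {S : Set P.DualEdge} (hS : P.IsSpanningTree S)
    (F : T × Fin 4 → G) (hF : ∀ a, F (P.opp a) = (F a)⁻¹) {t : T} (w : P.Walk t t)
    (hw : ∀ e ∈ w.edges, e ∈ S) : w.hol F = 1 := by
  induction hn : w.edges.length using Nat.strong_induction_on generalizing t with
  | _ n ih =>
    subst hn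
    by_cases hd : w.edges.Nodup
    · have h := hS.acyclic t w hw hd
      cases w with
      | nil => rfl
      | cons f w => simp at h
    · obtain ⟨r, f, r', f', u, v, z, h, rfl⟩ := w.exists_eq_append_of_not_nodup hd
      simp only [Walk.edges_append, Walk.edges_cons, List.mem_append, List.mem_cons,
        List.length_append, List.length_cons] at hw ih
      rcases P.dualEdge_eq_iff.1 h with h | h
      · obtain ⟨rfl, rfl⟩ := Prod.mk.inj h
        have h1 := ih _ (by simp; omega) (Walk.cons f' v) (fun e he => hw e (by
          rw [Walk.edges_cons, List.mem_cons] at he; tauto)) rfl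
        have h2 := ih _ (by simp) (u.append (.cons f' z)) (fun e he => hw e (by
          rw [Walk.edges_append, List.mem_append, Walk.edges_cons, List.mem_cons] at he; tauto)) rfl
        simp only [Walk.hol_append, Walk.hol_cons] at h1 h2 ⊢
        rw [mul_assoc _ (Walk.hol F v), h1, mul_one, h2]
      · obtain ⟨rfl, rfl⟩ := Prod.mk.inj h
        -- After crossing the face forth and back, `z` starts at `r` only up to the equation
        -- `glue_glue`, so it has to be transported before it can follow `u`.
        obtain ⟨z', hz1, hz2⟩ : ∃ z' : P.Walk r t, z'.edges = z.edges ∧ z'.hol F = z.hol F := by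
          clear ih hw hd
          generalize hy : P.glue (P.glue r f) (P.perm r f f) = y at z
          rw [P.glue_glue] at hy
          subst hy
          exact ⟨z, rfl, rfl⟩
        have h1 := ih _ (by omega) v (fun e he => hw e (by tauto)) rfl
        have h2 := ih _ (by rw [Walk.edges_append, List.length_append, hz1]; omega)
          (u.append z') (fun e he => hw e (by
          rw [Walk.edges_append, List.mem_append, hz1] at he; tauto)) rfl
        have h3 : F (P.glue r f, P.perm r f f) = (F (r, f))⁻¹ := hF (r, f)
        simp only [Walk.hol_append, Walk.hol_cons, h1, h3, hz2] at h2 ⊢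
        rw [mul_one, inv_mul_cancel_right, h2]

variable (S : Set P.DualEdge) (orient : P.DualEdge → T × Fin 4)

theorem word_eq_hol {s t : T} (w : P.Walk s t) : P.word S orient w = w.hol (P.letter S orient) := by
  induction w with
  | nil => rfl
  | cons f w ih => rw [word, Walk.hol_cons, ih]

variable {S orient}

theorem letter_eq_one {a : T × Fin 4} (h : P.dualEdge a ∈ S) : P.letter S orient a = 1 :=
  dif_pos h

theorem letter_orient (horient : ∀ e, P.dualEdge (orient e) = e) (e : {e : P.DualEdge // e ∉ S}) :
    P.letter S orient (orient e) = FreeGroup.of e := by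
  have h : P.dualEdge (orient e) ∉ S := by rw [horient]; exact e.2
  rw [letter, dif_neg h, if_pos (by rw [horient])]
  exact congrArg _ (Subtype.ext (horient e))

theorem orient_cases (horient : ∀ e, P.dualEdge (orient e) = e) (a : T × Fin 4) :
    a = orient (P.dualEdge a) ∨ a = P.opp (orient (P.dualEdge a)) :=
  P.dualEdge_eq_iff.1 (horient _)

theorem letter_opp (horient : ∀ e, P.dualEdge (orient e) = e) (a : T × Fin 4) :
    P.letter S orient (P.opp a) = (P.letter S orient a)⁻¹ := by
  by_cases h : P.dualEdge a ∈ S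
  · rw [letter_eq_one h, letter_eq_one (by rwa [dualEdge_opp]), inv_one]
  · have h' : P.dualEdge (P.opp a) ∉ S := by rwa [dualEdge_opp]
    have h3 : orient (P.dualEdge (P.opp a)) = orient (P.dualEdge a) := by rw [dualEdge_opp]
    simp only [letter, dif_neg h, dif_neg h', dualEdge_opp]
    rcases orient_cases horient a with h1 | h1
    · rw [if_neg (by rw [h3, ← h1]; exact (P.opp_ne a).symm), if_pos h1.symm]
    · have h2 : P.opp a = orient (P.dualEdge a) := by
        conv_lhs => rw [h1, opp_opp]
      rw [if_pos (h3.trans h2.symm), if_neg (by rw [← h2]; exact P.opp_ne a), inv_inv]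

/-- A function that inverts under reversal and is trivial on `S` is determined by its values on the
chosen orientations outside `S`; so holonomies can be computed from words. -/
theorem lift_letter (horient : ∀ e, P.dualEdge (orient e) = e) (F : T × Fin 4 → G)
    (hF : ∀ a, F (P.opp a) = (F a)⁻¹) (hS : ∀ a, P.dualEdge a ∈ S → F a = 1) (a : T × Fin 4) :
    FreeGroup.lift (fun e : {e : P.DualEdge // e ∉ S} => F (orient e)) (P.letter S orient a) =
      F a := by
  by_cases h : P.dualEdge a ∈ S
  · rw [letter_eq_one h, hS a h, map_one]
  · rcases orient_cases horient a with h1 | h1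
    · have := letter_orient horient ⟨_, h⟩
      rw [← h1] at this
      rw [this, FreeGroup.lift_apply_of, ← h1]
    · have := letter_orient horient ⟨_, h⟩
      conv_lhs => rw [h1, letter_opp horient, this, map_inv, FreeGroup.lift_apply_of]
      rw [← hF, ← h1]

theorem lift_word (horient : ∀ e, P.dualEdge (orient e) = e) (F : T × Fin 4 → G)
    (hF : ∀ a, F (P.opp a) = (F a)⁻¹) (hS : ∀ a, P.dualEdge a ∈ S → F a = 1) {s t : T}
    (w : P.Walk s t) :
    FreeGroup.lift (fun e : {e : P.DualEdge // e ∉ S} => F (orient e)) (P.word S orient w) =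
      w.hol F := by
  induction w with
  | nil => simp [word]
  | cons f w ih => rw [word, map_mul, ih, lift_letter horient F hF hS, Walk.hol_cons]

/-- A letter is the word of the walk that runs in the tree to the edge, crosses it and returns in
the tree. Questions about group elements thereby become questions about closed walks. -/
theorem exists_word_eq (hS : P.IsSpanningTree S) (horient : ∀ e, P.dualEdge (orient e) = e)
    (t₀ : T) (x : FreeGroup {e : P.DualEdge // e ∉ S}) :
    ∃ w : P.Walk t₀ t₀, P.word S orient w = x := by
  have key : ∀ a : T × Fin 4, ∃ w : P.Walk t₀ t₀, P.word S orient w = P.letter S orient a := by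
    intro a
    obtain ⟨p, hp⟩ := hS.connected t₀ a.1
    obtain ⟨q, hq⟩ := hS.connected (P.glue a.1 a.2) t₀
    refine ⟨p.append (.cons a.2 q), ?_⟩
    rw [word_eq_hol, Walk.hol_append, Walk.hol_cons,
      Walk.hol_eq_one (S := S) _ (fun _ => letter_eq_one) p hp,
      Walk.hol_eq_one (S := S) _ (fun _ => letter_eq_one) q hq, one_mul, mul_one]
  induction x using FreeGroup.induction_on with
  | C1 => exact ⟨.nil _, rfl⟩
  | of e =>
    obtain ⟨w, hw⟩ := key (orient e)
    exact ⟨w, by rw [hw, letter_orient horient]⟩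
  | inv_of e _ =>
    obtain ⟨w, hw⟩ := key (P.opp (orient e))
    exact ⟨w, by rw [hw, letter_opp horient, letter_orient horient]⟩
  | mul x y hx hy =>
    obtain ⟨u, rfl⟩ := hx
    obtain ⟨v, rfl⟩ := hy
    exact ⟨v.append u, by simp only [word_eq_hol, Walk.hol_append]⟩

end FacePairing

/-! ### Open faces of the tetrahedron and their barycenters -/

namespace idealTetrahedron

instance : ContractibleSpace idealTetrahedron :=
  convex.contractibleSpace ⟨center.1, center.2⟩

theorem path_homotopic {x y : idealTetrahedron} (p q : Path x y) : p.Homotopic q :=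
  SimplyConnectedSpace.paths_homotopic p q

/-- A set of at most two vertices of the tetrahedron. It stands for the open face on which exactly
the coordinates in the set vanish. -/
abbrev Mark : Type := {A : Finset (Fin 4) // A.card ≤ 2}

/-- Relabelling the vertices of a mark. -/
def Mark.map (σ : Equiv.Perm (Fin 4)) (A : Mark) : Mark :=
  ⟨A.1.map σ.toEmbedding, by rw [Finset.card_map]; exact A.2⟩

@[simp] theorem Mark.mem_map {σ : Equiv.Perm (Fin 4)} {A : Mark} {i : Fin 4} :
    i ∈ (A.map σ).1 ↔ σ.symm i ∈ A.1 := by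
  simp only [Mark.map, Finset.mem_map_equiv]

theorem Mark.card_map (σ : Equiv.Perm (Fin 4)) (A : Mark) : (A.map σ).1.card = A.1.card :=
  Finset.card_map _

theorem Mark.card_sub_pos (A : Mark) : (0 : ℝ) < 4 - (A.1.card : ℝ) := by
  have : (A.1.card : ℝ) ≤ 2 := by exact_mod_cast A.2
  linarith

theorem Mark.sum_bary (A : Mark) :
    ∑ i, (if i ∈ A.1 then 0 else 1 / (4 - (A.1.card : ℝ))) = 1 := by
  have h : A.1.card ≤ 4 := A.2.trans (by norm_num)
  have h' := A.card_sub_pos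
  rw [Finset.sum_ite, Finset.sum_const_zero, Finset.sum_const, zero_add]
  have : (Finset.univ.filter fun i => i ∉ A.1).card = 4 - A.1.card := by
    rw [Finset.filter_not, Finset.filter_mem_eq_inter, Finset.univ_inter,
      Finset.card_sdiff_of_subset (Finset.subset_univ _), Finset.card_fin]
  rw [this, nsmul_eq_mul, Nat.cast_sub h]
  push_cast
  field_simp

/-- The barycenter of an open face. -/
def bary (A : Mark) : idealTetrahedron :=
  ⟨fun i => if i ∈ A.1 then 0 else 1 / (4 - (A.1.card : ℝ)),
    ⟨fun i => by
      have := A.card_sub_pos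
      dsimp only
      split_ifs <;> positivity, A.sum_bary⟩,
    fun i => by
      have h : (A.1.card : ℝ) ≤ 2 := by exact_mod_cast A.2
      have := A.card_sub_pos
      dsimp only
      split_ifs
      · norm_num
      · rw [div_lt_one this]
        linarith⟩

theorem bary_of_mem {A : Mark} {i : Fin 4} (h : i ∈ A.1) : (bary A).1 i = 0 := if_pos h

theorem bary_pos {A : Mark} {i : Fin 4} (h : i ∉ A.1) : 0 < (bary A).1 i := by
  simp only [bary, if_neg h]
  exact one_div_pos.2 A.card_sub_pos

theorem permute_bary (σ : Equiv.Perm (Fin 4)) (A : Mark) :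
    permute σ (bary A) = bary (A.map σ) := by
  apply Subtype.ext
  funext i
  simp [bary, permute, Mark.card_map]

end idealTetrahedron

namespace FacePairing

open idealTetrahedron

/-- The edge of the tetrahedron at a corner, as a mark. -/
def Corner.mark {T : Type*} (c : Corner T) : Mark :=
  ⟨{c.enter, c.exit}, Finset.card_le_two⟩

theorem mark_step {T : Type*} (P : FacePairing T) (c : Corner T) :
    (P.step c).mark = c.mark.map (P.perm c.tet c.exit) := by
  apply Subtype.ext
  simp [Corner.mark, Mark.map, step, Finset.pair_comm]

end FacePairing

/-! ### Loops through dual edges; the relators hold -/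

namespace IdealCellulation

open idealTetrahedron Path

variable {M : Type*} [TopologicalSpace M] {T : Type*} (𝒞 : IdealCellulation M T)

/-- The homotopy class of the straight path between two points of a tetrahedron. -/
def seg (t : T) (x y : idealTetrahedron) {m m' : M} (hx : 𝒞.point t x = m)
    (hy : 𝒞.point t y = m') : Homotopic.Quotient m m' :=
  .mk (((segmentPath x y).map (𝒞.continuous_point t)).cast hx.symm hy.symm)

/-- The ideal tetrahedron is convex, hence simply connected. -/
theorem mk_map_eq_seg (t : T) {x y : idealTetrahedron} (p : Path x y) {m m' : M}
    (hx : 𝒞.point t x = m) (hy : 𝒞.point t y = m') :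
    Homotopic.Quotient.mk ((p.map (𝒞.continuous_point t)).cast hx.symm hy.symm) = 𝒞.seg t x y hx hy := by
  subst hx hy
  exact Homotopic.Quotient.eq.2 ((path_homotopic p (segmentPath x y)).map ⟨_, 𝒞.continuous_point t⟩)

theorem seg_trans (t : T) (x y z : idealTetrahedron) {m m' m'' : M} (hx : 𝒞.point t x = m)
    (hy : 𝒞.point t y = m') (hz : 𝒞.point t z = m'') :
    (𝒞.seg t x y hx hy).trans (𝒞.seg t y z hy hz) = 𝒞.seg t x z hx hz := by
  subst hx hy hz
  rw [← 𝒞.mk_map_eq_seg t ((segmentPath x y).trans (segmentPath y z)), Path.map_trans]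
  rfl

theorem seg_self (t : T) (x : idealTetrahedron) {m : M} (hx : 𝒞.point t x = m) :
    𝒞.seg t x x hx hx = .refl m := by
  subst hx
  rw [← 𝒞.mk_map_eq_seg t (Path.refl x)]
  rfl

theorem seg_glue (t : T) (f : Fin 4) {x y : idealTetrahedron} (hxf : x.1 f = 0) (hyf : y.1 f = 0)
    {m m' : M} (hx : 𝒞.point t x = m) (hy : 𝒞.point t y = m') :
    𝒞.seg t x y hx hy = 𝒞.seg (𝒞.glue t f) (permute (𝒞.perm t f) x) (permute (𝒞.perm t f) y)
      ((𝒞.point_eq t f x hxf).symm.trans hx) ((𝒞.point_eq t f y hyf).symm.trans hy) := by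
  refine congrArg Homotopic.Quotient.mk (Path.ext (funext fun s => ?_))
  have h : (line s x y).1 f = 0 := by simp [line_apply, hxf, hyf]
  have := 𝒞.point_eq t f _ h
  rw [permute_line] at this
  exact this

theorem point_center (t : T) : 𝒞.point t center = 𝒞.dualVertex t := rfl

theorem mk_edgePath (t : T) (f : Fin 4) : Homotopic.Quotient.mk (𝒞.edgePath t f) =
    (𝒞.seg t center (faceCenter f) (𝒞.point_center t) rfl).trans
      (𝒞.seg (𝒞.glue t f) (faceCenter (𝒞.perm t f f)) center (𝒞.point_faceCenter t f).symm
        (𝒞.point_center _)) := by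
  rw [← 𝒞.mk_map_eq_seg (𝒞.glue t f) (segmentPath center (faceCenter (𝒞.perm t f f))).symm]
  rfl

theorem faceCenter_self (f : Fin 4) : (faceCenter f).1 f = 0 := if_pos rfl

/-- Pass through the barycenter of the face: the segment from there to `x` stays in the face and can
be read in the neighbouring tetrahedron. -/
theorem seg_center_eq (t : T) (f : Fin 4) {x : idealTetrahedron} (hxf : x.1 f = 0) {m : M}
    (hx : 𝒞.point t x = m) : 𝒞.seg t center x (𝒞.point_center t) hx = (Homotopic.Quotient.mk (𝒞.edgePath t f)).trans
      (𝒞.seg (𝒞.glue t f) center (permute (𝒞.perm t f) x) (𝒞.point_center _)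
        ((𝒞.point_eq t f x hxf).symm.trans hx)) := by
  rw [mk_edgePath, Homotopic.Quotient.trans_assoc, seg_trans, ← 𝒞.seg_trans t center (faceCenter f) x (𝒞.point_center t) rfl,
    𝒞.seg_glue t f (faceCenter_self f) hxf]
  congr 2
  · rw [permute_faceCenter]

section Loops

variable {v : M} (τ : ∀ t, Homotopic.Quotient v (𝒞.dualVertex t))

/-- The class of the path from the base point to a point of the tetrahedron `t` which passes through
the barycenter of `t`. -/
def approach (t : T) (x : idealTetrahedron) {m : M} (hx : 𝒞.point t x = m) : Homotopic.Quotient v m :=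
  (τ t).trans (𝒞.seg t center x (𝒞.point_center t) hx)

/-- The loop through an oriented dual edge. -/
def edgeLoop (a : T × Fin 4) : FundamentalGroup M v :=
  ((τ a.1).trans (Homotopic.Quotient.mk (𝒞.edgePath a.1 a.2))).trans (τ (𝒞.glue a.1 a.2)).symm

/-- This is the source of all relations: each face crossed while looking at a fixed point
contributes one edge loop. -/
theorem approach_eq (t : T) (f : Fin 4) {x : idealTetrahedron} (hxf : x.1 f = 0) {m : M}
    (hx : 𝒞.point t x = m) : 𝒞.approach τ t x hx = Homotopic.Quotient.trans (𝒞.edgeLoop τ (t, f))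
      (𝒞.approach τ (𝒞.glue t f) (permute (𝒞.perm t f) x)
        ((𝒞.point_eq t f x hxf).symm.trans hx)) := by
  simp only [approach, edgeLoop, 𝒞.seg_center_eq t f hxf hx, Homotopic.Quotient.trans_assoc]
  rw [← Homotopic.Quotient.trans_assoc (τ _).symm, Homotopic.Quotient.symm_trans, Homotopic.Quotient.refl_trans]

theorem approach_congr {t t' : T} {x x' : idealTetrahedron} (ht : t = t') (hxx : x = x') {m : M}
    (hx : 𝒞.point t x = m) (hx' : 𝒞.point t' x' = m) :
    𝒞.approach τ t x hx = 𝒞.approach τ t' x' hx' := by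
  subst ht hxx
  rfl

theorem eq_one_of_trans_eq {m : M} {g : FundamentalGroup M v} {q : Homotopic.Quotient v m}
    (h : Homotopic.Quotient.trans g q = q) : g = 1 := by
  have h2 := congrArg (Homotopic.Quotient.trans · q.symm) h
  simp only [Homotopic.Quotient.trans_assoc, Homotopic.Quotient.trans_symm] at h2
  rwa [Homotopic.Quotient.trans_refl] at h2

/-- Changing sides twice at the barycenter of the face restores the approach path. -/
theorem edgeLoop_opp (a : T × Fin 4) : 𝒞.edgeLoop τ (𝒞.opp a) = (𝒞.edgeLoop τ a)⁻¹ := by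
  obtain ⟨t, f⟩ := a
  have h1 := 𝒞.approach_eq τ t f (faceCenter_self f) rfl
  have h0 : (permute (𝒞.perm t f) (faceCenter f)).1 (𝒞.perm t f f) = 0 := by
    rw [permute_faceCenter, faceCenter_self]
  rw [𝒞.approach_eq τ (𝒞.glue t f) (𝒞.perm t f f) h0, ← Homotopic.Quotient.trans_assoc] at h1
  -- A product in the fundamental group runs through its right factor first.
  have h2 := eq_one_of_trans_eq (g := 𝒞.edgeLoop τ (𝒞.opp (t, f)) * 𝒞.edgeLoop τ (t, f))
    (h1.trans (congrArg _ (𝒞.approach_congr τ (𝒞.glue_glue t f)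
      (by rw [𝒞.perm_perm, permute_symm_permute]) _ rfl))).symm
  exact eq_inv_of_mul_eq_one_left h2

theorem hol_edgeLoop {s t : T} (w : 𝒞.Walk s t) : w.hol (𝒞.edgeLoop τ) =
    ((τ s).trans (Homotopic.Quotient.mk (𝒞.walkPath w))).trans (τ t).symm := by
  induction w with
  | nil t =>
    simp only [walkPath, Homotopic.Quotient.mk_refl, Homotopic.Quotient.trans_refl, Homotopic.Quotient.trans_symm]
    rfl
  | cons f w ih =>
    rw [FacePairing.Walk.hol_cons, ih, FundamentalGroup.mul_def, edgeLoop, walkPath,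
      Homotopic.Quotient.mk_trans]
    simp only [Homotopic.Quotient.trans_assoc]
    rw [← Homotopic.Quotient.trans_assoc (τ _).symm, Homotopic.Quotient.symm_trans, Homotopic.Quotient.refl_trans]

theorem bary_exit (c : FacePairing.Corner T) : (bary c.mark).1 c.exit = 0 :=
  bary_of_mem (by simp [FacePairing.Corner.mark])

theorem point_bary_step (c : FacePairing.Corner T) :
    𝒞.point (𝒞.step c).tet (bary (𝒞.step c).mark) = 𝒞.point c.tet (bary c.mark) := by
  rw [𝒞.point_eq c.tet c.exit _ (bary_exit c), permute_bary, 𝒞.mark_step]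
  rfl

theorem point_bary_step_iterate (n : ℕ) (c : FacePairing.Corner T) :
    𝒞.point (𝒞.step^[n] c).tet (bary (𝒞.step^[n] c).mark) = 𝒞.point c.tet (bary c.mark) := by
  induction n generalizing c with
  | zero => rfl
  | succ n ih => rw [Function.iterate_succ_apply, ih, point_bary_step]

theorem approach_rotationWalk (n : ℕ) (c : FacePairing.Corner T) {m : M}
    (h : 𝒞.point c.tet (bary c.mark) = m) : 𝒞.approach τ c.tet (bary c.mark) h =
      Homotopic.Quotient.trans ((𝒞.rotationWalk n c).hol (𝒞.edgeLoop τ)).toPath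
        (𝒞.approach τ (𝒞.step^[n] c).tet (bary (𝒞.step^[n] c).mark)
          ((𝒞.point_bary_step_iterate n c).trans h)) := by
  induction n generalizing c with
  | zero => exact (Homotopic.Quotient.refl_trans _).symm
  | succ n ih =>
    rw [𝒞.approach_eq τ c.tet c.exit (bary_exit c) h]
    have h1 := ih (𝒞.step c) ((𝒞.point_bary_step c).trans h)
    refine Eq.trans (congrArg _ (Eq.trans ?_ h1)) (Homotopic.Quotient.trans_assoc _ _ _).symm
    exact 𝒞.approach_congr τ rfl (by rw [permute_bary, 𝒞.mark_step]) _ _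

/-- The barycenter of the edge lies in every tetrahedron met. When the rotation closes up, its
approach path is the initial one again, so the loops collected on the way multiply to 1. -/
theorem hol_edgeLoop_rotationWalk {n : ℕ} {c : FacePairing.Corner T} (h : 𝒞.step^[n] c = c) :
    (𝒞.rotationWalk n c).hol (𝒞.edgeLoop τ) = 1 := by
  have h1 := 𝒞.approach_rotationWalk τ n c rfl
  exact eq_one_of_trans_eq ((h1.trans (congrArg _ (𝒞.approach_congr τ (by rw [h]) (by rw [h])
    _ rfl))).symm)

end Loops

end IdealCellulation

/-! ### Open stars inside a tetrahedron -/

namespace idealTetrahedron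

/-- The open star of the open face on which exactly the coordinates in `A` vanish: there the
coordinates in `A` are smaller than the others. -/
def region (A : Mark) : Set idealTetrahedron :=
  {x | (∀ i, i ∉ A.1 → 0 < x.1 i) ∧ ∀ i j, i ∈ A.1 → j ∉ A.1 → x.1 i < x.1 j}

theorem mem_of_mem_region {A : Mark} {x : idealTetrahedron} (hx : x ∈ region A) {i : Fin 4}
    (hi : x.1 i = 0) : i ∈ A.1 := by
  by_contra h
  exact (hx.1 i h).ne' hi

theorem isOpen_region (A : Mark) : IsOpen (region A) := by
  simp only [region, Set.ofPred_and, Set.ofPred_forall]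
  exact (isOpen_iInter_of_finite fun i => isOpen_iInter_of_finite fun _ =>
    isOpen_lt continuous_const (continuous_coord i)).inter
    (isOpen_iInter_of_finite fun i => isOpen_iInter_of_finite fun j =>
      isOpen_iInter_of_finite fun _ => isOpen_iInter_of_finite fun _ =>
        isOpen_lt (continuous_coord i) (continuous_coord j))

theorem permute_mem_region {A : Mark} {x : idealTetrahedron} (hx : x ∈ region A)
    (σ : Equiv.Perm (Fin 4)) : permute σ x ∈ region (A.map σ) :=
  ⟨fun _ hi => hx.1 _ fun h => hi (Mark.mem_map.2 h), fun _ _ hi hj =>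
    hx.2 _ _ (Mark.mem_map.1 hi) fun h => hj (Mark.mem_map.2 h)⟩

/-- Let `A` be the set of vanishing coordinates; it has at most two elements because two coordinates
are positive. -/
theorem exists_mem_region (x : idealTetrahedron) : ∃ A, x ∈ region A := by
  obtain ⟨i, j, hij, h⟩ := exists_second_eq x.1
  have hpos := second_pos x
  rw [← h, lt_min_iff] at hpos
  have hA : (Finset.univ.filter fun k => x.1 k = 0).card ≤ 2 := by
    have hsub : (Finset.univ.filter fun k => x.1 k = 0) ⊆ (Finset.univ.erase i).erase j := by
      intro k hk
      rw [Finset.mem_filter] at hk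
      simp only [Finset.mem_erase, Finset.mem_univ, and_true]
      exact ⟨fun h => hpos.2.ne' (h ▸ hk.2), fun h => hpos.1.ne' (h ▸ hk.2)⟩
    have := Finset.card_le_card hsub
    rwa [Finset.card_erase_of_mem (by simp [hij.symm]), Finset.card_erase_of_mem (by simp),
      Finset.card_fin] at this
  have h0 : ∀ k, ¬ x.1 k = 0 → 0 < x.1 k := fun k hk => lt_of_le_of_ne (nonneg x k) (Ne.symm hk)
  refine ⟨⟨_, hA⟩, fun k hk => h0 k (by simpa using hk), fun k l hk hl => ?_⟩
  have hk' : x.1 k = 0 := by simpa using hk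
  rw [hk']
  exact h0 l (by simpa using hl)

theorem bary_mem_region (A : Mark) : bary A ∈ region A :=
  ⟨fun _ hi => bary_pos hi, fun i j hi hj => by rw [bary_of_mem hi]; exact bary_pos hj⟩

theorem line_mem_region {A : Mark} {x y : idealTetrahedron} (hx : x ∈ region A) (hy : y ∈ region A)
    (s : unitInterval) : line s x y ∈ region A := by
  have key : ∀ a b : ℝ, 0 < a → 0 < b → 0 < (1 - s) * a + s * b := by
    intro a b ha hb
    have h1 := mul_nonneg (sub_nonneg.2 s.2.2) ha.le
    rcases s.2.1.eq_or_lt with h | h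
    · rw [← h]; simpa using ha
    · have := mul_pos h hb
      linarith
  refine ⟨fun i hi => ?_, fun i j hi hj => ?_⟩
  · rw [line_apply]
    exact key _ _ (hx.1 i hi) (hy.1 i hi)
  · have := key _ _ (sub_pos.2 (hx.2 i j hi hj)) (sub_pos.2 (hy.2 i j hi hj))
    rw [line_apply, line_apply]
    linarith

/-- Both sets consist of the smallest coordinates, so they are nested. This makes `contract`
independent of the choice of the face. -/
theorem region_unique {A B : Mark} {x : idealTetrahedron} (hA : x ∈ region A) (hB : x ∈ region B)
    (h : A.1.card = B.1.card) : A = B := by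
  apply Subtype.ext
  refine Finset.eq_of_subset_of_card_le ?_ h.ge
  intro i hi
  by_contra hiB
  have hsub : B.1 ⊆ A.1.erase i := fun j hj => by
    refine Finset.mem_erase.2 ⟨fun h => hiB (h ▸ hj), ?_⟩
    by_contra hjA
    exact lt_asymm (hA.2 i j hi hjA) (hB.2 j i hj hiB)
  have := Finset.card_le_card hsub
  rw [Finset.card_erase_of_mem hi] at this
  have := Finset.card_pos.2 ⟨i, hi⟩
  omega

open Classical in
/-- Contraction at time `s` of the open stars of the faces with `k` vanishing coordinates towards
the barycenters of these faces. -/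
def contract (k : ℕ) (s : unitInterval) (x : idealTetrahedron) : idealTetrahedron :=
  if h : ∃ A : Mark, A.1.card = k ∧ x ∈ region A then line s x (bary h.choose) else x

theorem contract_eq {A : Mark} {x : idealTetrahedron} (hx : x ∈ region A) (s : unitInterval) :
    contract A.1.card s x = line s x (bary A) := by
  have h : ∃ B : Mark, B.1.card = A.1.card ∧ x ∈ region B := ⟨A, rfl, hx⟩
  rw [contract, dif_pos h, region_unique h.choose_spec.2 hx h.choose_spec.1]

theorem contract_apply_eq_zero (k : ℕ) (s : unitInterval) (x : idealTetrahedron) (i : Fin 4)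
    (hi : x.1 i = 0) : (contract k s x).1 i = 0 := by
  by_cases h : ∃ A : Mark, A.1.card = k ∧ x ∈ region A
  · obtain ⟨A, rfl, hA⟩ := h
    rw [contract_eq hA, line_apply, hi, bary_of_mem (mem_of_mem_region hA hi)]
    simp
  · rw [contract, dif_neg h, hi]

/-- Prescribing only the number of vanishing coordinates, and not the face, makes the contraction
commute with every relabelling. -/
theorem contract_permute (k : ℕ) (s : unitInterval) (σ : Equiv.Perm (Fin 4))
    (x : idealTetrahedron) : contract k s (permute σ x) = permute σ (contract k s x) := by
  by_cases h : ∃ A : Mark, A.1.card = k ∧ x ∈ region A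
  · obtain ⟨A, rfl, hA⟩ := h
    rw [contract_eq hA, ← Mark.card_map σ, contract_eq (permute_mem_region hA σ), permute_line,
      permute_bary]
  · have h' : ¬ ∃ A : Mark, A.1.card = k ∧ permute σ x ∈ region A := by
      rintro ⟨A, rfl, hA⟩
      refine h ⟨A.map σ.symm, Mark.card_map _ _, ?_⟩
      simpa only [permute_symm_permute] using permute_mem_region hA σ.symm
    rw [contract, dif_neg h', contract, dif_neg h]

end idealTetrahedron

/-! ### Strata of `M` and their contractible open stars -/

namespace FacePairing

open idealTetrahedron

variable {T : Type*} (P : FacePairing T)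

/-- One step of the identification of the faces of the tetrahedra. -/
inductive StratumRel : T × Mark → T × Mark → Prop
  | glue (t : T) (f : Fin 4) (A : Mark) (h : f ∈ A.1) :
      StratumRel (t, A) (P.glue t f, A.map (P.perm t f))

/-- The open faces of dimensions 3, 2 and 1 of the triangulation. -/
def Stratum : Type _ := Quot P.StratumRel

/-- The stratum of a face of a tetrahedron. -/
def stratum (t : T) (A : Mark) : P.Stratum := Quot.mk _ (t, A)

theorem stratum_glue (t : T) (f : Fin 4) (A : Mark) (h : f ∈ A.1) :
    P.stratum (P.glue t f) (A.map (P.perm t f)) = P.stratum t A :=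
  (Quot.sound (.glue t f A h)).symm

theorem eq_of_stratum_eq {α : Type*} (g : T → Mark → α)
    (hg : ∀ t f A, f ∈ A.1 → g (P.glue t f) (A.map (P.perm t f)) = g t A) {t t' : T} {A A' : Mark}
    (h : P.stratum t A = P.stratum t' A') : g t A = g t' A' := by
  have key : ∀ a b, P.StratumRel a b → g a.1 a.2 = g b.1 b.2 := by
    rintro _ _ ⟨t, f, A, h⟩
    exact (hg t f A h).symm
  exact congrArg (Quot.lift (fun a : T × Mark => g a.1 a.2) key) h

theorem card_eq_of_stratum_eq {t t' : T} {A A' : Mark} (h : P.stratum t A = P.stratum t' A') :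
    A.1.card = A'.1.card :=
  P.eq_of_stratum_eq (fun _ A => A.1.card) (fun _ _ A _ => Mark.card_map _ A) h

end FacePairing

namespace IdealCellulation

open idealTetrahedron Path

variable {M : Type*} [TopologicalSpace M] {T : Type*} (𝒞 : IdealCellulation M T)

/-- The open star of a stratum. -/
def star (a : 𝒞.Stratum) : Set M :=
  {m | ∃ t x A, 𝒞.point t x = m ∧ 𝒞.stratum t A = a ∧ x ∈ region A}

theorem point_mem_star {a : 𝒞.Stratum} {t : T} {x : idealTetrahedron} :
    𝒞.point t x ∈ 𝒞.star a ↔ ∃ A, 𝒞.stratum t A = a ∧ x ∈ region A := by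
  constructor
  · rintro ⟨t', x', A, h, hA⟩
    refine 𝒞.rel_of_point_eq (Q := fun t x => ∃ A, 𝒞.stratum t A = a ∧ x ∈ region A) ?_ h ⟨A, hA⟩
    rintro t f x hx ⟨B, rfl, hB⟩
    exact ⟨B.map _, 𝒞.stratum_glue t f B (mem_of_mem_region hB hx), permute_mem_region hB _⟩
  · rintro ⟨A, hA⟩
    exact ⟨t, x, A, rfl, hA⟩

theorem isOpen_star (a : 𝒞.Stratum) : IsOpen (𝒞.star a) := by
  rw [← 𝒞.isQuotientMap_point.isOpen_preimage, isOpen_sigma_iff]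
  intro t
  have : Sigma.mk t ⁻¹' ((fun p : Σ _ : T, idealTetrahedron => 𝒞.point p.1 p.2) ⁻¹' 𝒞.star a) =
      ⋃ A : Mark, ⋃ _ : 𝒞.stratum t A = a, region A := by
    ext x
    simp only [Set.mem_preimage, point_mem_star, Set.mem_iUnion, exists_prop]
  rw [this]
  exact isOpen_iUnion fun A => isOpen_iUnion fun _ => isOpen_region A

theorem exists_mem_star (m : M) : ∃ a, m ∈ 𝒞.star a := by
  obtain ⟨t, x, rfl⟩ := 𝒞.exists_point m
  obtain ⟨A, hA⟩ := exists_mem_region x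
  exact ⟨𝒞.stratum t A, 𝒞.point_mem_star.2 ⟨A, rfl, hA⟩⟩

theorem point_bary_eq {t t' : T} {A A' : Mark} (h : 𝒞.stratum t A = 𝒞.stratum t' A') :
    𝒞.point t (bary A) = 𝒞.point t' (bary A') :=
  𝒞.eq_of_stratum_eq (fun t A => 𝒞.point t (bary A)) (fun t f A h => by
    rw [← permute_bary, 𝒞.point_eq t f _ (bary_of_mem h)]) h

/-- `contract` shrinks each region along straight lines to its barycenter. It need not be continuous
on the whole tetrahedron, so continuity is tested over the open star, on whose preimage the gluing
map is still a quotient map. -/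
theorem star_contractible (t₀ : T) (A₀ : Mark) :
    ContractibleSpace (𝒞.star (𝒞.stratum t₀ A₀)) := by
  set U := 𝒞.star (𝒞.stratum t₀ A₀)
  have hU : IsOpen U := 𝒞.isOpen_star _
  let K : unitInterval → M → M := fun s => 𝒞.descend (contract A₀.1.card s)
    (contract_apply_eq_zero _ s) (contract_permute _ s)
  have hK : ∀ s t A x, 𝒞.stratum t A = 𝒞.stratum t₀ A₀ → x ∈ region A →
      K s (𝒞.point t x) = 𝒞.point t (line s x (bary A)) := fun s t A x h hx => by
    rw [show K s _ = _ from 𝒞.descend_point _ _ _ t x, ← 𝒞.card_eq_of_stratum_eq h, contract_eq hx]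
  have hKU : ∀ s, ∀ m ∈ U, K s m ∈ U := by
    rintro s _ ⟨t, x, A, rfl, h, hx⟩
    rw [hK s t A x h hx]
    exact ⟨t, _, A, rfl, h, line_mem_region hx (bary_mem_region A) s⟩
  have hc : Continuous fun p : unitInterval × U => K p.1 p.2 := by
    have hq := 𝒞.isQuotientMap_point.restrictPreimage_isOpen hU
    refine hq.continuous_lift_prod_right (g := fun p : unitInterval × U => K p.1 p.2) ?_
    have h1 : ContinuousOn
        (fun p : unitInterval × (Σ _ : T, idealTetrahedron) => K p.1 (𝒞.point p.2.1 p.2.2))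
        {p | 𝒞.point p.2.1 p.2.2 ∈ U} := by
      rintro ⟨s, t, x⟩ hp
      obtain ⟨A, hA, hx⟩ := 𝒞.point_mem_star.1 hp
      refine ContinuousAt.continuousWithinAt ?_
      have he : IsOpenEmbedding fun p : unitInterval × idealTetrahedron =>
          ((p.1, ⟨t, p.2⟩) : unitInterval × (Σ _ : T, idealTetrahedron)) :=
        IsOpenEmbedding.id.prodMap IsOpenEmbedding.sigmaMk
      rw [← he.continuousAt_iff (x := (s, x))]
      have hcont : Continuous fun p : unitInterval × idealTetrahedron =>
          𝒞.point t (line p.1 p.2 (bary A)) :=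
        (𝒞.continuous_point t).comp (continuous_line continuous_fst continuous_snd continuous_const)
      refine hcont.continuousAt.congr ?_
      -- Near `(s, x)` the region, and with it the target barycenter, does not change.
      have hn : {p : unitInterval × idealTetrahedron | p.2 ∈ region A} ∈ 𝓝 (s, x) :=
        ((isOpen_region A).preimage continuous_snd).mem_nhds hx
      filter_upwards [hn] with p hp
      exact (hK p.1 t A p.2 hA hp).symm
    have h2 := h1.comp_continuous (f := fun p : unitInterval ×
      ((fun p : Σ _ : T, idealTetrahedron => 𝒞.point p.1 p.2) ⁻¹' U) => (p.1, p.2.1))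
      (by fun_prop) fun p => p.2.2
    exact h2
  rw [contractible_iff_id_nullhomotopic]
  let b : U := ⟨𝒞.point t₀ (bary A₀), t₀, _, A₀, rfl, rfl, bary_mem_region A₀⟩
  let F : (ContinuousMap.id U).Homotopy (ContinuousMap.const U b) :=
    { toFun := fun p => ⟨K p.1 p.2, hKU _ _ p.2.2⟩
      continuous_toFun := hc.subtype_mk _
      map_zero_left := by
        rintro ⟨_, t, x, A, rfl, h, hx⟩
        exact Subtype.ext ((hK 0 t A x h hx).trans (by rw [line_zero]; rfl))
      map_one_left := by
        rintro ⟨_, t, x, A, rfl, h, hx⟩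
        exact Subtype.ext ((hK 1 t A x h hx).trans (by
          rw [line_one]; exact 𝒞.point_bary_eq h)) }
  exact ⟨b, ⟨F⟩⟩

theorem _root_.Path.homotopic_of_mem {X : Type*} [TopologicalSpace X] {U : Set X}
    [SimplyConnectedSpace U] {x y : X} {p q : Path x y} (hp : ∀ s, p s ∈ U) (hq : ∀ s, q s ∈ U) :
    p.Homotopic q := by
  have hx : x ∈ U := by simpa using hp 0
  have hy : y ∈ U := by simpa using hp 1
  let lift (p : Path x y) (hp : ∀ s, p s ∈ U) : Path (⟨x, hx⟩ : U) ⟨y, hy⟩ :=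
    { toFun := fun s => ⟨p s, hp s⟩
      continuous_toFun := p.continuous.subtype_mk _
      source' := Subtype.ext p.source
      target' := Subtype.ext p.target }
  exact (SimplyConnectedSpace.paths_homotopic (lift p hp) (lift q hq)).map
    ⟨Subtype.val, continuous_subtype_val⟩

/-- Both paths stay in the star, which is simply connected. -/
theorem mk_eq_of_mem_star {a : 𝒞.Stratum} {m m' : M} (p : Path m m') (hp : ∀ s, p s ∈ 𝒞.star a)
    {t t' : T} {x x' : idealTetrahedron} {A A' : Mark} (hm : 𝒞.point t x = m)
    (hA : 𝒞.stratum t A = a) (hx : x ∈ region A) (hm' : 𝒞.point t' x' = m')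
    (hA' : 𝒞.stratum t' A' = a) (hx' : x' ∈ region A') :
    Homotopic.Quotient.mk p = (𝒞.seg t x (bary A) hm rfl).trans
      (𝒞.seg t' (bary A') x' (𝒞.point_bary_eq (hA'.trans hA.symm)) hm') := by
  subst hA
  have := 𝒞.star_contractible t A
  rw [seg, seg, ← Homotopic.Quotient.mk_trans, Homotopic.Quotient.eq]
  refine Path.homotopic_of_mem hp fun s => ?_
  have h1 : ∀ s, 𝒞.point t (line s x (bary A)) ∈ 𝒞.star (𝒞.stratum t A) := fun s =>
    ⟨t, _, A, rfl, rfl, line_mem_region hx (bary_mem_region A) s⟩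
  have h2 : ∀ s, 𝒞.point t' (line s (bary A') x') ∈ 𝒞.star (𝒞.stratum t A) := fun s =>
    ⟨t', _, A', rfl, hA', line_mem_region (bary_mem_region A') hx' s⟩
  rw [Path.trans_apply]
  split_ifs
  · exact h1 _
  · exact h2 _

/-! ### The loops through dual edges generate the fundamental group -/

section Loops

variable {v : M} (τ : ∀ t, Homotopic.Quotient v (𝒞.dualVertex t))

/-- The subgroup generated by the loops through the dual edges. -/
def edgeSubgroup : Subgroup (FundamentalGroup M v) := Subgroup.closure (Set.range (𝒞.edgeLoop τ))

theorem exists_approach_eq {t t' : T} {x x' : idealTetrahedron} {m : M} (hx : 𝒞.point t x = m)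
    (hx' : 𝒞.point t' x' = m) : ∃ g ∈ 𝒞.edgeSubgroup τ,
      𝒞.approach τ t x hx = Homotopic.Quotient.trans g.toPath (𝒞.approach τ t' x' hx') := by
  refine 𝒞.rel_of_point_eq (Q := fun t' x' => ∀ hx' : 𝒞.point t' x' = m, ∃ g ∈ 𝒞.edgeSubgroup τ,
    𝒞.approach τ t x hx = Homotopic.Quotient.trans g.toPath (𝒞.approach τ t' x' hx')) ?_
    (hx.trans hx'.symm) ?_ hx'
  · intro t' f x' hf ih hx'
    obtain ⟨g, hg, h⟩ := ih ((𝒞.point_eq t' f x' hf).trans hx')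
    refine ⟨𝒞.edgeLoop τ (t', f) * g,
      mul_mem (Subgroup.subset_closure (Set.mem_range_self _)) hg, ?_⟩
    rw [h, 𝒞.approach_eq τ t' f hf, FundamentalGroup.mul_def]
    exact (Homotopic.Quotient.trans_assoc _ _ _).symm
  · exact fun hx' => ⟨1, one_mem _, (Homotopic.Quotient.refl_trans _).symm⟩

/-- A class of paths is carried by the dual edges if it is, up to the paths to the barycenters of
the tetrahedra, a product of loops through dual edges. -/
def IsCarried {m m' : M} (q : Homotopic.Quotient m m') : Prop :=
  ∀ (t : T) (x : idealTetrahedron) (hx : 𝒞.point t x = m) (t' : T) (x' : idealTetrahedron)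
    (hx' : 𝒞.point t' x' = m'), ∃ g ∈ 𝒞.edgeSubgroup τ,
      (𝒞.approach τ t x hx).trans q = Homotopic.Quotient.trans g.toPath (𝒞.approach τ t' x' hx')

/-- Approaching the endpoints through other tetrahedra costs only factors from `edgeSubgroup`, so a
single choice is enough. -/
theorem IsCarried.of_exists {m m' : M} {q : Homotopic.Quotient m m'}
    (h : ∃ (t : T) (x : idealTetrahedron) (hx : 𝒞.point t x = m) (t' : T) (x' : idealTetrahedron)
      (hx' : 𝒞.point t' x' = m'), ∃ g ∈ 𝒞.edgeSubgroup τ, (𝒞.approach τ t x hx).trans q =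
        Homotopic.Quotient.trans g.toPath (𝒞.approach τ t' x' hx')) : 𝒞.IsCarried τ q := by
  obtain ⟨t, x, hx, t', x', hx', g, hg, h⟩ := h
  intro s y hy s' y' hy'
  obtain ⟨g₁, hg₁, h₁⟩ := 𝒞.exists_approach_eq τ hy hx
  obtain ⟨g₂, hg₂, h₂⟩ := 𝒞.exists_approach_eq τ hx' hy'
  refine ⟨g₂ * (g * g₁), mul_mem hg₂ (mul_mem hg hg₁), ?_⟩
  rw [h₁, Homotopic.Quotient.trans_assoc, h, h₂]
  simp only [FundamentalGroup.mul_def, Homotopic.Quotient.trans_assoc]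

theorem IsCarried.trans {m m' m'' : M} {q : Homotopic.Quotient m m'} {q' : Homotopic.Quotient m' m''}
    (h : 𝒞.IsCarried τ q) (h' : 𝒞.IsCarried τ q') : 𝒞.IsCarried τ (q.trans q') := by
  intro t x hx t'' x'' hx''
  obtain ⟨t', x', hx'⟩ := 𝒞.exists_point m'
  obtain ⟨g, hg, h⟩ := h t x hx t' x' hx'
  obtain ⟨g', hg', h'⟩ := h' t' x' hx' t'' x'' hx''
  refine ⟨g' * g, mul_mem hg' hg, ?_⟩
  rw [← Homotopic.Quotient.trans_assoc, h, Homotopic.Quotient.trans_assoc, h',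
    ← Homotopic.Quotient.trans_assoc]
  rfl

theorem isCarried_of_mem_star {a : 𝒞.Stratum} {m m' : M} (p : Path m m')
    (hp : ∀ s, p s ∈ 𝒞.star a) : 𝒞.IsCarried τ (Homotopic.Quotient.mk p) := by
  have h0 : m ∈ 𝒞.star a := by simpa using hp 0
  have h1 : m' ∈ 𝒞.star a := by simpa using hp 1
  obtain ⟨t, x, A, hm, hA, hx⟩ := h0
  obtain ⟨t', x', A', hm', hA', hx'⟩ := h1
  refine IsCarried.of_exists 𝒞 τ ⟨t, x, hm, t', x', hm', ?_⟩
  obtain ⟨g, hg, h⟩ := 𝒞.exists_approach_eq τ (t := t) (x := bary A) rfl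
    (𝒞.point_bary_eq (hA'.trans hA.symm))
  refine ⟨g, hg, ?_⟩
  rw [𝒞.mk_eq_of_mem_star p hp hm hA hx hm' hA' hx', ← Homotopic.Quotient.trans_assoc, approach,
    Homotopic.Quotient.trans_assoc (τ t), seg_trans]
  change (𝒞.approach τ t (bary A) rfl).trans _ = _
  rw [h, approach, approach, Homotopic.Quotient.trans_assoc, Homotopic.Quotient.trans_assoc,
    seg_trans]

theorem IsCarried.of_cast {m m' n n' : M} {p : Path m m'} {h : n = m} {h' : n' = m'}
    (hp : 𝒞.IsCarried τ (Homotopic.Quotient.mk (p.cast h h'))) :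
    𝒞.IsCarried τ (Homotopic.Quotient.mk p) := by
  subst h h'
  exact hp

/-- By compactness the path is cut into finitely many pieces, each inside one open star; carried
classes are closed under concatenation. -/
theorem isCarried {m m' : M} (q : Homotopic.Quotient m m') : 𝒞.IsCarried τ q := by
  obtain ⟨p, rfl⟩ := Homotopic.Quotient.mk_surjective q
  obtain ⟨s, hs0, hmono, ⟨n, hn⟩, hs⟩ := exists_monotone_Icc_subset_open_cover_unitInterval
    (c := fun a : 𝒞.Stratum => p ⁻¹' 𝒞.star a) (fun a => (𝒞.isOpen_star a).preimage p.continuous)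
    fun r _ => Set.mem_iUnion.2 (𝒞.exists_mem_star (p r))
  have key : ∀ k, 𝒞.IsCarried τ (Homotopic.Quotient.mk (p.subpath (s 0) (s k))) := by
    intro k
    have hstep : ∀ k, 𝒞.IsCarried τ (Homotopic.Quotient.mk (p.subpath (s k) (s (k + 1)))) := by
      intro k
      obtain ⟨a, ha⟩ := hs k
      refine 𝒞.isCarried_of_mem_star τ (a := a) _ fun r => ?_
      have hr : p.subpath (s k) (s (k + 1)) r ∈ Set.range (p.subpath (s k) (s (k + 1))) := ⟨r, rfl⟩
      rw [range_subpath_of_le _ _ _ (hmono k.le_succ)] at hr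
      obtain ⟨r', hr', h⟩ := hr
      rw [← h]
      exact ha hr'
    induction k with
    | zero =>
      obtain ⟨a, ha⟩ := 𝒞.exists_mem_star (p (s 0))
      refine 𝒞.isCarried_of_mem_star τ (a := a) _ fun r => ?_
      rwa [subpath_self]
    | succ k ih =>
      have h := IsCarried.trans 𝒞 τ ih (hstep k)
      rwa [← Homotopic.Quotient.mk_trans,
        Homotopic.Quotient.eq.2 ⟨Homotopy.subpathTransSubpath p (s 0) (s k) (s (k + 1))⟩] at h
  have h := key n
  rw [hs0, hn n le_rfl, subpath_zero_one] at h
  exact IsCarried.of_cast 𝒞 τ h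

end Loops

end IdealCellulation

/-! ### The cover defined by a group-valued function on dual edges -/

namespace FacePairing

open idealTetrahedron

variable {T : Type*} (P : FacePairing T) {G : Type*} [Group G]

theorem stratumRel_symm {a b : T × Mark} (h : P.StratumRel a b) : P.StratumRel b a := by
  obtain ⟨t, f, A, hf⟩ := h
  have h := StratumRel.glue (P := P) (P.glue t f) (P.perm t f f) (A.map (P.perm t f))
    (by simpa using hf)
  have hA : (A.map (P.perm t f)).map (P.perm t f).symm = A :=
    Subtype.ext (Finset.ext fun i => by simp)
  rwa [P.glue_glue, P.perm_perm, hA] at h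

theorem rel_of_stratum_eq {Q : T → Mark → Prop}
    (hQ : ∀ t f A, f ∈ A.1 → Q t A → Q (P.glue t f) (A.map (P.perm t f)))
    {t t' : T} {A A' : Mark} (h : P.stratum t A = P.stratum t' A') (hx : Q t A) : Q t' A' := by
  have key : ∀ a b, P.StratumRel a b → Q a.1 a.2 → Q b.1 b.2 := by
    rintro _ _ ⟨t, f, A, hf⟩ h
    exact hQ t f A hf h
  have hsymm := congrArg (Quot.lift (fun a : T × Mark => Q a.1 a.2) fun a b h =>
    propext ⟨key a b h, key b a (P.stratumRel_symm h)⟩) h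
  exact hsymm.mp hx

theorem Corner.mark_swap (c : Corner T) : c.swap.mark = c.mark :=
  Subtype.ext (Finset.pair_comm _ _)

/-- The gluing of the copies of the tetrahedra indexed by a group `G`, in which crossing an oriented
dual edge multiplies the index by the value of `F`. -/
@[simps]
def cover (F : T × Fin 4 → G) (hF : ∀ a, F (P.opp a) = (F a)⁻¹) : FacePairing (T × G) where
  glue s f := (P.glue s.1 f, F (s.1, f) * s.2)
  perm s f := P.perm s.1 f
  glue_glue s f := by
    have h : F (P.glue s.1 f, P.perm s.1 f f) = (F (s.1, f))⁻¹ := hF (s.1, f)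
    ext1
    · exact P.glue_glue _ _
    · exact (congrArg (· * (F (s.1, f) * s.2)) h).trans (inv_mul_cancel_left _ _)
  perm_perm s f := P.perm_perm _ _
  no_self_gluing s f h := P.no_self_gluing s.1 f (congrArg Prod.fst h)

/-- The image of a corner of a copy of a tetrahedron. -/
def Corner.base (d : Corner (T × G)) : Corner T := ⟨d.tet.1, d.enter, d.exit, d.ne⟩

variable {F : T × Fin 4 → G} (hF : ∀ a, F (P.opp a) = (F a)⁻¹)

theorem base_stepPerm_zpow (m : ℤ) (d : Corner (T × G)) :
    (((P.cover F hF).stepPerm ^ m) d).base = (P.stepPerm ^ m) d.base := by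
  induction m with
  | zero => rfl
  | succ m ih =>
    rw [add_comm, zpow_one_add, zpow_one_add, Equiv.Perm.mul_apply, Equiv.Perm.mul_apply, ← ih]
    rfl
  | pred m ih =>
    rw [sub_eq_add_neg, add_comm, zpow_add, zpow_add, Equiv.Perm.mul_apply, Equiv.Perm.mul_apply,
      ← ih, zpow_neg_one, zpow_neg_one]
    rfl

/-- The rotation about an edge closes up in the cover as soon as it does below. -/
def Closes (d : Corner (T × G)) : Prop :=
  ∀ m : ℤ, (P.stepPerm ^ m) d.base = d.base → ((P.cover F hF).stepPerm ^ m) d = d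

theorem Closes.of_zpow {d : Corner (T × G)} {j : ℤ}
    (h : P.Closes hF (((P.cover F hF).stepPerm ^ j) d)) : P.Closes hF d := by
  intro m hm
  have h1 := h m (by
    rw [base_stepPerm_zpow, ← Equiv.Perm.mul_apply, ← zpow_add, add_comm, zpow_add,
      Equiv.Perm.mul_apply, hm])
  rw [← Equiv.Perm.mul_apply, ← zpow_add, add_comm, zpow_add, Equiv.Perm.mul_apply] at h1
  exact (Equiv.injective _) h1

theorem Closes.of_swap {d : Corner (T × G)} (h : P.Closes hF d.swap) : P.Closes hF d := by
  intro m hm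
  have h1 := h (-m) (by
    change (P.stepPerm ^ (-m)) d.base.swap = d.base.swap
    rw [P.stepPerm_zpow_swap, neg_neg, hm])
  rw [stepPerm_zpow_swap, neg_neg] at h1
  exact congrArg Corner.swap h1

/-- One period multiplies the sheet by the holonomy of the rotation walk, and every rotation that
closes up below is a multiple of the period. -/
theorem Closes.of_hol {d : Corner (T × G)}
    (h : (P.rotationWalk (Function.minimalPeriod P.step d.base) d.base).hol F = 1) :
    P.Closes hF d := by
  have key : ∀ (n : ℕ) (d : Corner (T × G)), (((P.cover F hF).stepPerm ^ n) d).tet.2 =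
      (P.rotationWalk n d.base).hol F * d.tet.2 := by
    intro n
    induction n with
    | zero => intro d; exact (one_mul _).symm
    | succ n ih =>
      intro d
      rw [pow_succ, Equiv.Perm.mul_apply, ih]
      exact (mul_assoc _ _ _).symm
  intro m hm
  have hdvd := (MulAction.zpow_smul_eq_iff_minimalPeriod_dvd
    (a := P.stepPerm) (b := d.base) (n := m)).1 hm
  obtain ⟨k, rfl⟩ := hdvd
  change ((P.cover F hF).stepPerm ^ ((Function.minimalPeriod P.step d.base : ℤ) * k)) d = d
  rw [zpow_mul, zpow_natCast]
  refine Equiv.Perm.zpow_apply_eq_self_of_apply_eq_self ?_ k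
  have h1 := key (Function.minimalPeriod P.step d.base) d
  rw [h, one_mul] at h1
  have h2 := P.base_stepPerm_zpow hF (Function.minimalPeriod P.step d.base) d
  have h3 : (P.stepPerm ^ (Function.minimalPeriod P.step d.base : ℤ)) d.base = d.base := by
    rw [zpow_natCast, ← Equiv.Perm.iterate_eq_pow]
    exact Function.iterate_minimalPeriod (f := P.step)
  rw [h3, zpow_natCast] at h2
  have h4 := congrArg Corner.tet h2
  have h5 := congrArg Corner.enter h2
  have h6 := congrArg Corner.exit h2
  exact Corner.ext (Prod.ext h4 h1) h5 h6

/-- Closing up depends neither on the starting corner nor on the direction of rotation, so one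
corner in each class suffices. -/
theorem closes_of_forall_dualFace {corner : P.DualFace → Corner T}
    (hcorner : ∀ c, P.dualFace (corner c) = c)
    (h : ∀ c, (P.rotationWalk (Function.minimalPeriod P.step (corner c)) (corner c)).hol F = 1)
    (d : Corner (T × G)) : P.Closes hF d := by
  obtain ⟨m, hm | hm⟩ := P.dualFace_eq_iff.1 (hcorner (P.dualFace d.base))
  · refine Closes.of_zpow P hF (j := -m) (Closes.of_hol P hF ?_)
    have : (((P.cover F hF).stepPerm ^ (-m)) d).base = corner (P.dualFace d.base) := by
      rw [base_stepPerm_zpow]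
      nth_rw 1 [hm]
      rw [← Equiv.Perm.mul_apply, ← zpow_add, neg_add_cancel]
      rfl
    rw [this]
    exact h _
  · refine Closes.of_swap P hF (Closes.of_zpow P hF (j := -m) (Closes.of_hol P hF ?_))
    have : (((P.cover F hF).stepPerm ^ (-m)) d.swap).base = corner (P.dualFace d.base) := by
      rw [base_stepPerm_zpow]
      change (P.stepPerm ^ (-m)) d.base.swap = _
      nth_rw 1 [hm]
      rw [Corner.swap_swap, ← Equiv.Perm.mul_apply, ← zpow_add, neg_add_cancel]
      rfl
    rw [this]
    exact h _

/-- This is what keeps the sheets apart. An open tetrahedron is not glued at all; an open triangle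
has two sides, with different images below; an open edge is followed by rotation. A rotation that
returns to the same tetrahedron edge below cannot reverse the direction, so it closes up below and
hence in the cover. -/
theorem snd_eq_of_stratum_eq (hcl : ∀ d, P.Closes hF d) {t : T} {g g' : G} {A : Mark}
    (h : (P.cover F hF).stratum (t, g) A = (P.cover F hF).stratum (t, g') A) : g = g' := by
  have hcard : A.1.card = 0 ∨ A.1.card = 1 ∨ A.1.card = 2 := by have := A.2; omega
  rcases hcard with h0 | h1 | h2
  · have h := (P.cover F hF).rel_of_stratum_eq (Q := fun s B => s = (t, g) ∧ B = A) ?_ h ⟨rfl, rfl⟩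
    · exact (congrArg Prod.snd h.1).symm
    · rintro s f B hf ⟨rfl, rfl⟩
      rw [Finset.card_eq_zero.1 h0] at hf
      simp at hf
  · obtain ⟨f, hf⟩ := Finset.card_eq_one.1 h1
    have h := (P.cover F hF).rel_of_stratum_eq (Q := fun s B => ∃ k, B.1 = {k} ∧
      ((s, k) = ((t, g), f) ∨ (s, k) = (P.cover F hF).opp ((t, g), f))) ?_ h ⟨f, hf, .inl rfl⟩
    · obtain ⟨k, hk, h | h⟩ := h
      · exact (congrArg (fun a : (T × G) × Fin 4 => a.1.2) h).symm
      · rw [hf, Finset.singleton_inj] at hk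
        subst hk
        have h3 : (t, f) = P.opp (t, f) :=
          congrArg (fun a : (T × G) × Fin 4 => (a.1.1, a.2)) h
        exact absurd h3.symm (P.opp_ne (t, f))
    · rintro s i B hi ⟨k, hB, h⟩
      rw [hB, Finset.mem_singleton] at hi
      subst hi
      refine ⟨(P.cover F hF).perm s i i, by simp [Mark.map, hB], ?_⟩
      change (P.cover F hF).opp (s, i) = _ ∨ (P.cover F hF).opp (s, i) = _
      rcases h with h | h
      · exact .inr (by rw [h])
      · exact .inl (by rw [h, opp_opp])
  · obtain ⟨k, l, hkl, hA⟩ := Finset.card_eq_two.1 h2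
    have hA' : A = Corner.mark ⟨t, k, l, hkl⟩ := Subtype.ext hA
    let c : Corner (T × G) := ⟨(t, g), k, l, hkl⟩
    have h := (P.cover F hF).rel_of_stratum_eq (Q := fun s B => ∃ m : ℤ,
      s = (((P.cover F hF).stepPerm ^ m) c).tet ∧ B = (((P.cover F hF).stepPerm ^ m) c).mark)
      ?_ h ⟨0, rfl, hA'⟩
    · obtain ⟨m, hm, hm'⟩ := h
      have hd : (((P.cover F hF).stepPerm ^ m) c).base = c.base ∨
          (((P.cover F hF).stepPerm ^ m) c).base = c.base.swap := by
        have h3 : ({k, l} : Finset (Fin 4)) = {(((P.cover F hF).stepPerm ^ m) c).enter,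
          (((P.cover F hF).stepPerm ^ m) c).exit} := hA.symm.trans (congrArg Subtype.val hm')
        have h4 : ({k, l} : Set (Fin 4)) = {(((P.cover F hF).stepPerm ^ m) c).enter,
          (((P.cover F hF).stepPerm ^ m) c).exit} := by
          simpa using congrArg (fun B : Finset (Fin 4) => (B : Set (Fin 4))) h3
        rcases Set.pair_eq_pair_iff.1 h4 with ⟨h5, h6⟩ | ⟨h5, h6⟩
        · exact .inl (Corner.ext (congrArg Prod.fst hm).symm h5.symm h6.symm)
        · exact .inr (Corner.ext (congrArg Prod.fst hm).symm h6.symm h5.symm)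
      rw [base_stepPerm_zpow] at hd
      rcases hd with hd | hd
      · have := hcl c m hd
        rw [this] at hm
        exact (congrArg Prod.snd hm).symm
      · exact absurd hd (P.stepPerm_zpow_ne_swap _ _)
    · rintro s f B hf ⟨m, rfl, rfl⟩
      have hf' : f = (((P.cover F hF).stepPerm ^ m) c).enter ∨
          f = (((P.cover F hF).stepPerm ^ m) c).exit := by
        simpa [Corner.mark] using hf
      generalize hd : ((P.cover F hF).stepPerm ^ m) c = d at *
      rcases hf' with rfl | rfl
      -- The face `enter` is crossed by a backward rotation, the face `exit` by a forward one.
      · refine ⟨-1 + m, ?_⟩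
        rw [zpow_add, Equiv.Perm.mul_apply, hd, zpow_neg_one]
        refine ⟨rfl, ?_⟩
        change _ = ((P.cover F hF).step d.swap).swap.mark
        rw [Corner.mark_swap, mark_step, Corner.mark_swap]
        rfl
      · refine ⟨1 + m, ?_⟩
        rw [zpow_add, Equiv.Perm.mul_apply, hd, zpow_one]
        exact ⟨rfl, (mark_step _ d).symm⟩

end FacePairing

/-! ### The covering map and the lifting of walks -/

namespace IdealCellulation

open idealTetrahedron Path

variable {M : Type*} [TopologicalSpace M] {T : Type*} (𝒞 : IdealCellulation M T)
  {G : Type*} [Group G] {F : T × Fin 4 → G} (hF : ∀ a, F (𝒞.opp a) = (F a)⁻¹)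

/-- The cellulation of the total space of the cover. -/
def coverCellulation : IdealCellulation (𝒞.cover F hF).Space (T × G) :=
  { 𝒞.cover F hF with homeo := Homeomorph.refl _ }

/-- The projection of the cover. -/
def coverProj : (𝒞.cover F hF).Space → M :=
  Quot.lift (fun p : Σ _ : T × G, idealTetrahedron => 𝒞.point p.1.1 p.2) (by
    rintro _ _ ⟨s, f, x, hx⟩
    exact 𝒞.point_eq s.1 f x hx)

theorem coverProj_point (s : T × G) (x : idealTetrahedron) :
    𝒞.coverProj hF ((𝒞.coverCellulation hF).point s x) = 𝒞.point s.1 x := rfl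

/-- Crossing a face multiplies the sheet on the left, so right multiplications respect the gluings;
the inverse turns them into a left action. -/
instance coverMulAction : MulAction G (𝒞.cover F hF).Space where
  smul h := Quot.map (fun p => ⟨(p.1.1, p.1.2 * h⁻¹), p.2⟩) (by
    rintro _ _ ⟨s, f, x, hx⟩
    have := FacePairing.FaceRel.glue (P := 𝒞.cover F hF) (s.1, s.2 * h⁻¹) f x hx
    simpa only [FacePairing.cover_glue, FacePairing.cover_perm, mul_assoc] using this)
  one_smul := by
    rintro ⟨⟨⟨t, g⟩, x⟩⟩
    exact congrArg (fun g => Quot.mk (𝒞.cover F hF).FaceRel ⟨(t, g), x⟩)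
      (show g * 1⁻¹ = g by simp)
  mul_smul h h' := by
    rintro ⟨⟨⟨t, g⟩, x⟩⟩
    exact congrArg (fun g => Quot.mk (𝒞.cover F hF).FaceRel ⟨(t, g), x⟩)
      (show g * (h * h')⁻¹ = g * h'⁻¹ * h⁻¹ by simp [mul_assoc])

theorem smul_point (h : G) (t : T) (g : G) (x : idealTetrahedron) :
    h • (𝒞.coverCellulation hF).point (t, g) x =
      (𝒞.coverCellulation hF).point (t, g * h⁻¹) x := rfl

/-- Open stars are the evenly covered sets: if a star meets its translate by `h`, the same open face
of the same tetrahedron in the sheets `g` and `g * h⁻¹` belongs to one stratum, so `h = 1`. -/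
theorem isQuotientCoveringMap_coverProj (hcl : ∀ d, 𝒞.Closes hF d) :
    IsQuotientCoveringMap (𝒞.coverProj hF) G where
  toIsQuotientMap := by
    have hc : Continuous (𝒞.coverProj hF) :=
      (𝒞.coverCellulation hF).isQuotientMap_point.continuous_iff.2
        (continuous_sigma fun s => 𝒞.continuous_point s.1)
    refine IsQuotientMap.of_comp (f := fun p : Σ _ : T, idealTetrahedron =>
      (𝒞.coverCellulation hF).point (p.1, 1) p.2) ?_ hc 𝒞.isQuotientMap_point
    exact continuous_sigma fun t => (𝒞.coverCellulation hF).continuous_point (t, 1)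
  continuous_const_smul h := (𝒞.coverCellulation hF).isQuotientMap_point.continuous_iff.2
    (continuous_sigma fun s => (𝒞.coverCellulation hF).continuous_point (s.1, s.2 * h⁻¹))
  apply_eq_iff_mem_orbit {e₁ e₂} := by
    obtain ⟨⟨t₁, g₁⟩, x₁, rfl⟩ := (𝒞.coverCellulation hF).exists_point e₁
    obtain ⟨⟨t₂, g₂⟩, x₂, rfl⟩ := (𝒞.coverCellulation hF).exists_point e₂
    constructor
    · intro h
      obtain ⟨g, hg⟩ := 𝒞.rel_of_point_eq (Q := fun t x => ∃ g,
        (𝒞.coverCellulation hF).point (t₁, g₁) x₁ = (𝒞.coverCellulation hF).point (t, g) x) (by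
          rintro t f x hx ⟨g, hg⟩
          exact ⟨F (t, f) * g, hg.trans ((𝒞.coverCellulation hF).point_eq (t, g) f x hx)⟩)
        h ⟨g₁, rfl⟩
      refine ⟨g⁻¹ * g₂, ?_⟩
      simp only
      rw [hg, smul_point, mul_inv_rev, inv_inv, mul_inv_cancel_left]
    · rintro ⟨h, hh⟩
      simp only at hh
      rw [← hh, smul_point, coverProj_point, coverProj_point]
  disjoint e := by
    obtain ⟨a, ha⟩ := (𝒞.coverCellulation hF).exists_mem_star e
    refine ⟨_, ((𝒞.coverCellulation hF).isOpen_star a).mem_nhds ha, ?_⟩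
    rintro h ⟨_, ⟨y, ⟨⟨t, g⟩, x, A, rfl, rfl, hx⟩, rfl⟩, hy⟩
    simp only [smul_point] at hy
    obtain ⟨B, hB, hxB⟩ := (𝒞.coverCellulation hF).point_mem_star.1 hy
    obtain rfl := region_unique hxB hx ((𝒞.coverCellulation hF).card_eq_of_stratum_eq hB)
    have := 𝒞.snd_eq_of_stratum_eq hF hcl hB
    simpa using this

/-- The final sheet is a variable `g'` with an equation, because induction yields it only up to
associativity. -/
theorem exists_lift_walkPath {s t : T} (w : 𝒞.Walk s t) (g : G) :
    ∃ g', g' = w.hol F * g ∧ ∃ γ : Path ((𝒞.coverCellulation hF).dualVertex (s, g))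
      ((𝒞.coverCellulation hF).dualVertex (t, g')),
      ∀ r, 𝒞.coverProj hF (γ r) = 𝒞.walkPath w r := by
  induction w generalizing g with
  | nil t => exact ⟨g, (one_mul g).symm, Path.refl _, fun r => rfl⟩
  | @cons s t f w ih =>
    obtain ⟨g', hg', γ, hγ⟩ := ih (F (s, f) * g)
    let δ : Path ((𝒞.coverCellulation hF).dualVertex ((𝒞.coverCellulation hF).glue (s, g) f))
      ((𝒞.coverCellulation hF).dualVertex (t, g')) := γ
    refine ⟨g', by rw [hg', FacePairing.Walk.hol_cons, mul_assoc],
      ((𝒞.coverCellulation hF).edgePath (s, g) f).trans δ, fun r => ?_⟩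
    have h : ∀ r, 𝒞.coverProj hF ((𝒞.coverCellulation hF).edgePath (s, g) f r) =
        𝒞.edgePath s f r := fun r => by
      rw [edgePath, edgePath, Path.trans_apply, Path.trans_apply]
      split_ifs <;> rfl
    rw [walkPath, Path.trans_apply, Path.trans_apply]
    split_ifs
    · exact h _
    · exact hγ _

/-- The barycenter has no vanishing coordinate and is not glued to any point. -/
theorem dualVertex_injective {t t' : T} (h : 𝒞.dualVertex t = 𝒞.dualVertex t') : t = t' := by
  refine (𝒞.rel_of_point_eq (Q := fun t' x => t = t' ∧ x = center) ?_ h ⟨rfl, rfl⟩).1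
  rintro t f x hx ⟨rfl, rfl⟩
  norm_num [center] at hx

/-- Homotopic paths have the same monodromy, so the lifts starting in sheet 1 end at the same vertex
of the cover. -/
theorem hol_eq_of_mk_walkPath_eq (hcl : ∀ d, 𝒞.Closes hF d) {s t : T} {w w' : 𝒞.Walk s t}
    (h : Homotopic.Quotient.mk (𝒞.walkPath w) = Homotopic.Quotient.mk (𝒞.walkPath w')) :
    w.hol F = w'.hol F := by
  have cov := (𝒞.isQuotientCoveringMap_coverProj hF hcl).isCoveringMap
  obtain ⟨g, hg, γ, hγ⟩ := 𝒞.exists_lift_walkPath hF w 1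
  obtain ⟨g', hg', γ', hγ'⟩ := 𝒞.exists_lift_walkPath hF w' 1
  have h1 : (Homotopic.Quotient.mk γ).map ⟨_, cov.continuous⟩ =
      Homotopic.Quotient.mk (𝒞.walkPath w) :=
    congrArg Homotopic.Quotient.mk (Path.ext (funext hγ))
  have h2 : (Homotopic.Quotient.mk γ').map ⟨_, cov.continuous⟩ =
      Homotopic.Quotient.mk (𝒞.walkPath w') :=
    congrArg Homotopic.Quotient.mk (Path.ext (funext hγ'))
  have h3 := cov.monodromy_map (Homotopic.Quotient.mk γ)
  have h4 := cov.monodromy_map (Homotopic.Quotient.mk γ')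
  rw [h1, h] at h3
  rw [h2] at h4
  have h5 := congrArg Subtype.val (h3.symm.trans h4)
  have h6 := (𝒞.coverCellulation hF).dualVertex_injective h5
  have h7 := congrArg Prod.snd h6
  simpa [hg, hg'] using h7

end IdealCellulation

/-! ### The presentation of the fundamental group -/

namespace FacePairing

theorem Walk.map_hol {T : Type*} {P : FacePairing T} {G H : Type*} [Group G] [Group H] (φ : G →* H)
    (F : T × Fin 4 → G) {s t : T} (w : P.Walk s t) : φ (w.hol F) = w.hol fun a => φ (F a) := by
  induction w with
  | nil => exact map_one φ
  | cons f w ih => rw [hol_cons, map_mul, ih, hol_cons]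

end FacePairing

namespace IdealCellulation

open idealTetrahedron Path

variable {M : Type*} [TopologicalSpace M] {T : Type*} (𝒞 : IdealCellulation M T)

theorem exists_fundamentalGroup_presentation {S : Set 𝒞.DualEdge} (hS : 𝒞.IsSpanningTree S)
    {orient : 𝒞.DualEdge → T × Fin 4} (horient : ∀ e, 𝒞.dualEdge (orient e) = e)
    {corner : 𝒞.DualFace → FacePairing.Corner T} (hcorner : ∀ c, 𝒞.dualFace (corner c) = c)
    (t₀ : T) : ∃ φ : PresentedGroup (𝒞.relators S orient corner) ≃*
        FundamentalGroup M (𝒞.dualVertex t₀),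
      ∀ (e : {e : 𝒞.DualEdge // e ∉ S}) (p : 𝒞.Walk t₀ (orient e).1)
        (q : 𝒞.Walk (𝒞.glue (orient e).1 (orient e).2) t₀),
        (∀ a ∈ p.edges, a ∈ S) → (∀ a ∈ q.edges, a ∈ S) →
        φ (PresentedGroup.of e) = FundamentalGroup.fromPath (Path.Homotopic.Quotient.mk
          ((𝒞.walkPath p).trans
            ((𝒞.edgePath (orient e).1 (orient e).2).trans (𝒞.walkPath q)))) := by
  choose tree htree using hS.connected t₀
  let τ : ∀ t, Homotopic.Quotient (𝒞.dualVertex t₀) (𝒞.dualVertex t) :=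
    fun t => .mk (𝒞.walkPath (tree t))
  have hclosed : ∀ {t : T} (w : 𝒞.Walk t t), (∀ e ∈ w.edges, e ∈ S) →
      w.hol (𝒞.edgeLoop τ) = 1 := fun w hw =>
    hS.hol_closed_eq_one _ (𝒞.edgeLoop_opp τ) w hw
  have htreehol : ∀ t, (tree t).hol (𝒞.edgeLoop τ) = τ t₀ := fun t => by
    rw [hol_edgeLoop]
    change ((τ t₀).trans (τ t)).trans _ = _
    rw [Homotopic.Quotient.trans_assoc, Homotopic.Quotient.trans_symm,
      Homotopic.Quotient.trans_refl]
  -- `tree t₀` need not be the empty walk, but as a closed walk in the tree it has trivial holonomy.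
  have hτ : τ t₀ = .refl _ := (htreehol t₀).symm.trans (hclosed _ (htree t₀))
  have htree1 : ∀ t, (tree t).hol (𝒞.edgeLoop τ) = 1 := fun t => (htreehol t).trans hτ
  -- Compare two closed walks in the tree that differ, up to tree walks of trivial holonomy, only by
  -- the crossing of `a`.
  have hedge : ∀ a, 𝒞.dualEdge a ∈ S → 𝒞.edgeLoop τ a = 1 := by
    intro a ha
    obtain ⟨q, hq⟩ := hS.connected (𝒞.glue a.1 a.2) t₀
    have h1 := hclosed ((tree _).append q) (fun e he => by
      rw [FacePairing.Walk.edges_append, List.mem_append] at he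
      exact he.elim (htree _ e) (hq e))
    have h2 := hclosed ((tree a.1).append (.cons a.2 q)) (fun e he => by
      rw [FacePairing.Walk.edges_append, List.mem_append, FacePairing.Walk.edges_cons,
        List.mem_cons] at he
      rcases he with he | rfl | he
      exacts [htree _ e he, ha, hq e he])
    rw [FacePairing.Walk.hol_append, htree1, mul_one] at h1
    rwa [FacePairing.Walk.hol_append, htree1, mul_one, FacePairing.Walk.hol_cons, h1, one_mul] at h2
  have hloop : ∀ w : 𝒞.Walk t₀ t₀, w.hol (𝒞.edgeLoop τ) = Homotopic.Quotient.mk (𝒞.walkPath w) := by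
    intro w
    rw [hol_edgeLoop, hτ, Homotopic.Quotient.refl_trans]
    exact Homotopic.Quotient.trans_refl _
  have hlift : ∀ {s t : T} (w : 𝒞.Walk s t), FreeGroup.lift (fun e : {e : 𝒞.DualEdge // e ∉ S} =>
      𝒞.edgeLoop τ (orient e)) (𝒞.word S orient w) = w.hol (𝒞.edgeLoop τ) := fun w =>
    FacePairing.lift_word horient _ (𝒞.edgeLoop_opp τ) hedge w
  have hrel : ∀ r ∈ 𝒞.relators S orient corner, FreeGroup.lift
      (fun e : {e : 𝒞.DualEdge // e ∉ S} => 𝒞.edgeLoop τ (orient e)) r = 1 := by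
    rintro _ ⟨c, rfl⟩
    rw [hlift]
    exact 𝒞.hol_edgeLoop_rotationWalk τ Function.iterate_minimalPeriod
  let φ := PresentedGroup.toGroup hrel
  have hφ : ∀ {s t : T} (w : 𝒞.Walk s t), φ (PresentedGroup.mk _ (𝒞.word S orient w)) =
      w.hol (𝒞.edgeLoop τ) := hlift
  -- The sheets of the cover are indexed by the presented group itself.
  let F : T × Fin 4 → PresentedGroup (𝒞.relators S orient corner) := fun a =>
    PresentedGroup.mk _ (𝒞.letter S orient a)
  have hF : ∀ a, F (𝒞.opp a) = (F a)⁻¹ := fun a => by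
    simp only [F, FacePairing.letter_opp horient, map_inv]
  have hFword : ∀ {s t : T} (w : 𝒞.Walk s t),
      PresentedGroup.mk _ (𝒞.word S orient w) = w.hol F := fun w => by
    rw [FacePairing.word_eq_hol, FacePairing.Walk.map_hol]
  have hcl : ∀ d, 𝒞.Closes hF d := 𝒞.closes_of_forall_dualFace hF hcorner fun c => by
    rw [← hFword]
    exact PresentedGroup.mk_eq_one_iff.2 (Subgroup.subset_normalClosure ⟨c, rfl⟩)
  have hinj : Function.Injective φ := by
    rw [injective_iff_map_eq_one]
    intro x hx
    obtain ⟨y, rfl⟩ := PresentedGroup.mk_surjective _ x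
    obtain ⟨w, rfl⟩ := FacePairing.exists_word_eq hS horient t₀ y
    rw [hφ, hloop] at hx
    rw [hFword]
    -- The comparison is with the empty walk, whose path is constant.
    exact 𝒞.hol_eq_of_mk_walkPath_eq hF hcl (w' := .nil t₀) hx
  have hsurj : Function.Surjective φ := by
    intro q
    obtain ⟨g, hg, h⟩ := 𝒞.isCarried τ (m := 𝒞.dualVertex t₀) (m' := 𝒞.dualVertex t₀) q t₀ center
      (𝒞.point_center t₀) t₀ center (𝒞.point_center t₀)
    have happ : 𝒞.approach τ t₀ center (𝒞.point_center t₀) = .refl _ := by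
      rw [approach, hτ, seg_self]
      exact Homotopic.Quotient.refl_trans _
    rw [happ] at h
    have hgq : g = q :=
      ((Homotopic.Quotient.refl_trans q).symm.trans (h.trans (Homotopic.Quotient.trans_refl _))).symm
    have hle : 𝒞.edgeSubgroup τ ≤ φ.range := by
      rw [edgeSubgroup, Subgroup.closure_le]
      rintro _ ⟨a, rfl⟩
      exact ⟨PresentedGroup.mk _ (𝒞.letter S orient a),
        FacePairing.lift_letter horient _ (𝒞.edgeLoop_opp τ) hedge a⟩
    rw [← hgq]
    exact hle hg
  refine ⟨MulEquiv.ofBijective φ ⟨hinj, hsurj⟩, fun e p q hp hq => ?_⟩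
  have hp1 := FacePairing.Walk.hol_eq_one _ hedge p hp
  have hq1 := FacePairing.Walk.hol_eq_one _ hedge q hq
  have hp2 : Homotopic.Quotient.mk (𝒞.walkPath p) = τ (orient e).1 := by
    have h2 := congrArg (Homotopic.Quotient.trans · (τ (orient e).1)) ((𝒞.hol_edgeLoop τ p).symm.trans hp1)
    simp only [Homotopic.Quotient.trans_assoc, Homotopic.Quotient.symm_trans, hτ] at h2
    rw [Homotopic.Quotient.trans_refl, Homotopic.Quotient.refl_trans] at h2
    exact h2.trans (Homotopic.Quotient.refl_trans _)
  have hq2 : Homotopic.Quotient.mk (𝒞.walkPath q) =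
      (τ (𝒞.glue (orient e).1 (orient e).2)).symm := by
    have h2 := congrArg (Homotopic.Quotient.trans (τ (𝒞.glue (orient e).1 (orient e).2)).symm)
      ((𝒞.hol_edgeLoop τ q).symm.trans hq1)
    rw [hτ] at h2
    have h3 : (Homotopic.Quotient.refl (𝒞.dualVertex t₀)).symm = .refl _ := rfl
    rw [h3, Homotopic.Quotient.trans_refl, ← Homotopic.Quotient.trans_assoc,
      Homotopic.Quotient.symm_trans, Homotopic.Quotient.refl_trans] at h2
    exact h2.trans (Homotopic.Quotient.trans_refl _)
  have h3 : φ (PresentedGroup.of e) = 𝒞.edgeLoop τ (orient e) := PresentedGroup.toGroup.of hrel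
  change φ (PresentedGroup.of e) = _
  rw [h3, Homotopic.Quotient.mk_trans, Homotopic.Quotient.mk_trans, hp2, hq2,
    ← Homotopic.Quotient.trans_assoc]
  rfl

end IdealCellulation

/-! ### CW structures from finite partitions into cells -/

/-- From a compact set onto its image in a Hausdorff space, `g` is closed and hence a quotient map.
With `g` the coordinates on a disc and `h` the points of `M`, the factor is a characteristic map. -/
theorem IsCompact.exists_continuousOn_factor {X Y Z : Type*} [TopologicalSpace X]
    [TopologicalSpace Y] [T2Space Y] [TopologicalSpace Z] [Nonempty Z] {K : Set X}
    (hK : IsCompact K) {g : X → Y} (hg : Continuous g) {h : X → Z} (hh : Continuous h)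
    (hgh : ∀ x y, g x = g y → h x = h y) :
    ∃ f : Y → Z, ContinuousOn f (g '' K) ∧ ∀ x, f (g x) = h x := by
  have hf : ∀ x, Function.extend g h (fun _ => Classical.arbitrary Z) (g x) = h x := fun x =>
    Function.FactorsThrough.extend_apply (fun a b hab => hgh a b hab) _ x
  refine ⟨_, ?_, hf⟩
  have := isCompact_iff_compactSpace.1 hK
  let q : K → g '' K := fun x => ⟨g x.1, x.1, x.2, rfl⟩
  have hqc : Continuous q := (hg.comp continuous_subtype_val).subtype_mk _
  have hq : IsQuotientMap q := hqc.isClosedMap.isQuotientMap hqc (by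
    rintro ⟨_, x, hx, rfl⟩
    exact ⟨⟨x, hx⟩, rfl⟩)
  rw [continuousOn_iff_continuous_domRestrict, hq.continuous_iff]
  exact (hh.comp continuous_subtype_val).congr fun x => (hf x.1).symm

namespace Topology.CWComplex

open Metric

/-- Closed subsets of the closed ball have compact, hence closed, images; the sphere adds nothing to
their trace on the open cell, as it is mapped off it. -/
theorem continuousOn_invFunOn {X : Type*} [TopologicalSpace X] [T2Space X] {n : ℕ}
    {f : (Fin n → ℝ) → X} (hf : ContinuousOn f (closedBall 0 1)) (hinj : Set.InjOn f (ball 0 1))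
    (hd : Disjoint (f '' ball 0 1) (f '' sphere 0 1)) :
    ContinuousOn (Function.invFunOn f (ball 0 1)) (f '' ball 0 1) := by
  rw [continuousOn_iff_isClosed]
  intro t ht
  refine ⟨f '' (t ∩ closedBall 0 1), ?_, ?_⟩
  · exact (((isCompact_closedBall (0 : Fin n → ℝ) 1).inter_left ht).image_of_continuousOn
      (hf.mono Set.inter_subset_right)).isClosed
  · ext y
    constructor
    · rintro ⟨h1, x, hx, rfl⟩
      rw [Set.mem_preimage, hinj.leftInvOn_invFunOn hx] at h1
      exact ⟨⟨x, ⟨h1, ball_subset_closedBall hx⟩, rfl⟩, x, hx, rfl⟩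
    · rintro ⟨⟨x, ⟨hxt, hx⟩, rfl⟩, hy⟩
      rw [← ball_union_sphere] at hx
      have hx' : x ∈ ball 0 1 := hx.resolve_right fun h =>
        Set.disjoint_left.1 hd hy ⟨x, h, rfl⟩
      refine ⟨?_, hy⟩
      rw [Set.mem_preimage, hinj.leftInvOn_invFunOn hx']
      exact hxt

/-- A finite partition of a set into open cells with characteristic maps is a CW structure. -/
theorem exists_of_finite_partition {X : Type*} [TopologicalSpace X] [T2Space X] {ι : ℕ → Type*}
    [∀ n, _root_.Finite (ι n)] {N : ℕ} (hN : ∀ n, N < n → IsEmpty (ι n)) (U : ∀ n, ι n → Set X)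
    (hU : ∀ (a b : Σ n, ι n) (x : X), x ∈ U a.1 a.2 → x ∈ U b.1 b.2 → a = b)
    (hchar : ∀ n i, ∃ f : (Fin n → ℝ) → X, ContinuousOn f (closedBall 0 1) ∧
      Set.InjOn f (ball 0 1) ∧ f '' ball 0 1 = U n i ∧
      Set.MapsTo f (sphere 0 1) (⋃ (m < n) (j : ι m), U m j))
    {C : Set X} (hC : ⋃ (n) (i : ι n), U n i = C) :
    ∃ _ : CWComplex C, ∃ e : ∀ n, cell C n ≃ ι n, ∀ n c, openCell (C := C) n c = U n (e n c) := by
  choose f hf hinj hball hsphere using hchar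
  have hd : ∀ n i, Disjoint (f n i '' ball 0 1) (f n i '' sphere 0 1) := by
    intro n i
    rw [Set.disjoint_left]
    rintro x hx ⟨p, hp, rfl⟩
    obtain ⟨m, hm, j, hj⟩ := by simpa using hsphere n i hp
    rw [hball] at hx
    exact hm.ne (congrArg Sigma.fst (hU ⟨m, j⟩ ⟨n, i⟩ _ hj hx))
  -- The cells must live in the universe of `X`, so the finite index types are replaced by lifted
  -- `Fin` types.
  let e : ∀ n, ULift (Fin (Nat.card (ι n))) ≃ ι n := fun n =>
    Equiv.ulift.trans (Finite.equivFin (ι n)).symm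
  let char : ∀ n, ι n → PartialEquiv (Fin n → ℝ) X := fun n i =>
    (Set.InjOn.bijOn_image (hinj n i)).toPartialEquiv
  have hchar : ∀ n i, (char n i : (Fin n → ℝ) → X) = f n i := fun n i => rfl
  have hclosed : ∀ n i, f n i '' closedBall 0 1 ⊆ ⋃ (n) (i : ι n), U n i := by
    intro n i
    rw [← ball_union_sphere, Set.image_union, Set.union_subset_iff]
    constructor
    · rw [hball]
      exact fun x hx => Set.mem_iUnion₂.2 ⟨n, i, hx⟩
    · rintro _ ⟨p, hp, rfl⟩
      obtain ⟨m, hm, j, hj⟩ := by simpa using hsphere n i hp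
      exact Set.mem_iUnion₂.2 ⟨m, j, hj⟩
  have hsub : ∀ n i, U n i ⊆ f n i '' closedBall 0 1 := fun n i => by
    rw [← hball]
    exact Set.image_mono ball_subset_closedBall
  refine ⟨mkFinite C (fun n => ULift (Fin (Nat.card (ι n)))) (fun n c => char n (e n c))
    ?_ (fun n => inferInstance) (fun n c => rfl) (fun n c => hf n _)
    (fun n c => continuousOn_invFunOn (hf n _) (hinj n _) (hd n _)) ?_ ?_ ?_, e, fun n c => hball n _⟩
  · filter_upwards [Filter.eventually_gt_atTop N] with n hn
    exact (e n).isEmpty_congr.2 (hN n hn)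
  · rintro ⟨n, c⟩ - ⟨n', c'⟩ - hne
    rw [Function.onFun, Set.disjoint_left]
    intro x hx hx'
    change x ∈ f n (e n c) '' ball 0 1 at hx
    change x ∈ f n' (e n' c') '' ball 0 1 at hx'
    rw [hball] at hx hx'
    have h := hU ⟨n, e n c⟩ ⟨n', e n' c'⟩ x hx hx'
    apply hne
    have hinj : Function.Injective (Sigma.map id fun n => e n) :=
      Function.Injective.sigma_map Function.injective_id fun n => (e n).injective
    exact hinj h
  · intro n c p hp
    obtain ⟨m, hm, j, hj⟩ := by simpa using hsphere n (e n c) hp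
    refine Set.mem_iUnion₂.2 ⟨m, hm, Set.mem_iUnion.2 ⟨(e m).symm j, ?_⟩⟩
    change _ ∈ f m (e m ((e m).symm j)) '' closedBall 0 1
    rw [Equiv.apply_symm_apply]
    exact hsub m j hj
  · rw [← hC]
    apply Set.Subset.antisymm
    · exact Set.iUnion₂_subset fun n c => hclosed n (e n c)
    · refine Set.iUnion₂_subset fun n i => ?_
      refine (hsub n i).trans fun x hx => Set.mem_iUnion₂.2 ⟨n, (e n).symm i, ?_⟩
      change _ ∈ f n (e n ((e n).symm i)) '' closedBall 0 1
      rwa [Equiv.apply_symm_apply]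

end Topology.CWComplex

/-! ### The partition of the dual 2-skeleton into open cells -/

namespace idealTetrahedron

/-- The vertices at which a barycentric coordinate is not the largest one. -/
def low (x : idealTetrahedron) : Finset (Fin 4) :=
  open Classical in Finset.univ.filter fun v => ∃ w, x.1 v < x.1 w

theorem mem_low {x : idealTetrahedron} {v : Fin 4} : v ∈ low x ↔ ∃ w, x.1 v < x.1 w := by
  simp [low]

theorem low_permute (σ : Equiv.Perm (Fin 4)) (x : idealTetrahedron) :
    low (permute σ x) = (low x).map σ.toEmbedding := by
  ext v
  rw [Finset.mem_map_equiv, mem_low, mem_low]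
  exact ⟨fun ⟨w, h⟩ => ⟨σ.symm w, h⟩, fun ⟨w, h⟩ => ⟨σ w, by simpa using h⟩⟩

theorem low_eq_iff {x : idealTetrahedron} {A : Finset (Fin 4)} {v : Fin 4} (hv : v ∉ A) :
    low x = A ↔ (∀ i j, i ∉ A → j ∉ A → x.1 i = x.1 j) ∧
      ∀ i j, i ∈ A → j ∉ A → x.1 i < x.1 j := by
  constructor
  · rintro rfl
    have h : ∀ i j, j ∉ low x → x.1 i ≤ x.1 j := fun i j hj =>
      not_lt.1 fun h => hj (mem_low.2 ⟨i, h⟩)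
    refine ⟨fun i j hi hj => le_antisymm (h _ _ hj) (h _ _ hi), fun i j hi hj => ?_⟩
    obtain ⟨w, hw⟩ := mem_low.1 hi
    exact hw.trans_le (h _ _ hj)
  · rintro ⟨h1, h2⟩
    ext i
    rw [mem_low]
    constructor
    · rintro ⟨w, hw⟩
      by_contra hi
      by_cases hw' : w ∈ A
      · exact (h2 w i hw' hi).not_gt hw
      · exact hw.ne (h1 i w hi hw')
    · exact fun hi => ⟨v, h2 i v hi hv⟩

/-- A point is glued only across faces that belong to `low x`; this lets the dual cell be followed
through the gluings. -/
theorem mem_low_of_eq_zero {x : idealTetrahedron} {v : Fin 4} (hv : x.1 v = 0) : v ∈ low x := by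
  rw [mem_low]
  by_contra! h
  have h1 := sum_eq_one x
  linarith [h 0, h 1, h 2, h 3]

theorem eq_center_iff {x : idealTetrahedron} : x = center ↔ low x = ∅ := by
  rw [low_eq_iff (Finset.notMem_empty 0)]
  constructor
  · rintro rfl
    exact ⟨fun _ _ _ _ => rfl, fun _ _ h => absurd h (Finset.notMem_empty _)⟩
  · rintro ⟨h, -⟩
    have h1 := sum_eq_one x
    apply Subtype.ext
    funext i
    have h' : ∀ j, x.1 j = x.1 i := fun j => h j i (Finset.notMem_empty _) (Finset.notMem_empty _)
    change x.1 i = 1 / 4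
    linarith [h' 0, h' 1, h' 2, h' 3]

theorem low_eq_singleton_iff {x : idealTetrahedron} {f : Fin 4} : low x = {f} ↔
    (∀ i j, i ≠ f → j ≠ f → x.1 i = x.1 j) ∧ ∀ i, i ≠ f → x.1 f < x.1 i := by
  obtain ⟨v, hv⟩ := exists_ne f
  rw [low_eq_iff (v := v) (by simpa using hv)]
  simp only [Finset.mem_singleton]
  exact and_congr_right fun _ => ⟨fun h i hi => h f i rfl hi, fun h i j hi hj => hi ▸ h j hj⟩

theorem low_eq_pair_iff {x : idealTetrahedron} {k l : Fin 4} : low x = {k, l} ↔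
    (∀ i j, i ≠ k → i ≠ l → j ≠ k → j ≠ l → x.1 i = x.1 j) ∧
      ∀ i, i ≠ k → i ≠ l → x.1 k < x.1 i ∧ x.1 l < x.1 i := by
  obtain ⟨v, hv⟩ : ∃ v, v ∉ ({k, l} : Finset (Fin 4)) := by
    by_contra! h
    have h1 := Finset.card_le_card (fun v _ => h v : Finset.univ ⊆ ({k, l} : Finset (Fin 4)))
    have h2 : ({k, l} : Finset (Fin 4)).card ≤ 2 := Finset.card_le_two
    rw [Finset.card_fin] at h1
    omega
  rw [low_eq_iff hv]
  simp only [Finset.mem_insert, Finset.mem_singleton, not_or, and_imp]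
  constructor
  · rintro ⟨h1, h2⟩
    exact ⟨fun i j a b c d => h1 i j a b c d,
      fun i a b => ⟨h2 k i (.inl rfl) a b, h2 l i (.inr rfl) a b⟩⟩
  · rintro ⟨h1, h2⟩
    refine ⟨fun i j a b c d => h1 i j a b c d, ?_⟩
    rintro i j (rfl | rfl) a b
    exacts [(h2 j a b).1, (h2 j a b).2]

/-- The complement of `low x` is the set of vertices with maximal coordinate. -/
theorem card_low_le_two_iff {x : idealTetrahedron} : (low x).card ≤ 2 ↔
    ∃ i j, i ≠ j ∧ x.1 i = x.1 j ∧ ∀ k, x.1 k ≤ x.1 i := by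
  have hc : (low x)ᶜ.card = 4 - (low x).card := by rw [Finset.card_compl, Fintype.card_fin]
  have hlow : ∀ i, i ∉ low x ↔ ∀ k, x.1 k ≤ x.1 i := fun i => by simp [mem_low]
  have h1 : (low x).card ≤ 2 ↔ 1 < (low x)ᶜ.card := by
    rw [hc]
    have := Finset.card_le_univ (low x)
    rw [Fintype.card_fin] at this
    omega
  rw [h1, Finset.one_lt_card]
  simp only [Finset.mem_compl, hlow]
  constructor
  · rintro ⟨i, hi, j, hj, hij⟩
    exact ⟨i, j, hij, le_antisymm (hj i) (hi j), hi⟩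
  · rintro ⟨i, j, hij, h, hi⟩
    exact ⟨i, hi, j, fun k => (hi k).trans h.le, hij⟩

end idealTetrahedron

namespace FacePairing

instance {T : Type*} [Finite T] : Finite (Corner T) :=
  Finite.of_injective (fun c : Corner T => (c.tet, c.enter, c.exit)) fun c d h => by
    simp only [Prod.mk.injEq] at h
    exact Corner.ext h.1 h.2.1 h.2.2

/-- The indices of the cells of the dual 2-skeleton. -/
def DualCell {T : Type*} (P : FacePairing T) : ℕ → Type _
  | 0 => T
  | 1 => P.DualEdge
  | 2 => P.DualFace
  | _ => PEmpty

instance {T : Type*} [Finite T] (P : FacePairing T) (n : ℕ) : Finite (P.DualCell n) := by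
  match n with
  | 0 => exact inferInstanceAs (Finite T)
  | 1 => exact Finite.of_surjective P.dualEdge Quot.mk_surjective
  | 2 => exact Finite.of_surjective P.dualFace Quot.mk_surjective
  | n + 3 => exact inferInstanceAs (Finite PEmpty)

theorem isEmpty_dualCell {T : Type*} (P : FacePairing T) {n : ℕ} (h : 2 < n) :
    IsEmpty (P.DualCell n) := by
  match n, h with
  | n + 3, _ => exact inferInstanceAs (IsEmpty PEmpty)

end FacePairing

namespace IdealCellulation

open idealTetrahedron

variable {M : Type*} [TopologicalSpace M] {T : Type*} (𝒞 : IdealCellulation M T)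

/-- The open cells of the dual 2-skeleton. -/
def openDualCell : ∀ n, 𝒞.DualCell n → Set M
  | 0, t => {𝒞.dualVertex t}
  | 1, e => 𝒞.openDualEdge e
  | 2, c => 𝒞.openDualFace c
  | _ + 3, i => i.elim

/-- The cell `i` is dual to the face of the tetrahedron `t` on which the coordinates in `A`
vanish. -/
def IsDual (t : T) (A : Finset (Fin 4)) : ∀ n, 𝒞.DualCell n → Prop
  | 0, s => A = ∅ ∧ t = s
  | 1, e => ∃ f, A = {f} ∧ 𝒞.dualEdge (t, f) = e
  | 2, c => ∃ k l, ∃ h : k ≠ l, A = {k, l} ∧ 𝒞.dualFace ⟨t, k, l, h⟩ = c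
  | _ + 3, _ => False

theorem mem_openDualCell {m : M} : ∀ {n : ℕ} {i : 𝒞.DualCell n}, m ∈ 𝒞.openDualCell n i ↔
    ∃ t x, 𝒞.point t x = m ∧ 𝒞.IsDual t (low x) n i
  | 0, s => by
    constructor
    · rintro rfl
      exact ⟨s, center, 𝒞.point_center s, eq_center_iff.1 rfl, rfl⟩
    · rintro ⟨t, x, rfl, h, rfl⟩
      rw [eq_center_iff.2 h]
      exact 𝒞.point_center t
  | 1, e => by
    refine exists_congr fun t => exists_congr fun x => and_congr_right fun _ => ?_
    refine exists_congr fun f => ?_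
    rw [low_eq_singleton_iff]
    exact and_comm
  | 2, c => by
    refine exists_congr fun t => exists_congr fun x => and_congr_right fun _ => ?_
    refine exists_congr fun k => exists_congr fun l => exists_congr fun h => ?_
    rw [low_eq_pair_iff]
    exact and_comm
  | n + 3, i => i.elim

theorem IsDual.card_eq {t : T} {A : Finset (Fin 4)} : ∀ {n : ℕ} {i : 𝒞.DualCell n},
    𝒞.IsDual t A n i → A.card = n
  | 0, _, h => by rw [h.1]; rfl
  | 1, _, ⟨f, h, _⟩ => by rw [h]; rfl
  | 2, _, ⟨k, l, hkl, h, _⟩ => by rw [h, Finset.card_pair hkl]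
  | _ + 3, i, _ => i.elim

theorem IsDual.unique {t : T} {A : Finset (Fin 4)} : ∀ {n : ℕ} {i j : 𝒞.DualCell n},
    𝒞.IsDual t A n i → 𝒞.IsDual t A n j → i = j
  | 0, _, _, hi, hj => hi.2.symm.trans hj.2
  | 1, _, _, ⟨f, hf, hi⟩, ⟨g, hg, hj⟩ => by
    obtain rfl := Finset.singleton_inj.1 (hf.symm.trans hg)
    exact hi.symm.trans hj
  | 2, _, _, ⟨k, l, hkl, h, hi⟩, ⟨k', l', hkl', h', hj⟩ => by
    have h4 : ({k, l} : Set (Fin 4)) = {k', l'} := by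
      simpa using congrArg (fun B : Finset (Fin 4) => (B : Set (Fin 4))) (h.symm.trans h')
    rcases Set.pair_eq_pair_iff.1 h4 with ⟨rfl, rfl⟩ | ⟨rfl, rfl⟩
    · exact hi.symm.trans hj
    · exact hi.symm.trans ((𝒞.dualFace_swap ⟨t, l, k, hkl'⟩).trans hj)
  | _ + 3, i, _, _, _ => i.elim

theorem IsDual.glue {t : T} {A : Finset (Fin 4)} {f : Fin 4} (hf : f ∈ A) :
    ∀ {n : ℕ} {i : 𝒞.DualCell n}, 𝒞.IsDual t A n i →
      𝒞.IsDual (𝒞.glue t f) (A.map (𝒞.perm t f).toEmbedding) n i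
  | 0, _, h => by simp [h.1] at hf
  | 1, _, ⟨g, h, hi⟩ => by
    rw [h, Finset.mem_singleton] at hf
    subst hf
    exact ⟨𝒞.perm t f f, by simp [h], (𝒞.dualEdge_opp (t, f)).trans hi⟩
  | 2, _, ⟨k, l, hkl, h, hi⟩ => by
    rw [h, Finset.mem_insert, Finset.mem_singleton] at hf
    rcases hf with rfl | rfl
    · refine ⟨𝒞.perm t f f, 𝒞.perm t f l, (𝒞.perm t f).injective.ne hkl, by simp [h], ?_⟩
      rw [← hi, ← 𝒞.dualFace_swap ⟨t, f, l, hkl⟩]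
      exact 𝒞.dualFace_step ⟨t, l, f, hkl.symm⟩
    · refine ⟨𝒞.perm t f f, 𝒞.perm t f k, (𝒞.perm t f).injective.ne hkl.symm,
        by simp [h, Finset.pair_comm], ?_⟩
      rw [← hi]
      exact 𝒞.dualFace_step ⟨t, k, f, hkl⟩
  | _ + 3, i, _ => i.elim

theorem point_mem_openDualCell {t : T} {x : idealTetrahedron} {n : ℕ} {i : 𝒞.DualCell n} :
    𝒞.point t x ∈ 𝒞.openDualCell n i ↔ 𝒞.IsDual t (low x) n i := by
  rw [mem_openDualCell]
  constructor
  · rintro ⟨t', x', h, hi⟩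
    refine 𝒞.rel_of_point_eq (Q := fun t x => 𝒞.IsDual t (low x) n i) ?_ h hi
    intro t f x hx h
    rw [low_permute]
    exact h.glue 𝒞 (mem_low_of_eq_zero hx)
  · exact fun h => ⟨t, x, rfl, h⟩

theorem openDualCell_unique (a b : Σ n, 𝒞.DualCell n) (m : M) (ha : m ∈ 𝒞.openDualCell a.1 a.2)
    (hb : m ∈ 𝒞.openDualCell b.1 b.2) : a = b := by
  obtain ⟨t, x, rfl⟩ := 𝒞.exists_point m
  obtain ⟨n, i⟩ := a
  obtain ⟨n', j⟩ := b
  rw [point_mem_openDualCell] at ha hb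
  obtain rfl : n = n' := (ha.card_eq 𝒞).symm.trans (hb.card_eq 𝒞)
  exact congrArg (Sigma.mk n) (ha.unique 𝒞 hb)

theorem iUnion_openDualCell : ⋃ (n) (i : 𝒞.DualCell n), 𝒞.openDualCell n i = 𝒞.dualSkeleton := by
  ext m
  rw [Set.mem_iUnion₂]
  constructor
  · rintro ⟨n, i, h⟩
    obtain ⟨t, x, rfl, hi⟩ := 𝒞.mem_openDualCell.1 h
    have hn : n ≤ 2 := by
      by_contra! hn
      exact (𝒞.isEmpty_dualCell hn).false i
    exact ⟨t, x, rfl, card_low_le_two_iff.1 ((hi.card_eq 𝒞).trans_le hn)⟩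
  · rintro ⟨t, x, rfl, h⟩
    have h2 := card_low_le_two_iff.2 h
    have hcard : (low x).card = 0 ∨ (low x).card = 1 ∨ (low x).card = 2 := by omega
    simp only [point_mem_openDualCell]
    rcases hcard with h | h | h
    · exact ⟨0, t, Finset.card_eq_zero.1 h, rfl⟩
    · obtain ⟨f, hf⟩ := Finset.card_eq_one.1 h
      exact ⟨1, 𝒞.dualEdge (t, f), f, hf, rfl⟩
    · obtain ⟨k, l, hkl, hA⟩ := Finset.card_eq_two.1 h
      exact ⟨2, 𝒞.dualFace ⟨t, k, l, hkl⟩, k, l, hkl, hA, rfl⟩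

end IdealCellulation

/-! ### Characteristic maps of the 0-cells and 1-cells -/

namespace idealTetrahedron

/-- The point at parameter `s` on the segment from the barycenter of a face to the barycenter of
the tetrahedron. -/
def spoke (f : Fin 4) (s : unitInterval) : idealTetrahedron := line s (faceCenter f) center

theorem spoke_self (f : Fin 4) (s : unitInterval) : (spoke f s).1 f = s / 4 := by
  rw [spoke, line_apply]
  simp only [faceCenter, center, if_true]
  ring

theorem spoke_of_ne {f i : Fin 4} (h : i ≠ f) (s : unitInterval) :
    (spoke f s).1 i = (1 - s) / 3 + s / 4 := by
  rw [spoke, line_apply]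
  simp only [faceCenter, center, if_neg h]
  ring

theorem low_spoke (f : Fin 4) {s : unitInterval} (hs : s < 1) : low (spoke f s) = {f} := by
  have hs' : (s : ℝ) < 1 := hs
  rw [low_eq_singleton_iff]
  refine ⟨fun i j hi hj => by rw [spoke_of_ne hi, spoke_of_ne hj], fun i hi => ?_⟩
  rw [spoke_of_ne hi, spoke_self]
  linarith

theorem exists_spoke_eq {f : Fin 4} {x : idealTetrahedron} (h : low x = {f}) :
    ∃ s < 1, spoke f s = x := by
  rw [low_eq_singleton_iff] at h
  obtain ⟨v, hv⟩ := exists_ne f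
  have hsum := sum_eq_one x
  have key : ∀ i, i ≠ f → x.1 i = (1 - x.1 f) / 3 := by
    intro i hi
    have h1 : ∑ j, x.1 j = x.1 f + 3 * x.1 i := by
      rw [← Finset.add_sum_erase _ _ (Finset.mem_univ f),
        Finset.sum_congr rfl fun j hj => h.1 j i (Finset.ne_of_mem_erase hj) hi, Finset.sum_const,
        Finset.card_erase_of_mem (Finset.mem_univ f), Finset.card_fin, nsmul_eq_mul]
      norm_num
    rw [Fin.sum_univ_four, hsum] at h1
    linarith
  have h1 := h.2 v hv
  have h2 := key v hv
  have h0 := nonneg x f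
  refine ⟨⟨4 * x.1 f, by linarith, by linarith⟩, ?_, ?_⟩
  · change 4 * x.1 f < 1
    linarith
  · apply Subtype.ext
    funext i
    by_cases hi : i = f
    · subst hi
      rw [spoke_self]
      ring
    · rw [spoke_of_ne hi, key i hi]
      ring

theorem permute_spoke (σ : Equiv.Perm (Fin 4)) (f : Fin 4) (s : unitInterval) :
    permute σ (spoke f s) = spoke (σ f) s := by
  rw [spoke, permute_line, permute_faceCenter]
  rfl

theorem continuous_spoke (f : Fin 4) : Continuous (spoke f) :=
  continuous_line continuous_id continuous_const continuous_const

end idealTetrahedron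

namespace IdealCellulation

open idealTetrahedron Metric

variable {M : Type*} [TopologicalSpace M] {T : Type*} (𝒞 : IdealCellulation M T)

theorem exists_vertex_char (t : T) : ∃ f : (Fin 0 → ℝ) → M, ContinuousOn f (closedBall 0 1) ∧
    Set.InjOn f (ball 0 1) ∧ f '' ball 0 1 = 𝒞.openDualCell 0 t ∧
    Set.MapsTo f (sphere 0 1) (⋃ (m < 0) (j : 𝒞.DualCell m), 𝒞.openDualCell m j) := by
  refine ⟨fun _ => 𝒞.dualVertex t, continuousOn_const, Set.subsingleton_of_subsingleton.injOn _,
    ?_, ?_⟩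
  · exact Set.Nonempty.image_const ⟨0, by simp⟩ _
  · intro p hp
    rw [mem_sphere, Subsingleton.elim p 0, dist_self] at hp
    exact absurd hp zero_ne_one

/-- The two sides of a face. -/
def side (a : T × Fin 4) (b : Bool) : T × Fin 4 := cond b a (𝒞.opp a)

theorem side_not (a : T × Fin 4) (b : Bool) : 𝒞.side a (!b) = 𝒞.opp (𝒞.side a b) := by
  cases b
  · exact (𝒞.opp_opp a).symm
  · rfl

/-- The two spokes are laid out on `[-1, 1]`, with the barycenter of the face at 0 and those of the
tetrahedra at the ends. The interior is embedded because the two sides of a face are different, even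
when they belong to one tetrahedron. -/
theorem exists_edge_char (e : 𝒞.DualEdge) : ∃ f : (Fin 1 → ℝ) → M,
    ContinuousOn f (closedBall 0 1) ∧ Set.InjOn f (ball 0 1) ∧
    f '' ball 0 1 = 𝒞.openDualCell 1 e ∧
    Set.MapsTo f (sphere 0 1) (⋃ (m < 1) (j : 𝒞.DualCell m), 𝒞.openDualCell m j) := by
  obtain ⟨a, rfl⟩ := Quot.exists_rep e
  let g : Bool × unitInterval → (Fin 1 → ℝ) := fun k _ => cond k.1 k.2 (-k.2)
  let h : Bool × unitInterval → M := fun k => 𝒞.point (𝒞.side a k.1).1 (spoke (𝒞.side a k.1).2 k.2)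
  have hg : Continuous g := by
    rw [continuous_prod_of_discrete_left]
    rintro (_ | _)
    · exact continuous_pi fun _ => continuous_subtype_val.neg
    · exact continuous_pi fun _ => continuous_subtype_val
  have hh : Continuous h := by
    rw [continuous_prod_of_discrete_left]
    exact fun b => (𝒞.continuous_point (𝒞.side a b).1).comp (continuous_spoke (𝒞.side a b).2)
  have hgeq : ∀ k k', g k = g k' ↔ k.2 = k'.2 ∧ (k.2 = 0 ∨ k.1 = k'.1) := by
    rintro ⟨b, s⟩ ⟨b', s'⟩
    have h1 : g (b, s) = g (b', s') ↔ cond b (s : ℝ) (-s) = cond b' (s' : ℝ) (-s') :=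
      ⟨fun h => congrFun h 0, fun h => funext fun _ => h⟩
    have h2 := s.2.1
    have h3 := s'.2.1
    simp only [h1, Subtype.ext_iff, Set.Icc.coe_zero]
    cases b <;> cases b' <;> simp <;> constructor
    · exact fun h => ⟨by linarith, Subtype.ext (by change (s : ℝ) = 0; linarith)⟩
    · rintro ⟨h, h'⟩
      have h0 : (s : ℝ) = 0 := congrArg Subtype.val h'
      linarith
    · exact fun h => ⟨by linarith, Subtype.ext (by change (s : ℝ) = 0; linarith)⟩
    · rintro ⟨h, h'⟩
      have h0 : (s : ℝ) = 0 := congrArg Subtype.val h'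
      linarith
  have hglue : ∀ b, h (b, 0) = h (!b, 0) := by
    intro b
    change _ = 𝒞.point (𝒞.side a !b).1 (spoke (𝒞.side a !b).2 0)
    rw [𝒞.side_not]
    exact (𝒞.point_eq _ (𝒞.side a b).2 _ (by rw [spoke_self]; simp)).trans
      (congrArg _ (permute_spoke _ _ _))
  have hgh : ∀ k k', g k = g k' → h k = h k' := by
    rintro ⟨b, s⟩ ⟨b', s'⟩ hk
    obtain ⟨rfl, rfl | rfl⟩ := (hgeq _ _).1 hk
    · by_cases hb : b' = b
      · rw [hb]
      · rw [Bool.eq_not.2 hb]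
        exact hglue b
    · rfl
  have : Nonempty M := ⟨h (true, 0)⟩
  obtain ⟨f, hf, hfg⟩ := isCompact_univ.exists_continuousOn_factor hg hh hgh
  have hnorm : ∀ k, ‖g k‖ = k.2 := by
    rintro ⟨b, s⟩
    rw [pi_norm_const]
    cases b
    · exact (norm_neg _).trans (Real.norm_of_nonneg s.2.1)
    · exact Real.norm_of_nonneg s.2.1
  have hsurj : ∀ p : Fin 1 → ℝ, ‖p‖ ≤ 1 → ∃ k, g k = p := by
    intro p hp
    have hp' : |p 0| ≤ 1 := (norm_le_pi_norm p 0).trans hp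
    rcases le_total 0 (p 0) with h0 | h0
    · refine ⟨(true, ⟨p 0, h0, (le_abs_self _).trans hp'⟩), funext fun i => ?_⟩
      rw [Subsingleton.elim i 0]
      rfl
    · refine ⟨(false, ⟨-p 0, neg_nonneg.2 h0, (neg_le_abs _).trans hp'⟩), funext fun i => ?_⟩
      rw [Subsingleton.elim i 0]
      exact neg_neg _
  have hedge : ∀ b, 𝒞.dualEdge (𝒞.side a b) = 𝒞.dualEdge a := by
    rintro (_ | _)
    · exact 𝒞.dualEdge_opp a
    · rfl
  refine ⟨f, hf.mono fun p hp => ?_, ?_, ?_, ?_⟩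
  · obtain ⟨k, rfl⟩ := hsurj p (mem_closedBall_zero_iff.1 hp)
    exact ⟨k, trivial, rfl⟩
  · intro p hp p' hp' hpp
    obtain ⟨⟨b, s⟩, rfl⟩ := hsurj p (mem_ball_zero_iff.1 hp).le
    obtain ⟨⟨b', s'⟩, rfl⟩ := hsurj p' (mem_ball_zero_iff.1 hp').le
    rw [mem_ball_zero_iff, hnorm] at hp hp'
    rw [hfg, hfg] at hpp
    -- The point is seen on its own spoke and, only for `s = 0`, also on the opposite one.
    have hQ := 𝒞.rel_of_point_eq (Q := fun t x => ∃ b'', (𝒞.side a b'').1 = t ∧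
      spoke (𝒞.side a b'').2 s = x ∧ (s = 0 ∨ b = b'')) ?_ hpp ⟨b, rfl, rfl, .inr rfl⟩
    · obtain ⟨b'', ht, hx, hb⟩ := hQ
      have h1 : ({(𝒞.side a b'').2} : Finset (Fin 4)) = {(𝒞.side a b').2} := by
        rw [← low_spoke _ hp, hx, low_spoke _ hp']
      rw [Finset.singleton_inj] at h1
      have h2 : 𝒞.side a b'' = 𝒞.side a b' := Prod.ext ht h1
      have h3 : b'' = b' := by
        by_contra hne
        rw [Bool.eq_not.2 hne, 𝒞.side_not] at h2
        exact 𝒞.opp_ne _ h2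
      subst h3
      refine (hgeq _ _).2 ⟨?_, hb⟩
      have h4 := congrArg (fun x : idealTetrahedron => x.1 (𝒞.side a b'').2) hx
      simp only [spoke_self] at h4
      exact Subtype.ext (by linarith)
    · rintro _ i _ hi ⟨b'', rfl, rfl, -⟩
      have h1 : i = (𝒞.side a b'').2 := by
        have := mem_low_of_eq_zero hi
        rwa [low_spoke _ hp, Finset.mem_singleton] at this
      subst h1
      rw [spoke_self] at hi
      refine ⟨!b'', ?_, ?_, .inl (Subtype.ext ?_)⟩
      · rw [𝒞.side_not]
        rfl
      · rw [permute_spoke, 𝒞.side_not]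
        rfl
      · change (s : ℝ) = 0
        linarith
  · ext m
    constructor
    · rintro ⟨p, hp, rfl⟩
      obtain ⟨⟨b, s⟩, rfl⟩ := hsurj p (mem_ball_zero_iff.1 hp).le
      rw [mem_ball_zero_iff, hnorm] at hp
      rw [hfg]
      exact 𝒞.point_mem_openDualCell.2 ⟨_, low_spoke _ hp, hedge b⟩
    · intro hm
      obtain ⟨t, x, rfl, i, hi, he⟩ := 𝒞.mem_openDualCell.1 hm
      obtain ⟨s, hs, rfl⟩ := exists_spoke_eq hi
      obtain ⟨b, hb⟩ : ∃ b, 𝒞.side a b = (t, i) := by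
        rcases 𝒞.dualEdge_eq_iff.1 he with h1 | h1
        · exact ⟨true, h1⟩
        · exact ⟨false, (congrArg 𝒞.opp h1).trans (𝒞.opp_opp _)⟩
      refine ⟨g (b, s), ?_, ?_⟩
      · rw [mem_ball_zero_iff, hnorm]
        exact hs
      · rw [hfg]
        simp only [h, hb]
  · intro p hp
    rw [mem_sphere_zero_iff_norm] at hp
    obtain ⟨⟨b, s⟩, rfl⟩ := hsurj p hp.le
    rw [hnorm] at hp
    obtain rfl : s = 1 := Subtype.ext hp
    rw [hfg]
    refine Set.mem_iUnion₂.2 ⟨0, zero_lt_one, Set.mem_iUnion.2 ⟨(𝒞.side a b).1, ?_⟩⟩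
    refine 𝒞.point_mem_openDualCell.2 ⟨?_, rfl⟩
    rw [← eq_center_iff]
    exact line_one _ _

end IdealCellulation

/-! ### Polar coordinates for the supremum norm -/

/-- The point of the unit circle at angle `θ`, measured in turns. -/
def circlePoint (θ : ℝ) : Fin 2 → ℝ := ![Real.cos (2 * Real.pi * θ), Real.sin (2 * Real.pi * θ)]

theorem continuous_circlePoint : Continuous circlePoint := by
  refine continuous_pi fun i => ?_
  fin_cases i
  · exact Real.continuous_cos.comp (continuous_const.mul continuous_id)
  · exact Real.continuous_sin.comp (continuous_const.mul continuous_id)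

theorem norm_circlePoint_pos (θ : ℝ) : 0 < ‖circlePoint θ‖ := by
  rw [norm_pos_iff]
  intro h
  have h0 : Real.cos (2 * Real.pi * θ) = 0 := congrFun h 0
  have h1 : Real.sin (2 * Real.pi * θ) = 0 := congrFun h 1
  have := Real.sin_sq_add_cos_sq (2 * Real.pi * θ)
  rw [h0, h1] at this
  norm_num at this

theorem circlePoint_add_intCast (θ : ℝ) (k : ℤ) : circlePoint (θ + k) = circlePoint θ := by
  have h : 2 * Real.pi * (θ + k) = 2 * Real.pi * θ + k * (2 * Real.pi) := by ring
  rw [circlePoint, h, Real.cos_add_int_mul_two_pi, Real.sin_add_int_mul_two_pi, circlePoint]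

theorem exists_eq_add_intCast_of_circlePoint_eq_smul {θ θ' r : ℝ} (hr : 0 < r)
    (h : circlePoint θ = r • circlePoint θ') : ∃ k : ℤ, θ = θ' + k := by
  have h0 : Real.cos (2 * Real.pi * θ) = r * Real.cos (2 * Real.pi * θ') := congrFun h 0
  have h1 : Real.sin (2 * Real.pi * θ) = r * Real.sin (2 * Real.pi * θ') := congrFun h 1
  have h2 := Real.sin_sq_add_cos_sq (2 * Real.pi * θ)
  have h3 := Real.sin_sq_add_cos_sq (2 * Real.pi * θ')
  have hr1 : r = 1 := by
    rw [h0, h1, mul_pow, mul_pow, ← mul_add, h3, mul_one] at h2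
    exact (pow_eq_one_iff_of_nonneg hr.le two_ne_zero).1 h2
  rw [hr1, one_mul] at h0 h1
  have h4 := Real.Angle.cos_sin_inj h0 h1
  rw [Real.Angle.angle_eq_iff_two_pi_dvd_sub] at h4
  obtain ⟨k, hk⟩ := h4
  refine ⟨k, ?_⟩
  have : 2 * Real.pi * (θ - θ') = 2 * Real.pi * k := by linarith
  have := mul_left_cancel₀ Real.two_pi_pos.ne' this
  linarith

/-- Polar coordinates on the plane with the supremum norm; the angle is measured in turns. -/
def polar (ρ θ : ℝ) : Fin 2 → ℝ := (ρ / ‖circlePoint θ‖) • circlePoint θ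

theorem continuous_polar {X : Type*} [TopologicalSpace X] {ρ θ : X → ℝ} (hρ : Continuous ρ)
    (hθ : Continuous θ) : Continuous fun x => polar (ρ x) (θ x) := by
  have h := continuous_circlePoint.comp hθ
  exact (hρ.div h.norm fun x => (norm_circlePoint_pos _).ne').smul h

theorem norm_polar {ρ : ℝ} (hρ : 0 ≤ ρ) (θ : ℝ) : ‖polar ρ θ‖ = ρ := by
  rw [polar, norm_smul, norm_div, norm_norm, div_mul_cancel₀ _ (norm_circlePoint_pos θ).ne',
    Real.norm_of_nonneg hρ]

theorem polar_zero (θ : ℝ) : polar 0 θ = 0 := by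
  rw [polar, zero_div, zero_smul]

theorem polar_add_intCast (ρ θ : ℝ) (k : ℤ) : polar ρ (θ + k) = polar ρ θ := by
  rw [polar, circlePoint_add_intCast, polar]

theorem polar_eq_iff {ρ ρ' θ θ' : ℝ} (hρ : 0 ≤ ρ) (hρ' : 0 ≤ ρ') :
    polar ρ θ = polar ρ' θ' ↔ ρ = ρ' ∧ (ρ = 0 ∨ ∃ k : ℤ, θ = θ' + k) := by
  constructor
  · intro h
    have h1 : ρ = ρ' := by rw [← norm_polar hρ θ, h, norm_polar hρ']
    subst h1
    refine ⟨rfl, ?_⟩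
    rw [or_iff_not_imp_left]
    intro h0
    have hpos := hρ.lt_of_ne' h0
    have ha := norm_circlePoint_pos θ
    have hb := norm_circlePoint_pos θ'
    refine exists_eq_add_intCast_of_circlePoint_eq_smul (r := ‖circlePoint θ‖ / ‖circlePoint θ'‖)
      (by positivity) ?_
    have h2 := congrArg ((‖circlePoint θ‖ / ρ) • ·) h
    simp only [polar, smul_smul] at h2
    rw [div_mul_div_cancel₀ h0, div_self ha.ne', one_smul, div_mul_div_cancel₀ h0] at h2
    exact h2
  · rintro ⟨rfl, rfl | ⟨k, rfl⟩⟩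
    · rw [polar_zero, polar_zero]
    · rw [polar_add_intCast]

theorem exists_polar_eq (p : Fin 2 → ℝ) : ∃ θ, polar ‖p‖ θ = p := by
  by_cases hp : p = 0
  · exact ⟨0, by rw [hp, norm_zero, polar_zero]⟩
  let z : ℂ := ⟨p 0, p 1⟩
  have hz : z ≠ 0 := fun h => hp (by
    funext i
    fin_cases i
    · exact congrArg Complex.re h
    · exact congrArg Complex.im h)
  have hpi := Real.two_pi_pos.ne'
  have hpc : p = ‖z‖ • circlePoint (Complex.arg z / (2 * Real.pi)) := by
    have h : 2 * Real.pi * (Complex.arg z / (2 * Real.pi)) = Complex.arg z := mul_div_cancel₀ _ hpi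
    funext i
    rw [circlePoint, h]
    fin_cases i
    · exact (Complex.norm_mul_cos_arg z).symm
    · exact (Complex.norm_mul_sin_arg z).symm
  refine ⟨Complex.arg z / (2 * Real.pi), ?_⟩
  conv_rhs => rw [hpc]
  rw [polar]
  congr 1
  conv_lhs => rw [hpc]
  rw [norm_smul, norm_norm, mul_div_cancel_right₀ _ (norm_circlePoint_pos _).ne']

/-! ### Sectors: the part of a dual 2-cell in one tetrahedron -/

namespace FacePairing.Corner

open idealTetrahedron

variable {T : Type*} (c : Corner T)

/-- The point whose coordinates at `enter` and `exit` are `a` and `b` times the two others. -/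
def quad (a b : unitInterval) : idealTetrahedron :=
  ⟨fun v => (if v = c.enter then (a : ℝ) else if v = c.exit then (b : ℝ) else 1) / (2 + a + b), by
    have ha := a.2.1
    have hb := b.2.1
    have hsum : ∑ v, (if v = c.enter then (a : ℝ) else if v = c.exit then (b : ℝ) else 1) =
        2 + a + b := by
      have h : ∀ v, (if v = c.enter then (a : ℝ) else if v = c.exit then (b : ℝ) else 1) =
          1 + (if v = c.enter then (a : ℝ) - 1 else 0) + if v = c.exit then (b : ℝ) - 1 else 0 := by
        intro v
        have := c.ne
        split_ifs with h1 h2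
        · exact absurd (h1.symm.trans h2) this
        all_goals ring
      simp only [h, Finset.sum_add_distrib, Finset.sum_ite_eq', Finset.mem_univ, if_true,
        Finset.sum_const, Finset.card_fin, nsmul_eq_mul]
      push_cast
      ring
    refine ⟨⟨fun v => ?_, ?_⟩, fun v => ?_⟩
    · dsimp only
      split_ifs <;> positivity
    · rw [← Finset.sum_div, hsum, div_self (by positivity)]
    · have ha' := a.2.2
      have hb' := b.2.2
      rw [div_lt_one (by positivity)]
      split_ifs <;> linarith⟩

theorem quad_enter (a b : unitInterval) : (c.quad a b).1 c.enter = a / (2 + a + b) :=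
  congrArg (· / (2 + a + b : ℝ)) (if_pos rfl)

theorem quad_exit (a b : unitInterval) : (c.quad a b).1 c.exit = b / (2 + a + b) :=
  congrArg (· / (2 + a + b : ℝ)) ((if_neg c.ne.symm).trans (if_pos rfl))

theorem quad_of_ne (a b : unitInterval) {v : Fin 4} (h : v ≠ c.enter) (h' : v ≠ c.exit) :
    (c.quad a b).1 v = 1 / (2 + a + b) :=
  congrArg (· / (2 + a + b : ℝ)) ((if_neg h).trans (if_neg h'))

theorem exists_ne_ne : ∃ v, v ≠ c.enter ∧ v ≠ c.exit := by
  obtain ⟨v, -, hv⟩ := Finset.exists_mem_notMem_of_card_lt_card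
    (s := {c.enter, c.exit}) (t := Finset.univ) (by
      rw [Finset.card_pair c.ne, Finset.card_fin]
      norm_num)
  exact ⟨v, by simpa using hv⟩

theorem mem_low_quad (a b : unitInterval) {v : Fin 4} :
    v ∈ low (c.quad a b) ↔ v = c.enter ∧ a < 1 ∨ v = c.exit ∧ b < 1 := by
  have ha := a.2.1
  have hb := b.2.1
  have hpos : (0 : ℝ) < 2 + a + b := by positivity
  obtain ⟨w, hw, hw'⟩ := c.exists_ne_ne
  have hle : ∀ i, (c.quad a b).1 i ≤ 1 / (2 + a + b) := by
    intro i
    by_cases hi : i = c.enter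
    · rw [hi, quad_enter]
      exact div_le_div_of_nonneg_right a.2.2 hpos.le
    by_cases hi' : i = c.exit
    · rw [hi', quad_exit]
      exact div_le_div_of_nonneg_right b.2.2 hpos.le
    · rw [quad_of_ne _ _ _ hi hi']
  have h : v ∈ low (c.quad a b) ↔ (c.quad a b).1 v < 1 / (2 + a + b) := by
    rw [mem_low]
    exact ⟨fun ⟨i, hi⟩ => hi.trans_le (hle i), fun h => ⟨w, by rwa [quad_of_ne _ _ _ hw hw']⟩⟩
  rw [h]
  by_cases hi : v = c.enter
  · rw [hi, quad_enter, div_lt_div_iff_of_pos_right hpos]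
    simp only [true_and, c.ne, false_and, or_false]
    rfl
  by_cases hi' : v = c.exit
  · rw [hi', quad_exit, div_lt_div_iff_of_pos_right hpos]
    simp only [true_and, c.ne.symm, false_and, false_or]
    rfl
  · rw [quad_of_ne _ _ _ hi hi']
    simp [hi, hi']

theorem quad_eq_zero {a b : unitInterval} {v : Fin 4} (h : (c.quad a b).1 v = 0) :
    v = c.enter ∧ a = 0 ∨ v = c.exit ∧ b = 0 := by
  have ha := a.2.1
  have hb := b.2.1
  have hpos : (0 : ℝ) < 2 + a + b := by positivity
  by_cases hi : v = c.enter
  · rw [hi, quad_enter, div_eq_zero_iff, or_iff_left hpos.ne'] at h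
    exact .inl ⟨hi, Subtype.ext h⟩
  by_cases hi' : v = c.exit
  · rw [hi', quad_exit, div_eq_zero_iff, or_iff_left hpos.ne'] at h
    exact .inr ⟨hi', Subtype.ext h⟩
  · rw [quad_of_ne _ _ _ hi hi'] at h
    exact absurd h (by positivity)

theorem quad_injective {a b a' b' : unitInterval} (h : c.quad a b = c.quad a' b') :
    a = a' ∧ b = b' := by
  have ha := a.2.1
  have hb := b.2.1
  have hpos : (0 : ℝ) < 2 + a + b := by positivity
  obtain ⟨w, hw, hw'⟩ := c.exists_ne_ne
  have h1 := congrArg (fun x : idealTetrahedron => x.1 w) h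
  have h2 := congrArg (fun x : idealTetrahedron => x.1 c.enter) h
  have h3 := congrArg (fun x : idealTetrahedron => x.1 c.exit) h
  simp only [quad_enter, quad_exit, quad_of_ne _ _ _ hw hw', one_div, inv_inj] at h1 h2 h3
  rw [← h1, div_left_inj' hpos.ne'] at h2 h3
  exact ⟨Subtype.ext h2, Subtype.ext h3⟩

theorem exists_quad_eq {x : idealTetrahedron} (h : low x = {c.enter, c.exit}) :
    ∃ a < 1, ∃ b < 1, c.quad a b = x := by
  rw [low_eq_pair_iff] at h
  obtain ⟨w, hw, hw'⟩ := c.exists_ne_ne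
  obtain ⟨h1, h2⟩ := h.2 w hw hw'
  have h3 := nonneg x c.enter
  have h4 := nonneg x c.exit
  have hpos : 0 < x.1 w := h3.trans_lt h1
  have hsum : x.1 c.enter + x.1 c.exit + 2 * x.1 w = 1 := by
    have h5 : ∑ v, x.1 v = x.1 c.enter + (x.1 c.exit + 2 * x.1 w) := by
      rw [← Finset.add_sum_erase _ _ (Finset.mem_univ c.enter), ← Finset.add_sum_erase _ _
        (Finset.mem_erase.2 ⟨c.ne.symm, Finset.mem_univ c.exit⟩), Finset.sum_congr rfl fun j hj =>
          h.1 j w (Finset.ne_of_mem_erase (Finset.mem_of_mem_erase hj)) (Finset.ne_of_mem_erase hj)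
            hw hw', Finset.sum_const, Finset.card_erase_of_mem
          (Finset.mem_erase.2 ⟨c.ne.symm, Finset.mem_univ c.exit⟩),
        Finset.card_erase_of_mem (Finset.mem_univ _), Finset.card_fin, nsmul_eq_mul]
      norm_num
    rw [← add_assoc] at h5
    exact h5.symm.trans x.2.1.2
  have h6 : 2 + x.1 c.enter / x.1 w + x.1 c.exit / x.1 w = 1 / x.1 w := by
    field_simp
    linarith
  have ha : x.1 c.enter / x.1 w < 1 := (div_lt_one hpos).2 h1
  have hb : x.1 c.exit / x.1 w < 1 := (div_lt_one hpos).2 h2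
  refine ⟨⟨x.1 c.enter / x.1 w, by positivity, ha.le⟩, ha,
    ⟨x.1 c.exit / x.1 w, by positivity, hb.le⟩, hb, ?_⟩
  apply Subtype.ext
  funext i
  by_cases hi : i = c.enter
  · rw [hi, quad_enter]
    dsimp only
    rw [h6]
    field_simp
  by_cases hi' : i = c.exit
  · rw [hi', quad_exit]
    dsimp only
    rw [h6]
    field_simp
  · rw [quad_of_ne _ _ _ hi hi']
    dsimp only
    rw [h6, one_div_one_div]
    exact h.1 w i hw hw' hi hi'

theorem quad_swap (a b : unitInterval) : c.swap.quad a b = c.quad b a := by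
  have h := add_right_comm (2 : ℝ) b a
  apply Subtype.ext
  funext v
  by_cases hv : v = c.enter
  · rw [hv, quad_enter, h]
    exact c.swap.quad_exit a b
  by_cases hv' : v = c.exit
  · rw [hv', quad_exit, h]
    exact c.swap.quad_enter a b
  · rw [quad_of_ne _ _ _ hv hv', h]
    exact c.swap.quad_of_ne a b hv' hv

/-- The side `b = 0` lies in the face `exit`; beyond it, it is the side `a = 0` of the next corner.
-/
theorem permute_quad {P : FacePairing T} (a : unitInterval) :
    permute (P.perm c.tet c.exit) (c.quad a 0) = (P.step c).quad 0 a := by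
  have h := add_right_comm (2 : ℝ) a (0 : unitInterval)
  apply Subtype.ext
  funext v
  obtain ⟨w, rfl⟩ := (P.perm c.tet c.exit).surjective v
  rw [permute_apply, Equiv.symm_apply_apply]
  by_cases hw : w = c.enter
  · rw [hw, quad_enter, h]
    exact ((P.step c).quad_exit 0 a).symm
  by_cases hw' : w = c.exit
  · rw [hw', quad_exit, h]
    exact ((P.step c).quad_enter 0 a).symm
  · rw [quad_of_ne _ _ _ hw hw', h]
    exact ((P.step c).quad_of_ne 0 a ((P.perm c.tet c.exit).injective.ne hw')
      ((P.perm c.tet c.exit).injective.ne hw)).symm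

theorem continuous_quad {X : Type*} [TopologicalSpace X] {a b : X → unitInterval}
    (ha : Continuous a) (hb : Continuous b) : Continuous fun p => c.quad (a p) (b p) := by
  have ha' : Continuous fun p => (a p : ℝ) := continuous_subtype_val.comp ha
  have hb' : Continuous fun p => (b p : ℝ) := continuous_subtype_val.comp hb
  refine Continuous.subtype_mk (continuous_pi fun v => ?_) _
  refine Continuous.div ?_ ((continuous_const.add ha').add hb') fun p => ?_
  · split_ifs
    exacts [ha', hb', continuous_const]
  · have h1 := (a p).2.1
    have h2 := (b p).2.1
    positivity

end FacePairing.Corner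

namespace unitInterval

/-- The first coordinate of the path along two sides of the unit square from `(0, 1)` over `(1, 1)`
to `(1, 0)`. -/
def arm (s : unitInterval) : unitInterval :=
  ⟨min 1 (2 * s), le_min zero_le_one (mul_nonneg zero_le_two s.2.1), min_le_left _ _⟩

theorem continuous_arm : Continuous arm :=
  (continuous_const.min (continuous_const.mul continuous_subtype_val)).subtype_mk _

theorem arm_zero : arm 0 = 0 := Subtype.ext (by simp [arm])

theorem arm_one : arm 1 = 1 := Subtype.ext (by norm_num [arm])

theorem arm_eq_zero {s : unitInterval} (h : arm s = 0) : s = 0 := by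
  have h1 : min 1 (2 * (s : ℝ)) = 0 := congrArg Subtype.val h
  apply Subtype.ext
  change (s : ℝ) = 0
  rcases min_choice 1 (2 * (s : ℝ)) with h2 | h2 <;> rw [h2] at h1 <;> linarith

theorem arm_eq_one {s : unitInterval} (h : 1 / 2 ≤ (s : ℝ)) : arm s = 1 :=
  Subtype.ext (min_eq_left (by linarith))

theorem coe_arm_of_le {s : unitInterval} (h : (s : ℝ) ≤ 1 / 2) : (arm s : ℝ) = 2 * s :=
  min_eq_right (by linarith)

theorem arm_eq_one_or (s : unitInterval) : arm s = 1 ∨ arm (symm s) = 1 := by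
  rcases le_total (1 / 2) (s : ℝ) with h | h
  · exact .inl (arm_eq_one h)
  · exact .inr (arm_eq_one (by rw [coe_symm_eq]; linarith))

theorem arm_injective {s s' : unitInterval} (h : arm s = arm s')
    (h' : arm (symm s) = arm (symm s')) : s = s' := by
  have h1 : min 1 (2 * (s : ℝ)) = min 1 (2 * (s' : ℝ)) := congrArg Subtype.val h
  have h2 : min 1 (2 * (1 - s : ℝ)) = min 1 (2 * (1 - s' : ℝ)) := congrArg Subtype.val h'
  apply Subtype.ext
  rcases le_total (2 * (s : ℝ)) 1 with h3 | h3 <;> rcases le_total (2 * (s' : ℝ)) 1 with h4 | h4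
  · rw [min_eq_right h3, min_eq_right h4] at h1
    linarith
  · rw [min_eq_right h3, min_eq_left h4] at h1
    rw [min_eq_left (by linarith), min_eq_right (by linarith)] at h2
    linarith
  · rw [min_eq_left h3, min_eq_right h4] at h1
    rw [min_eq_right (by linarith), min_eq_left (by linarith)] at h2
    linarith
  · rw [min_eq_right (by linarith), min_eq_right (by linarith)] at h2
    linarith

theorem exists_arm_eq {r : unitInterval} : ∃ s, arm s = r ∧ arm (symm s) = 1 := by
  have h0 := r.2.1
  have h1 := r.2.2
  refine ⟨⟨r / 2, by positivity, by linarith⟩, Subtype.ext ?_, arm_eq_one ?_⟩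
  · rw [coe_arm_of_le (by dsimp only; linarith)]
    dsimp only
    ring
  · rw [coe_symm_eq]
    dsimp only
    linarith

/-- Rays from the origin meet the two far sides of the square, which `s` runs through; the radius is
the larger coordinate. -/
theorem exists_mul_arm_eq (a b : unitInterval) :
    ∃ s, a = max a b * arm s ∧ b = max a b * arm (symm s) := by
  have key : ∀ a b : unitInterval, a ≤ b → ∃ s, a = b * arm s ∧ arm (symm s) = 1 := by
    intro a b hab
    have ha := a.2.1
    have hb := b.2.1
    obtain ⟨s, hs, hs'⟩ := exists_arm_eq (r := ⟨a / b, by positivity, div_le_one_of_le₀ hab hb⟩)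
    refine ⟨s, Subtype.ext ?_, hs'⟩
    rw [hs]
    change (a : ℝ) = b * (a / b)
    rcases hb.eq_or_lt with h | h
    · have : (a : ℝ) ≤ b := hab
      rw [← h] at this ⊢
      linarith
    · field_simp
  rcases le_total a b with h | h
  · obtain ⟨s, h1, h2⟩ := key a b h
    refine ⟨s, ?_, ?_⟩
    · rwa [max_eq_right h]
    · rw [max_eq_right h, h2, mul_one]
  · obtain ⟨s, h1, h2⟩ := key b a h
    refine ⟨symm s, ?_, ?_⟩
    · rw [max_eq_left h, h2, mul_one]
    · rwa [max_eq_left h, symm_symm]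

end unitInterval

namespace FacePairing.Corner

open idealTetrahedron unitInterval

variable {T : Type*} (c : Corner T)

/-- Polar coordinates on the part of a dual 2-cell in one tetrahedron: the radius `ρ` and the
position `s` in the rotation from the face `enter` to the face `exit`. -/
def sector (ρ s : unitInterval) : idealTetrahedron :=
  c.quad (ρ * arm s) (ρ * arm (unitInterval.symm s))

theorem sector_zero (s : unitInterval) : c.sector 0 s = c.quad 0 0 := by
  rw [sector, zero_mul, zero_mul]

theorem sector_swap (ρ s : unitInterval) :
    c.swap.sector ρ s = c.sector ρ (unitInterval.symm s) := by
  rw [sector, quad_swap, sector, unitInterval.symm_symm]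

theorem permute_sector {P : FacePairing T} (ρ : unitInterval) :
    permute (P.perm c.tet c.exit) (c.sector ρ 1) = (P.step c).sector ρ 0 := by
  rw [sector, sector, unitInterval.symm_one, unitInterval.symm_zero, arm_zero, arm_one, mul_one,
    mul_zero, permute_quad]

theorem low_sector {ρ : unitInterval} (hρ : ρ < 1) (s : unitInterval) :
    low (c.sector ρ s) = {c.enter, c.exit} := by
  have h : ∀ r, ρ * r < 1 := fun r => lt_of_le_of_lt unitInterval.mul_le_left hρ
  ext v
  rw [sector, mem_low_quad]
  simp [h]

/-- At radius 1 one of the two ratios is 1, so at most one coordinate stays low. -/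
theorem low_sector_one (s : unitInterval) :
    low (c.sector 1 s) = ∅ ∨ low (c.sector 1 s) = {c.enter} ∨ low (c.sector 1 s) = {c.exit} := by
  have key : ∀ a b : unitInterval, a = 1 ∨ b = 1 →
      low (c.quad a b) = ∅ ∨ low (c.quad a b) = {c.enter} ∨ low (c.quad a b) = {c.exit} := by
    intro a b h
    rcases eq_or_lt_of_le (unitInterval.le_one' (t := a)) with ha | ha
    · rcases eq_or_lt_of_le (unitInterval.le_one' (t := b)) with hb | hb
      · exact .inl (by ext v; rw [mem_low_quad]; simp [ha, hb])
      · exact .inr (.inr (by ext v; rw [mem_low_quad]; simp [ha, hb]))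
    · have hb := h.resolve_left ha.ne
      exact .inr (.inl (by ext v; rw [mem_low_quad]; simp [ha, hb]))
  rw [sector, one_mul, one_mul]
  exact key _ _ (arm_eq_one_or s)

theorem sector_eq_zero {ρ s : unitInterval} {v : Fin 4} (h : (c.sector ρ s).1 v = 0) :
    v = c.enter ∧ (ρ = 0 ∨ s = 0) ∨ v = c.exit ∧ (ρ = 0 ∨ s = 1) := by
  rcases c.quad_eq_zero h with ⟨h1, h2⟩ | ⟨h1, h2⟩
  · exact .inl ⟨h1, (mul_eq_zero.1 h2).imp_right arm_eq_zero⟩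
  · refine .inr ⟨h1, (mul_eq_zero.1 h2).imp_right fun h3 => ?_⟩
    exact unitInterval.symm_eq_zero.1 (arm_eq_zero h3)

theorem sector_injective {ρ s ρ' s' : unitInterval} (h : c.sector ρ s = c.sector ρ' s') :
    ρ = ρ' ∧ (ρ = 0 ∨ s = s') := by
  have hmax : ∀ ρ s : unitInterval, max (ρ * arm s) (ρ * arm (unitInterval.symm s)) = ρ := by
    intro ρ s
    rcases arm_eq_one_or s with h | h
    · rw [h, mul_one, max_eq_left unitInterval.mul_le_left]
    · rw [h, mul_one, max_eq_right unitInterval.mul_le_left]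
  obtain ⟨h1, h2⟩ := c.quad_injective h
  have h3 : ρ = ρ' := by rw [← hmax ρ s, h1, h2, hmax]
  subst h3
  refine ⟨rfl, or_iff_not_imp_left.2 fun h0 => ?_⟩
  exact arm_injective (mul_left_cancel₀ h0 h1) (mul_left_cancel₀ h0 h2)

theorem exists_sector_eq {x : idealTetrahedron} (h : low x = {c.enter, c.exit}) :
    ∃ ρ < 1, ∃ s, c.sector ρ s = x := by
  obtain ⟨a, ha, b, hb, rfl⟩ := c.exists_quad_eq h
  obtain ⟨s, h1, h2⟩ := exists_mul_arm_eq a b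
  exact ⟨max a b, max_lt ha hb, s, by rw [sector, ← h1, ← h2]⟩

theorem continuous_sector : Continuous fun p : unitInterval × unitInterval => c.sector p.1 p.2 :=
  c.continuous_quad (continuous_fst.mul (continuous_arm.comp continuous_snd))
    (continuous_fst.mul (continuous_arm.comp (unitInterval.continuous_symm.comp continuous_snd)))

end FacePairing.Corner

/-! ### Characteristic maps of the 2-cells -/

namespace FacePairing

variable {T : Type*} (P : FacePairing T)

theorem exists_period [Finite T] (c : Corner T) : ∃ n : ℕ, 0 < n ∧ ∀ m m' : ℤ,
    (P.stepPerm ^ m) c = (P.stepPerm ^ m') c ↔ ∃ k : ℤ, m = m' + k * n := by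
  refine ⟨Function.minimalPeriod (P.stepPerm • ·) c, ?_, fun m m' => ?_⟩
  · exact Function.minimalPeriod_pos_of_mem_periodicPts
      (P.stepPerm.injective.mem_periodicPts c)
  · have h := MulAction.zpow_smul_eq_iff_minimalPeriod_dvd (a := P.stepPerm) (b := c) (n := m - m')
    have h2 : (P.stepPerm ^ m) c = (P.stepPerm ^ m') c ↔ P.stepPerm ^ (m - m') • c = c := by
      rw [sub_eq_neg_add, zpow_add, zpow_neg, Equiv.Perm.smul_def, Equiv.Perm.mul_apply,
        Equiv.Perm.inv_eq_iff_eq]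
    rw [h2, h]
    constructor
    · rintro ⟨k, hk⟩
      exact ⟨k, by rw [mul_comm]; omega⟩
    · rintro ⟨k, rfl⟩
      exact ⟨k, by ring⟩

end FacePairing

theorem exists_mem_Ico_polar_eq {n : ℕ} (hn : 0 < n) {p : Fin 2 → ℝ} (hp : ‖p‖ ≤ 1) :
    ∃ m : ℤ, m ∈ Set.Ico (0 : ℤ) n ∧ ∃ ρ s : unitInterval, polar ρ ((m + s) / n) = p := by
  obtain ⟨θ, hθ⟩ := exists_polar_eq p
  have hn' : (0 : ℤ) < n := by exact_mod_cast hn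
  have hnR : (n : ℝ) ≠ 0 := by exact_mod_cast hn.ne'
  -- The integral part of `θ * n` selects the sector, modulo a full turn; the fractional part is the
  -- position in it.
  refine ⟨⌊θ * n⌋ % n, ⟨Int.emod_nonneg _ hn'.ne', Int.emod_lt_of_pos _ hn'⟩,
    ⟨‖p‖, norm_nonneg p, hp⟩, ⟨Int.fract (θ * n), Int.fract_nonneg _, (Int.fract_lt_one _).le⟩, ?_⟩
  have h : (((⌊θ * n⌋ % n : ℤ) : ℝ) + Int.fract (θ * n)) / n = θ + (-(⌊θ * n⌋ / n) : ℤ) := by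
    have h1 := Int.mul_ediv_add_emod ⌊θ * n⌋ n
    have h2 : (n : ℝ) * ((⌊θ * n⌋ / n : ℤ) : ℝ) + ((⌊θ * n⌋ % n : ℤ) : ℝ) = ⌊θ * n⌋ := by
      exact_mod_cast h1
    have h3 := Int.floor_add_fract (θ * n)
    rw [div_eq_iff hnR]
    push_cast
    linarith
  dsimp only
  rw [h, polar_add_intCast, hθ]

namespace IdealCellulation

open idealTetrahedron Metric FacePairing

variable {M : Type*} [TopologicalSpace M] {T : Type*} (𝒞 : IdealCellulation M T)

/-- The dual 2-cell around a corner, in polar coordinates; the angle `m + s` is measured in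
tetrahedra. -/
def wheel (c : Corner T) (k : ℤ × unitInterval × unitInterval) : M :=
  𝒞.point ((𝒞.stepPerm ^ k.1) c).tet (((𝒞.stepPerm ^ k.1) c).sector k.2.1 k.2.2)

theorem continuous_wheel (c : Corner T) : Continuous (𝒞.wheel c) := by
  rw [continuous_prod_of_discrete_left]
  exact fun m => (𝒞.continuous_point ((𝒞.stepPerm ^ m) c).tet).comp
    ((𝒞.stepPerm ^ m) c).continuous_sector

theorem stepPerm_zpow_add_one (c : Corner T) (m : ℤ) :
    (𝒞.stepPerm ^ (m + 1)) c = 𝒞.step ((𝒞.stepPerm ^ m) c) := by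
  rw [add_comm, zpow_add, zpow_one, Equiv.Perm.mul_apply, stepPerm_apply]

theorem wheel_one (c : Corner T) (m : ℤ) (ρ : unitInterval) :
    𝒞.wheel c (m, ρ, 1) = 𝒞.wheel c (m + 1, ρ, 0) := by
  have h0 : (((𝒞.stepPerm ^ m) c).sector ρ 1).1 ((𝒞.stepPerm ^ m) c).exit = 0 := by
    rw [Corner.sector, Corner.quad_exit, unitInterval.symm_one, unitInterval.arm_zero, mul_zero]
    simp
  have h1 : 𝒞.wheel c (m + 1, ρ, 0) = 𝒞.point (𝒞.step ((𝒞.stepPerm ^ m) c)).tet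
      ((𝒞.step ((𝒞.stepPerm ^ m) c)).sector ρ 0) := by
    rw [← stepPerm_zpow_add_one]
    rfl
  rw [h1, ← Corner.permute_sector]
  exact 𝒞.point_eq _ _ _ h0

/-- The tip of every sector is the midpoint of its tetrahedron edge; neighbouring tips agree because
neighbouring sectors share a side. -/
theorem wheel_zero (c : Corner T) (m m' : ℤ) (s s' : unitInterval) :
    𝒞.wheel c (m, 0, s) = 𝒞.wheel c (m', 0, s') := by
  have h : ∀ m s, 𝒞.wheel c (m, 0, s) = 𝒞.wheel c (m, 0, 0) := fun m s => by
    rw [wheel, wheel, Corner.sector_zero, Corner.sector_zero]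
  have h' : ∀ m, 𝒞.wheel c (m, 0, 0) = 𝒞.wheel c (0, 0, 0) := by
    intro m
    induction m with
    | zero => rfl
    | succ m ih => rw [← wheel_one, h, ih]
    | pred m ih => rw [← ih, ← h _ 1, wheel_one, sub_add_cancel]
  rw [h, h', ← h' m', ← h m' s']

/-- After removing full turns, the integral parts differ by at most one, and a difference of one
occurs only on the common side of neighbouring sectors. -/
theorem wheel_eq {c : Corner T} {n : ℕ} (hn : ∀ m m' : ℤ,
      (𝒞.stepPerm ^ m) c = (𝒞.stepPerm ^ m') c ↔ ∃ k : ℤ, m = m' + k * n) {m m' : ℤ}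
    {ρ s s' : unitInterval} (h : ρ = 0 ∨ ∃ k : ℤ, (m + s : ℝ) = m' + s' + k * n) :
    𝒞.wheel c (m, ρ, s) = 𝒞.wheel c (m', ρ, s') := by
  rcases h with rfl | ⟨k, hk⟩
  · exact 𝒞.wheel_zero c m m' s s'
  have hper : ∀ s, 𝒞.wheel c (m' + k * n, ρ, s) = 𝒞.wheel c (m', ρ, s) := fun s => by
    rw [wheel, wheel, (hn (m' + k * n) m').2 ⟨k, rfl⟩]
  rw [← hper]
  generalize hl : m' + k * n = l
  have hl' : (l : ℝ) = m' + k * n := by rw [← hl]; push_cast; ring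
  have h0 := s.2.1
  have h1 := s.2.2
  have h0' := s'.2.1
  have h1' := s'.2.2
  have h2 : -1 ≤ l - m := by
    have : (-1 : ℝ) ≤ ((l - m : ℤ) : ℝ) := by push_cast; linarith
    exact_mod_cast this
  have h3 : l - m ≤ 1 := by
    have : ((l - m : ℤ) : ℝ) ≤ (1 : ℝ) := by push_cast; linarith
    exact_mod_cast this
  have h4 : l = m ∨ l = m + 1 ∨ m = l + 1 := by omega
  rcases h4 with rfl | rfl | rfl
  · obtain rfl : s = s' := Subtype.ext (by linarith)
    rfl
  · push_cast at hl'
    obtain rfl : s = 1 := Subtype.ext (by change (s : ℝ) = 1; linarith)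
    obtain rfl : s' = 0 := Subtype.ext (by change (s' : ℝ) = 0; linarith)
    exact 𝒞.wheel_one c m ρ
  · push_cast at hk
    obtain rfl : s = 0 := Subtype.ext (by change (s : ℝ) = 0; linarith)
    obtain rfl : s' = 1 := Subtype.ext (by change (s' : ℝ) = 1; linarith)
    exact (𝒞.wheel_one c l ρ).symm

/-- The invariant `Q` says that the point is seen only in sectors of this wheel, at the same angle
unless it is the centre. Two sectors in the same tetrahedron edge with opposite directions are
excluded by `stepPerm_zpow_ne_swap`. -/
theorem eq_of_wheel_eq {c : Corner T} {n : ℕ} (hn : ∀ m m' : ℤ,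
      (𝒞.stepPerm ^ m) c = (𝒞.stepPerm ^ m') c ↔ ∃ k : ℤ, m = m' + k * n) {m m' : ℤ}
    {ρ ρ' s s' : unitInterval} (hρ : ρ < 1) (hρ' : ρ' < 1)
    (h : 𝒞.wheel c (m, ρ, s) = 𝒞.wheel c (m', ρ', s')) :
    ρ = ρ' ∧ (ρ = 0 ∨ ∃ k : ℤ, (m + s : ℝ) = m' + s' + k * n) := by
  have hQ := 𝒞.rel_of_point_eq (Q := fun t x => ∃ l : ℤ, ((𝒞.stepPerm ^ l) c).tet = t ∧
    ∃ r, ((𝒞.stepPerm ^ l) c).sector ρ r = x ∧ (ρ = 0 ∨ (m + s : ℝ) = l + r)) ?_ h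
    ⟨m, rfl, s, rfl, .inr rfl⟩
  · obtain ⟨l, ht, r, hx, hl⟩ := hQ
    have h1 : ({((𝒞.stepPerm ^ l) c).enter, ((𝒞.stepPerm ^ l) c).exit} : Finset (Fin 4)) =
        {((𝒞.stepPerm ^ m') c).enter, ((𝒞.stepPerm ^ m') c).exit} := by
      rw [← Corner.low_sector _ hρ r, hx, Corner.low_sector _ hρ']
    have h2 : ({((𝒞.stepPerm ^ l) c).enter, ((𝒞.stepPerm ^ l) c).exit} : Set (Fin 4)) =
        {((𝒞.stepPerm ^ m') c).enter, ((𝒞.stepPerm ^ m') c).exit} := by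
      simpa using congrArg (fun B : Finset (Fin 4) => (B : Set (Fin 4))) h1
    rcases Set.pair_eq_pair_iff.1 h2 with ⟨h3, h4⟩ | ⟨h3, h4⟩
    · have h5 : (𝒞.stepPerm ^ l) c = (𝒞.stepPerm ^ m') c := Corner.ext ht h3 h4
      rw [h5] at hx
      obtain ⟨rfl, h6⟩ := Corner.sector_injective _ hx
      obtain ⟨k, rfl⟩ := (hn _ _).1 h5
      refine ⟨rfl, ?_⟩
      rcases hl with h0 | hl
      · exact .inl h0
      · refine h6.imp_right fun h6 => ⟨k, ?_⟩
        rw [hl, h6]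
        push_cast
        ring
    · have h5 : (𝒞.stepPerm ^ l) c = ((𝒞.stepPerm ^ m') c).swap := Corner.ext ht h3 h4
      rw [← sub_add_cancel l m', zpow_add, Equiv.Perm.mul_apply] at h5
      exact absurd h5 (𝒞.stepPerm_zpow_ne_swap _ _)
  · rintro _ i _ hi ⟨l, rfl, r, rfl, hl⟩
    rcases Corner.sector_eq_zero _ hi with ⟨rfl, h0⟩ | ⟨rfl, h0⟩
    · obtain ⟨d, hd⟩ : ∃ d, d = (𝒞.stepPerm ^ (l - 1)) c := ⟨_, rfl⟩
      have hd' : (𝒞.stepPerm ^ l) c = 𝒞.step d := by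
        rw [hd, ← stepPerm_zpow_add_one, sub_add_cancel]
      have hr : (𝒞.step d).sector ρ r = (𝒞.step d).sector ρ 0 := by
        rcases h0 with rfl | rfl
        · rw [Corner.sector_zero, Corner.sector_zero]
        · rfl
      -- A point of the face `enter` is also the end `s = 1` of the preceding sector.
      refine ⟨l - 1, ?_, 1, ?_, ?_⟩
      · rw [hd', ← hd]
        exact (𝒞.glue_glue _ _).symm
      · rw [hd', ← hd, hr, ← Corner.permute_sector]
        have h7 : 𝒞.perm (𝒞.step d).tet (𝒞.step d).enter = (𝒞.perm d.tet d.exit).symm :=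
          𝒞.perm_perm _ _
        rw [h7]
        exact (permute_symm_permute _ _).symm
      · rcases h0 with h0 | rfl
        · exact .inl h0
        · refine hl.imp_right fun hl => ?_
          rw [hl]
          push_cast
          simp
    · refine ⟨l + 1, ?_, 0, ?_, ?_⟩
      · rw [stepPerm_zpow_add_one]
        rfl
      · rw [stepPerm_zpow_add_one, ← Corner.permute_sector]
        rcases h0 with rfl | rfl
        · rw [Corner.sector_zero, Corner.sector_zero]
        · rfl
      · rcases h0 with h0 | rfl
        · exact .inl h0
        · refine hl.imp_right fun hl => ?_
          rw [hl]
          push_cast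
          simp

theorem image_wheel (c : Corner T) :
    𝒞.wheel c '' {k | k.2.1 < 1} = 𝒞.openDualFace (𝒞.dualFace c) := by
  ext m
  constructor
  · rintro ⟨⟨l, ρ, s⟩, hρ, rfl⟩
    exact 𝒞.point_mem_openDualCell (n := 2).2
      ⟨_, _, ((𝒞.stepPerm ^ l) c).ne, Corner.low_sector _ hρ s, 𝒞.dualFace_zpow c l⟩
  · intro hm
    obtain ⟨t, x, rfl, i, j, hij, hx, hd⟩ := 𝒞.mem_openDualCell (n := 2).1 hm
    obtain ⟨ρ, hρ, s, rfl⟩ := Corner.exists_sector_eq ⟨t, i, j, hij⟩ hx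
    have key : ∀ d : Corner T, 𝒞.dualFace c = 𝒞.dualFace d →
        𝒞.point d.tet (d.sector ρ s) ∈ 𝒞.wheel c '' {k | k.2.1 < 1} := by
      intro d hd
      obtain ⟨l, rfl | rfl⟩ := 𝒞.dualFace_eq_iff.1 hd
      · exact ⟨(l, ρ, s), hρ, rfl⟩
      · rw [Corner.sector_swap]
        exact ⟨(l, ρ, unitInterval.symm s), hρ, rfl⟩
    exact key ⟨t, i, j, hij⟩ hd.symm

theorem wheel_mem_of_eq_one (c : Corner T) (m : ℤ) (s : unitInterval) :
    𝒞.wheel c (m, 1, s) ∈ ⋃ (n < 2) (j : 𝒞.DualCell n), 𝒞.openDualCell n j := by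
  generalize hd : (𝒞.stepPerm ^ m) c = d
  rw [wheel, hd]
  rcases d.low_sector_one s with h | h | h
  · exact Set.mem_iUnion₂.2 ⟨0, zero_lt_two, Set.mem_iUnion.2 ⟨d.tet,
      𝒞.point_mem_openDualCell.2 ⟨h, rfl⟩⟩⟩
  · exact Set.mem_iUnion₂.2 ⟨1, one_lt_two, Set.mem_iUnion.2 ⟨𝒞.dualEdge (d.tet, d.enter),
      𝒞.point_mem_openDualCell.2 ⟨_, h, rfl⟩⟩⟩
  · exact Set.mem_iUnion₂.2 ⟨1, one_lt_two, Set.mem_iUnion.2 ⟨𝒞.dualEdge (d.tet, d.exit),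
      𝒞.point_mem_openDualCell.2 ⟨_, h, rfl⟩⟩⟩

theorem exists_face_char [Finite T] (e : 𝒞.DualFace) : ∃ f : (Fin 2 → ℝ) → M,
    ContinuousOn f (closedBall 0 1) ∧ Set.InjOn f (ball 0 1) ∧
    f '' ball 0 1 = 𝒞.openDualCell 2 e ∧
    Set.MapsTo f (sphere 0 1) (⋃ (m < 2) (j : 𝒞.DualCell m), 𝒞.openDualCell m j) := by
  obtain ⟨c, rfl⟩ := Quot.exists_rep e
  obtain ⟨n, hn, hper⟩ := 𝒞.exists_period c
  have hnR : (n : ℝ) ≠ 0 := by exact_mod_cast hn.ne'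
  let g : ℤ × unitInterval × unitInterval → (Fin 2 → ℝ) := fun k => polar k.2.1 ((k.1 + k.2.2) / n)
  have hg : Continuous g := by
    rw [continuous_prod_of_discrete_left]
    intro m
    have h1 : Continuous fun p : unitInterval × unitInterval => (p.1 : ℝ) := by fun_prop
    have h2 : Continuous fun p : unitInterval × unitInterval => ((m : ℝ) + p.2) / n := by fun_prop
    exact continuous_polar h1 h2
  have hgeq : ∀ k k', g k = g k' ↔ k.2.1 = k'.2.1 ∧
      (k.2.1 = 0 ∨ ∃ j : ℤ, (k.1 + k.2.2 : ℝ) = k'.1 + k'.2.2 + j * n) := by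
    intro k k'
    have h0 : (k.2.1 : ℝ) = 0 ↔ k.2.1 = 0 := ⟨fun h => Subtype.ext h, congrArg Subtype.val⟩
    refine (polar_eq_iff k.2.1.2.1 k'.2.1.2.1).trans (and_congr Subtype.ext_iff.symm
      (or_congr h0 (exists_congr fun j => ?_)))
    rw [div_add' _ _ _ hnR, div_left_inj' hnR]
  have hgh : ∀ k k', g k = g k' → 𝒞.wheel c k = 𝒞.wheel c k' := by
    rintro ⟨m, ρ, s⟩ ⟨m', ρ', s'⟩ h
    obtain ⟨rfl, h'⟩ := (hgeq _ _).1 h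
    exact 𝒞.wheel_eq hper h'
  have : Nonempty M := ⟨𝒞.wheel c (0, 0, 0)⟩
  -- The wheel is parametrised over all integers, but compactness needs finitely many sectors; one
  -- full turn already covers the disc.
  obtain ⟨f, hf, hfg⟩ := ((Set.finite_Ico (0 : ℤ) n).isCompact.prod
    (isCompact_univ (X := unitInterval × unitInterval))).exists_continuousOn_factor hg
      (𝒞.continuous_wheel c) hgh
  have hnorm : ∀ k, ‖g k‖ = k.2.1 := fun k => norm_polar k.2.1.2.1 _
  have hsurj : ∀ p : Fin 2 → ℝ, ‖p‖ ≤ 1 → ∃ k ∈ Set.Ico (0 : ℤ) n ×ˢ Set.univ, g k = p := by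
    intro p hp
    obtain ⟨m, hm, ρ, s, h⟩ := exists_mem_Ico_polar_eq hn hp
    exact ⟨(m, ρ, s), ⟨hm, trivial⟩, h⟩
  refine ⟨f, hf.mono fun p hp => hsurj p (mem_closedBall_zero_iff.1 hp), ?_, ?_, ?_⟩
  · intro p hp p' hp' hpp
    obtain ⟨k, -, rfl⟩ := hsurj p (mem_ball_zero_iff.1 hp).le
    obtain ⟨k', -, rfl⟩ := hsurj p' (mem_ball_zero_iff.1 hp').le
    rw [mem_ball_zero_iff, hnorm] at hp hp'
    rw [hfg, hfg] at hpp
    exact (hgeq k k').2 (𝒞.eq_of_wheel_eq hper hp hp' hpp)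
  · refine Eq.trans ?_ (𝒞.image_wheel c)
    ext m
    constructor
    · rintro ⟨p, hp, rfl⟩
      obtain ⟨k, -, rfl⟩ := hsurj p (mem_ball_zero_iff.1 hp).le
      rw [mem_ball_zero_iff, hnorm] at hp
      exact ⟨k, hp, (hfg k).symm⟩
    · rintro ⟨k, hk, rfl⟩
      exact ⟨g k, by rw [mem_ball_zero_iff, hnorm]; exact hk, hfg k⟩
  · intro p hp
    rw [mem_sphere_zero_iff_norm] at hp
    obtain ⟨⟨m, ρ, s⟩, -, rfl⟩ := hsurj p hp.le
    rw [hnorm] at hp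
    obtain rfl : ρ = 1 := Subtype.ext hp
    rw [hfg]
    exact 𝒞.wheel_mem_of_eq_one c m s

/-- The dual 2-skeleton is a 2-dimensional CW complex with the expected open cells. -/
theorem exists_CWComplex_dualSkeleton [T2Space M] [Finite T] :
    ∃ _ : Topology.CWComplex 𝒞.dualSkeleton,
      ∃ e : ∀ n, Topology.CWComplex.cell 𝒞.dualSkeleton n ≃ 𝒞.DualCell n,
        ∀ n c, Topology.CWComplex.openCell (C := 𝒞.dualSkeleton) n c =
          𝒞.openDualCell n (e n c) := by
  refine Topology.CWComplex.exists_of_finite_partition (N := 2) (fun n => 𝒞.isEmpty_dualCell)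
    𝒞.openDualCell 𝒞.openDualCell_unique ?_ 𝒞.iUnion_openDualCell
  intro n i
  match n, i with
  | 0, t => exact 𝒞.exists_vertex_char t
  | 1, e => exact 𝒞.exists_edge_char e
  | 2, c => exact 𝒞.exists_face_char c
  | _ + 3, i => exact i.elim

end IdealCellulation

end

/-! ### The theorem -/

theorem mainTheorem7 {M : Type*} [TopologicalSpace M] [T2Space M] [SecondCountableTopology M]
    [ChartedSpace (EuclideanSpace ℝ (Fin 3)) M] {T : Type*} [Finite T]
    (𝒞 : IdealCellulation M T) :
    IsDeformationRetract 𝒞.dualSkeleton ∧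
    (∃ _ : Topology.CWComplex 𝒞.dualSkeleton,
      ∃ e₀ : Topology.CWComplex.cell 𝒞.dualSkeleton 0 ≃ T,
      ∃ e₁ : Topology.CWComplex.cell 𝒞.dualSkeleton 1 ≃ 𝒞.DualEdge,
      ∃ e₂ : Topology.CWComplex.cell 𝒞.dualSkeleton 2 ≃ 𝒞.DualFace,
        (∀ n, 2 < n → IsEmpty (Topology.CWComplex.cell 𝒞.dualSkeleton n)) ∧
        (∀ c, Topology.CWComplex.openCell (C := 𝒞.dualSkeleton) 0 c = {𝒞.dualVertex (e₀ c)}) ∧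
        (∀ c, Topology.CWComplex.openCell (C := 𝒞.dualSkeleton) 1 c = 𝒞.openDualEdge (e₁ c)) ∧
        (∀ c, Topology.CWComplex.openCell (C := 𝒞.dualSkeleton) 2 c = 𝒞.openDualFace (e₂ c))) ∧
    ∀ S : Set 𝒞.DualEdge, 𝒞.IsSpanningTree S →
      ∀ orient : 𝒞.DualEdge → T × Fin 4, (∀ e, 𝒞.dualEdge (orient e) = e) →
      ∀ corner : 𝒞.DualFace → FacePairing.Corner T, (∀ c, 𝒞.dualFace (corner c) = c) →
      ∀ t₀ : T,
        ∃ φ : PresentedGroup (𝒞.relators S orient corner) ≃*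
            FundamentalGroup M (𝒞.dualVertex t₀),
          ∀ (e : {e : 𝒞.DualEdge // e ∉ S})
            (p : 𝒞.Walk t₀ (orient e).1)
            (q : 𝒞.Walk (𝒞.glue (orient e).1 (orient e).2) t₀),
            (∀ a ∈ p.edges, a ∈ S) → (∀ a ∈ q.edges, a ∈ S) →
            φ (PresentedGroup.of e) = FundamentalGroup.fromPath (Path.Homotopic.Quotient.mk
              ((𝒞.walkPath p).trans
                ((𝒞.edgePath (orient e).1 (orient e).2).trans (𝒞.walkPath q)))) := by
  refine ⟨𝒞.isDeformationRetract_dualSkeleton, ?_, fun S hS orient horient corner hcorner t₀ =>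
    𝒞.exists_fundamentalGroup_presentation hS horient hcorner t₀⟩
  obtain ⟨h, e, he⟩ := 𝒞.exists_CWComplex_dualSkeleton
  exact ⟨h, e 0, e 1, e 2, fun n hn => (e n).isEmpty_congr.2 (𝒞.isEmpty_dualCell hn), he 0, he 1,
    he 2⟩
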